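/- All graphs are finite and simple; $N(v)$ is the neighbourhood of $v$ and $G[A]$ the subgraph induced by $A$. For $n\ge 2$ put $\alpha=96\ln n$, $\mu_R=(10^6\ln n)^{-1}$, $\mu_H(r)=\tfrac12 e^{\frac{\alpha}{2}(r-1/2)}$ if $r\le\tfrac12$ and $\mu_H(r)=1-\tfrac12 e^{-\frac{\alpha}{2}(r-1/2)}$ if $r>\tfrac12$, and $\mu_F(r)=\max\{r/4,0\}$ if $r\le 4$, $\mu_F(r)=1$ if $r>4$. All random choices below are independent. $\mathtt{MatchHeavy}(H,F)$: every $v\in F$ picks a uniformly random $v_\star\in N(v)\cap H$; every vertex of $H\cup F$ is coloured red or blue with probability $\tfrac12$ each; $E_\star$ is the set of edges $(v,v_\star)$ with $v\in F$ red and $v_\star\in H$ blue. For every blue vertex incident to an edge of $E_\star$ select one such edge (arbitrarily); return the selected edges. $\mathtt{GlobalAlg}(G[V'],\Delta)$: start with $M=\emptyset$. While $\Delta\ge 1$: let $H$ be the set of $v\in V'$ of degree at least $\Delta/2$ in $G[V']$; put every $v\in V'$ into $F$ with probability $|N(v)\cap H|/(4\Delta)$; add the output of $\mathtt{MatchHeavy}(H,F)$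 to $M$; replace $V'$ by $V'\setminus(H\cup F)$ and $\Delta$ by $\Delta/2$. Return $M$. $\mathtt{LocalPhase}(G[A],\Delta)$, inside a graph on $n$ vertices: put every $v\in A$ into $R$ with probability $\mu_R$; then every $v\in A$ into $H$ with probability $\mu_H\big(|N(v)\cap R|/(\mu_R\Delta)\big)$; then every $v\in A$ into $F$ with probability $\mu_F\big(|N(v)\cap H|/\Delta\big)$; compute an (arbitrary) maximal matching $M$ of $G[H\cup F]$; return $(A\setminus(R\cup H\cup F),\,M)$. $\mathtt{ParallelAlg}(G,S)$, for a graph $G=(V,E)$ on $n\ge2$ vertices and an integer $1\le S\le n$: start with $\Delta=n$, $V'=V$, $M=\emptyset$. While $\Delta\ge\frac nS(200\ln n)^{32}$: let $m=\lfloor\sqrt{n\Delta/S}\rfloor$ and $\tau=\lceil\frac1{16}\log_{120\alpha}(\Delta/m)\rceil$; assign every vertex of $V'$ uniformly at random to one of $m$ sets $V_1,\dots,V_m$; for each $i$, set $V_i=\emptyset$ if $G[V_i]$ has more than $8S$ edges, and then for $j=1,\dots,\tau$ in turn set $(V_i,M_{i,j})=\mathtt{LocalPhase}(G[V_i],\Delta/(2^{j-1}m))$;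 replace $V'$ by $\bigcup_i V_i$, add all $M_{i,j}$ to $M$, and replace $\Delta$ by $\Delta/2^\tau$. After the loop, remove from $V'$ all vertices of degree at least $2\Delta$ in $G[V']$ and return $M\cup\mathtt{GlobalAlg}(G[V'],2\Delta)$. **Claim.** There are absolute constants $C>0$ and $p>0$ such that the following holds for every $\varepsilon>0$, every graph $G$ on $n\ge 2$ vertices, every integer $1\le S\le n$, and every (possibly randomized) way of making the arbitrary choices of a maximal matching of a given graph in $\mathtt{LocalPhase}$ and of edges of a given $E_\star$ in $\mathtt{MatchHeavy}$. Execute $\mathtt{ParallelAlg}(\cdot,S)$ successively $\lceil C\max\{1,\ln(1/\varepsilon)\}\rceil$ times, starting from $G$, with fresh randomness each time, and after each execution remove the matching found, i.e. delete all edges incident to a matched vertex (the vertex set, hence $n$, stays the same). Then the union $M$ of the matchings found is always a matching of $G$, and with probability at least $p$ it is a $(2+\varepsilon)$-approximate maximum matching of $G$, i.e. $|M_{\mathrm{OPT}}|\le(2+\varepsilon)|M|$ for every maximum matching $M_{\mathrm{OPT}}$ of $G$. -/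

import Mathlib

namespace RoundCompression

noncomputable section

open scoped Classical

/-! ### Matchings, as finite sets of edges -/

section Matchings

variable {V : Type*}

/-- `M` is a matching of `G`: a set of edges of `G`, no two of which share an endpoint. -/
def IsMatching (G : SimpleGraph V) (M : Finset (Sym2 V)) : Prop :=
  (∀ e ∈ M, e ∈ G.edgeSet) ∧ ∀ e ∈ M, ∀ f ∈ M, ∀ v : V, v ∈ e → v ∈ f → e = f

/-- `M` is a `c`-approximate maximum matching of `G`: it is a matching of `G`, and no matching of
`G` has more than `c * |M|` edges. -/
def IsApproxMaximumMatching (c : ℝ) (G : SimpleGraph V) (M : Finset (Sym2 V)) : Prop :=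
  IsMatching G M ∧ ∀ N : Finset (Sym2 V), IsMatching G N → (N.card : ℝ) ≤ c * (M.card : ℝ)

/-- The graph `G[A]` induced by `A`, kept on the vertex type `V` (vertices outside `A` are
isolated). -/
def inducedOn (G : SimpleGraph V) (A : Finset V) : SimpleGraph V where
  Adj u v := G.Adj u v ∧ u ∈ A ∧ v ∈ A
  symm := ⟨fun _ _ h => ⟨h.1.symm, h.2.2, h.2.1⟩⟩
  loopless := ⟨fun _ h => G.loopless.irrefl _ h.1⟩

/-- The graph obtained from `G` by removing the matching `M`: every edge of `G` with an endpoint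
that is matched by `M` is deleted. -/
def removeMatching (G : SimpleGraph V) (M : Finset (Sym2 V)) : SimpleGraph V where
  Adj u v := G.Adj u v ∧ (∀ e ∈ M, u ∉ e) ∧ ∀ e ∈ M, v ∉ e
  symm := ⟨fun _ _ h => ⟨h.1.symm, h.2.2, h.2.1⟩⟩
  loopless := ⟨fun _ h => G.loopless.irrefl _ h.1⟩

/-- `|N(v) ∩ X|`. -/
def nbrCount (G : SimpleGraph V) (X : Finset V) (v : V) : ℕ :=
  (X.filter fun u => G.Adj v u).card

end Matchings

/-! ### Independent random choices -/

section Randomness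

/-- The law of a family of independent random variables, the `i`-th of which has law `p i`. -/
def indep {ι β : Type*} [Fintype ι] [Fintype β] (p : ι → PMF β) : PMF (ι → β) :=
  PMF.ofFintype (fun f => ∏ i, p i (f i)) (by
    rw [← Fintype.prod_sum (fun i b => p i b)]
    refine Finset.prod_eq_one fun i _ => ?_
    rw [← tsum_fintype (L := .unconditional β)]
    exact (p i).tsum_coe)

/-- A coin that shows `true` with probability `p` (a value outside `[0, 1]` is replaced by the
closest point of that interval). -/
def coin (p : ℝ) : PMF Bool :=
  PMF.ofFintype
    (fun b => cond b (ENNReal.ofReal (min 1 (max 0 p))) (ENNReal.ofReal (1 - min 1 (max 0 p)))) (by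
      have h0 : (0 : ℝ) ≤ min 1 (max 0 p) := le_min zero_le_one (le_max_left _ _)
      have h1 : (0 : ℝ) ≤ 1 - min 1 (max 0 p) := sub_nonneg.2 (min_le_left _ _)
      simp only [Fintype.sum_bool, cond_true, cond_false]
      rw [← ENNReal.ofReal_add h0 h1]
      simp)

/-- The random subset of `A` that contains each `v ∈ A` independently with probability `p v`. -/
def randomSubset {V : Type*} [Fintype V] (A : Finset V) (p : V → ℝ) : PMF (Finset V) :=
  (indep fun v => coin (p v)).map fun c => A.filter fun v => c v = true

end Randomness

/-! ### Parameters of the algorithm on an `n`-vertex graph -/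

section Parameters

/-- `α = 96 ln n`. -/
def alpha (n : ℕ) : ℝ := 96 * Real.log n

/-- The probability of the selection for a reference set. -/
def muR (n : ℕ) : ℝ := (10 ^ 6 * Real.log n)⁻¹

/-- The probability of the selection for a heavy set. -/
def muH (n : ℕ) (r : ℝ) : ℝ :=
  if r ≤ 1 / 2 then 1 / 2 * Real.exp (alpha n / 2 * (r - 1 / 2))
  else 1 - 1 / 2 * Real.exp (-(alpha n / 2) * (r - 1 / 2))

/-- The probability of the selection for the set of friends. -/
def muF (r : ℝ) : ℝ := if r ≤ 4 then max (r / 4) 0 else 1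

/-- The main loop runs as long as `Δ` is at least this number. -/
def threshold (n S : ℕ) : ℝ := (n : ℝ) / S * (200 * Real.log n) ^ 32

/-- The number of machines, `m = ⌊√(n Δ / S)⌋`. -/
def numMachines (n S : ℕ) (Δ : ℝ) : ℕ := ⌊Real.sqrt (n * Δ / S)⌋₊

/-- The number of emulated phases, `τ = ⌈(1/16) log_{120 α} (Δ / m)⌉`. -/
def numPhases (n S : ℕ) (Δ : ℝ) : ℕ :=
  ⌈1 / 16 * Real.logb (120 * alpha n) (Δ / numMachines n S Δ)⌉₊

/-! Inside the main loop there is at least one machine and at least one phase, and the loop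
terminates. -/

lemma one_le_log_aux {n : ℕ} (hn : 2 ≤ n) : 1 < 200 * Real.log n := by
  have h1 : Real.log 2 ≤ Real.log n := Real.log_le_log (by norm_num) (by exact_mod_cast hn)
  have h2 := Real.log_two_gt_d9
  linarith

lemma ratio_le_threshold {n S : ℕ} (hn : 2 ≤ n) : (n : ℝ) / S ≤ threshold n S := by
  have h := one_le_pow₀ (one_le_log_aux hn).le (n := 32)
  have h' : (0 : ℝ) ≤ (n : ℝ) / S := by positivity
  unfold threshold
  nlinarith

lemma one_le_of_threshold_le {n S : ℕ} (hn : 2 ≤ n) (hS : 1 ≤ S) (hSn : S ≤ n) {Δ : ℝ}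
    (h : threshold n S ≤ Δ) : 1 ≤ Δ := by
  have hS' : (0 : ℝ) < S := by exact_mod_cast hS
  have h1 : (1 : ℝ) ≤ (n : ℝ) / S := by
    rw [le_div_iff₀ hS', one_mul]; exact_mod_cast hSn
  exact h1.trans ((ratio_le_threshold hn).trans h)

lemma numMachines_pos {n S : ℕ} (hn : 2 ≤ n) (hS : 1 ≤ S) (hSn : S ≤ n) {Δ : ℝ}
    (h : threshold n S ≤ Δ) : 0 < numMachines n S Δ := by
  have hS' : (0 : ℝ) < S := by exact_mod_cast hS
  have h1 : (1 : ℝ) ≤ (n : ℝ) / S := by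
    rw [le_div_iff₀ hS', one_mul]; exact_mod_cast hSn
  have hΔ := one_le_of_threshold_le hn hS hSn h
  refine Nat.floor_pos.2 (Real.one_le_sqrt.2 ?_)
  rw [mul_div_right_comm]
  nlinarith

lemma numPhases_pos {n S : ℕ} (hn : 2 ≤ n) (hS : 1 ≤ S) (hSn : S ≤ n) {Δ : ℝ}
    (h : threshold n S ≤ Δ) : 0 < numPhases n S Δ := by
  have hS' : (0 : ℝ) < S := by exact_mod_cast hS
  have hn' : (0 : ℝ) < n := by exact_mod_cast (by omega : 0 < n)
  have hΔ := one_le_of_threshold_le hn hS hSn h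
  have hm : (0 : ℝ) < numMachines n S Δ := by exact_mod_cast numMachines_pos hn hS hSn h
  have hL := one_le_log_aux hn
  have hlt : (n : ℝ) / S < Δ := by
    refine lt_of_lt_of_le ?_ h
    have h1 := one_lt_pow₀ hL (n := 32) (by norm_num)
    have h2 : (0 : ℝ) < (n : ℝ) / S := by positivity
    unfold threshold
    nlinarith
  have hmΔ : (numMachines n S Δ : ℝ) < Δ := by
    refine (Nat.floor_le (Real.sqrt_nonneg _)).trans_lt ?_
    rw [Real.sqrt_lt' (by linarith), mul_div_right_comm]
    nlinarith
  refine Nat.ceil_pos.2 (mul_pos (by norm_num) (Real.logb_pos ?_ ?_))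
  · unfold alpha; nlinarith
  · rwa [one_lt_div hm]

lemma floor_next_lt {n S : ℕ} (hn : 2 ≤ n) (hS : 1 ≤ S) (hSn : S ≤ n) {Δ : ℝ}
    (h : threshold n S ≤ Δ) : ⌊Δ / 2 ^ numPhases n S Δ⌋₊ < ⌊Δ⌋₊ := by
  have hΔ := one_le_of_threshold_le hn hS hSn h
  have h2 : (2 : ℝ) ≤ 2 ^ numPhases n S Δ :=
    le_self_pow₀ one_le_two (numPhases_pos hn hS hSn h).ne'
  have h3 : Δ / 2 ^ numPhases n S Δ ≤ Δ / 2 := by gcongr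
  have h4 : 1 ≤ ⌊Δ⌋₊ := Nat.one_le_floor_iff _ |>.2 hΔ
  have h5 : (1 : ℝ) ≤ ⌊Δ⌋₊ := by exact_mod_cast h4
  have h6 := Nat.lt_floor_add_one Δ
  refine (Nat.floor_lt (by positivity)).2 ?_
  linarith

lemma floor_half_lt {Δ : ℝ} (hΔ : 1 ≤ Δ) : ⌊Δ / 2⌋₊ < ⌊Δ⌋₊ := by
  have h4 : 1 ≤ ⌊Δ⌋₊ := Nat.one_le_floor_iff _ |>.2 hΔ
  have h5 : (1 : ℝ) ≤ ⌊Δ⌋₊ := by exact_mod_cast h4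
  have h6 := Nat.lt_floor_add_one Δ
  refine (Nat.floor_lt (by positivity)).2 ?_
  linarith

end Parameters

/-! ### The algorithms -/

section Algorithms

/-- The two places at which the algorithms leave a choice open: which maximal matching of a given
graph is computed, and which of the edges of `E⋆` (directed from a friend to its heavy neighbour)
is selected at each blue endpoint. Both may be made in an arbitrary, possibly randomized, way. -/
structure OpenChoices (V : Type*) where
  /-- computes a maximal matching of the given graph -/
  maximalMatching : SimpleGraph V → PMF (Finset (Sym2 V))
  maximalMatching_spec : ∀ G, ∀ M ∈ (maximalMatching G).support, Maximal (IsMatching G) M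
  /-- for every blue vertex `w` incident to an edge `(v, w) ∈ E⋆` selects one such edge -/
  selectEdges : Finset (V × V) → PMF (Finset (V × V))
  selectEdges_spec : ∀ E, ∀ M ∈ (selectEdges E).support,
    M ⊆ E ∧ ∀ w, (∃ v, (v, w) ∈ E) → ∃! v, (v, w) ∈ M

variable {V : Type*} [Fintype V]

/-- `MatchHeavy(H, F)`. The colour `true` is red, the colour `false` is blue. A vertex outside `F`,
or without a neighbour in `H`, has no `v⋆`. -/
def matchHeavy (ρ : OpenChoices V) (G : SimpleGraph V) (H F : Finset V) :
    PMF (Finset (Sym2 V)) :=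
  (indep fun v : V =>
    if h : v ∈ F ∧ (H.filter fun u => G.Adj v u).Nonempty then
      (PMF.uniformOfFinset (H.filter fun u => G.Adj v u) h.2).map some
    else PMF.pure none).bind fun star : V → Option V =>
  (indep fun _ : V => PMF.uniformOfFintype Bool).bind fun red : V → Bool =>
  (ρ.selectEdges (Finset.univ.filter fun e : V × V =>
    e.1 ∈ F ∧ star e.1 = some e.2 ∧ red e.1 = true ∧ e.2 ∈ H ∧ red e.2 = false)).map
  fun M => M.image fun e => s(e.1, e.2)

/-- `GlobalAlg(G[A], Δ)`. -/
def globalAlg (ρ : OpenChoices V) (G : SimpleGraph V) (Δ : ℝ) (A : Finset V) :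
    PMF (Finset (Sym2 V)) :=
  if _hΔ : 1 ≤ Δ then
    let H := A.filter fun v => Δ / 2 ≤ (nbrCount G A v : ℝ)
    (randomSubset A fun v => (nbrCount G H v : ℝ) / (4 * Δ)).bind fun F =>
    (matchHeavy ρ G H F).bind fun M =>
    (globalAlg ρ G (Δ / 2) (A \ (H ∪ F))).map fun M' => M ∪ M'
  else PMF.pure ∅
termination_by ⌊Δ⌋₊
decreasing_by exact floor_half_lt _hΔ

/-- `LocalPhase(i, G[A], Δ)`: returns the remaining vertices and a matching. -/
def localPhase (ρ : OpenChoices V) (G : SimpleGraph V) (Δ : ℝ) (A : Finset V) :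
    PMF (Finset V × Finset (Sym2 V)) :=
  let n := Fintype.card V
  (randomSubset A fun _ => muR n).bind fun R =>
  (randomSubset A fun v => muH n ((nbrCount G R v : ℝ) / muR n / Δ)).bind fun H =>
  (randomSubset A fun v => muF ((nbrCount G H v : ℝ) / Δ)).bind fun F =>
  (ρ.maximalMatching (inducedOn G (H ∪ F))).map fun M => (A \ (R ∪ H ∪ F), M)

/-- `τ` successive local phases with thresholds `Δ, Δ/2, …, Δ/2^(τ-1)`: returns the remaining
vertices and the union of the matchings. -/
def localPhases (ρ : OpenChoices V) (G : SimpleGraph V) :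
    ℕ → ℝ → Finset V → PMF (Finset V × Finset (Sym2 V))
  | 0, _, A => PMF.pure (A, ∅)
  | τ + 1, Δ, A =>
    (localPhase ρ G Δ A).bind fun x =>
    (localPhases ρ G τ (Δ / 2) x.1).map fun y => (y.1, x.2 ∪ y.2)

/-- The security check: a vertex set that induces more than `8 S` edges is emptied. -/
def securityCheck (G : SimpleGraph V) (S : ℕ) (B : Finset V) : Finset V :=
  if 8 * S < (inducedOn G B).edgeSet.ncard then ∅ else B

/-- The body of the main loop, with `m` machines and `τ` phases, applied to the set `A` of
remaining vertices: partition `A` at random, run the local phases independently on the parts, and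
collect the remaining vertices and the matchings. -/
def loopBody (ρ : OpenChoices V) (G : SimpleGraph V) (S m τ : ℕ) [NeZero m] (Δ : ℝ)
    (A : Finset V) : PMF (Finset V × Finset (Sym2 V)) :=
  (indep fun _ : V => PMF.uniformOfFintype (Fin m)).bind fun Φ : V → Fin m =>
  (indep fun i : Fin m =>
    localPhases ρ G τ (Δ / m) (securityCheck G S (A.filter fun v => Φ v = i))).map fun out =>
  (Finset.univ.biUnion fun i => (out i).1, Finset.univ.biUnion fun i => (out i).2)

/-- `ParallelAlg(G, S)` from the test of the main loop on, with current threshold `Δ` and set `A` of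
remaining vertices; returns the edges added to the matching from there on. -/
def parallelLoop (ρ : OpenChoices V) (G : SimpleGraph V) (S : ℕ) (hn : 2 ≤ Fintype.card V)
    (hS : 1 ≤ S) (hSn : S ≤ Fintype.card V) (Δ : ℝ) (A : Finset V) : PMF (Finset (Sym2 V)) :=
  if h : threshold (Fintype.card V) S ≤ Δ then
    let m := numMachines (Fintype.card V) S Δ
    let τ := numPhases (Fintype.card V) S Δ
    haveI : NeZero m := ⟨(numMachines_pos hn hS hSn h).ne'⟩
    (loopBody ρ G S m τ Δ A).bind fun x =>
    (parallelLoop ρ G S hn hS hSn (Δ / 2 ^ τ) x.1).map fun M => x.2 ∪ M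
  else
    globalAlg ρ G (2 * Δ) (A.filter fun v => (nbrCount G A v : ℝ) < 2 * Δ)
termination_by ⌊Δ⌋₊
decreasing_by exact floor_next_lt hn hS hSn h

/-- `ParallelAlg(G, S)` on a graph with `n ≥ 2` vertices, where `1 ≤ S ≤ n`: the law of the
matching that it returns. -/
def parallelAlg (ρ : OpenChoices V) (G : SimpleGraph V) (S : ℕ) (hn : 2 ≤ Fintype.card V)
    (hS : 1 ≤ S) (hSn : S ≤ Fintype.card V) : PMF (Finset (Sym2 V)) :=
  parallelLoop ρ G S hn hS hSn (Fintype.card V) Finset.univ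

/-- `ParallelAlg` executed `k` times, with fresh randomness; after each execution the matching
found is removed from the graph. The law of the union of the `k` matchings. -/
def repeatedParallelAlg (ρ : OpenChoices V) (S : ℕ) (hn : 2 ≤ Fintype.card V)
    (hS : 1 ≤ S) (hSn : S ≤ Fintype.card V) : ℕ → SimpleGraph V → PMF (Finset (Sym2 V))
  | 0, _ => PMF.pure ∅
  | k + 1, G =>
    (parallelAlg ρ G S hn hS hSn).bind fun M =>
    (repeatedParallelAlg ρ S hn hS hSn k (removeMatching G M)).map fun M' => M ∪ M'

end Algorithms

end

end RoundCompression

/-! One run of the algorithm finds in expectation at least 1/500 of the edges of any fixed matching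
`N` (`card_le_ex_parallelAlg`). A matching found and a maximum matching of what is left can be
combined, so every run multiplies the expected matching number of the remaining graph by at most
499/500. After `k` runs Markov's inequality shows that, with probability at least 1/2, less than a
fraction ε/(2+ε) of the matching number remains. Since the matched vertices meet at most 2|M| edges
of an optimum, ν(G) ≤ 2|M| + ν(rest), which then yields the ratio 2+ε.

For a single run, the removed vertices are charged to the matching. A removed vertex destroys at
most one edge of `N`. A vertex becomes a friend with probability proportional to its number of heavy
neighbours, and this cancels the factor 1/(number of heavy neighbours) in the choice of `v⋆`; so a
heavy vertex of degree at least D/8 is matched by `matchHeavy` with probability at least 1/130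
(`le_ex_matchHeavy`). The friends are in expectation at most half as many as the heavy vertices when
degrees are at most 2D. Hence heavy vertices and friends together are paid for by a constant
multiple of the matching, and a maximal matching is at least half as large as that of `matchHeavy`.
Reference vertices are not paid for, but they hit an endpoint of `N` only with probability `muR`.
There are at most log₂ n local phases, so their total cost is a tiny fraction of |N|.

All this needs degrees to stay below about D while D is halved, although a machine sees only its own
vertices and estimates degrees by sampling. The proof compares every machine with one deterministic
mean field, `density`: the idealised presence probability of each vertex after `j` phases. The
compared quantities are the weighted neighbourhood sums `pullback`, in which each vertex carries its
mean-field probability of surviving up to a later phase. Their targets do not move from phase to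
phase, so only sampling errors and errors in the selection probabilities have to be controlled.

Since 1 - `muH` varies by small factors on the scale 1/α, a phase multiplies the error by at most
120α (`pr_localPhase_le`). The number of phases is chosen so that the initial noise ξ times (120α)^τ
is still at most 1/(1000α) (`exists_loopNumerics`, `pr_localPhases_le`). The mean field is common to
all machines: a surviving vertex has few remaining neighbours on each of them, and summing over
machines bounds its degree in the whole graph (`nbrCount_le_of_followsMeanField`). -/

namespace RoundCompression

noncomputable section

open scoped Classical

/-! ### Expectations over finite types -/

section Expectation

variable {α β : Type*} [Fintype α] [Fintype β]

/-- The expectation of `f` under the law `p`. -/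
def ex (p : PMF α) (f : α → ℝ) : ℝ := ∑ a, (p a).toReal * f a

/-- The probability of the event `P` under the law `p`. -/
def pr (p : PMF α) (P : α → Prop) : ℝ := ex p fun a => if P a then 1 else 0

lemma sum_toReal (p : PMF α) : ∑ a, (p a).toReal = 1 := by
  rw [← ENNReal.toReal_sum fun a _ => p.apply_ne_top a, ← tsum_fintype (L := .unconditional α),
    p.tsum_coe, ENNReal.toReal_one]

lemma ex_const (p : PMF α) (c : ℝ) : ex p (fun _ => c) = c := by
  rw [ex, ← Finset.sum_mul, sum_toReal, one_mul]

lemma ex_add (p : PMF α) (f g : α → ℝ) : ex p (fun a => f a + g a) = ex p f + ex p g := by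
  simp [ex, mul_add, Finset.sum_add_distrib]

lemma ex_sub (p : PMF α) (f g : α → ℝ) : ex p (fun a => f a - g a) = ex p f - ex p g := by
  simp [ex, mul_sub, Finset.sum_sub_distrib]

lemma ex_const_mul (p : PMF α) (c : ℝ) (f : α → ℝ) : ex p (fun a => c * f a) = c * ex p f := by
  simp only [ex, Finset.mul_sum]
  exact Finset.sum_congr rfl fun a _ => by ring

lemma ex_mul_const (p : PMF α) (f : α → ℝ) (c : ℝ) : ex p (fun a => f a * c) = ex p f * c := by
  simp only [ex, Finset.sum_mul]
  exact Finset.sum_congr rfl fun a _ => by ring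

lemma ex_sum {ι : Type*} (p : PMF α) (s : Finset ι) (f : ι → α → ℝ) :
    ex p (fun a => ∑ i ∈ s, f i a) = ∑ i ∈ s, ex p (f i) := by
  simp only [ex, Finset.mul_sum]
  exact Finset.sum_comm

lemma ex_mono {p : PMF α} {f g : α → ℝ} (h : ∀ a ∈ p.support, f a ≤ g a) : ex p f ≤ ex p g := by
  refine Finset.sum_le_sum fun a _ => ?_
  by_cases ha : a ∈ p.support
  · exact mul_le_mul_of_nonneg_left (h a ha) ENNReal.toReal_nonneg
  · have : p a = 0 := by simpa [PMF.mem_support_iff] using ha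
    simp [this]

lemma ex_congr {p : PMF α} {f g : α → ℝ} (h : ∀ a ∈ p.support, f a = g a) : ex p f = ex p g :=
  le_antisymm (ex_mono fun a ha => (h a ha).le) (ex_mono fun a ha => (h a ha).ge)

lemma ex_le_const {p : PMF α} {f : α → ℝ} {c : ℝ} (h : ∀ a ∈ p.support, f a ≤ c) :
    ex p f ≤ c :=
  (ex_mono h).trans_eq (ex_const p c)

lemma const_le_ex {p : PMF α} {f : α → ℝ} {c : ℝ} (h : ∀ a ∈ p.support, c ≤ f a) :
    c ≤ ex p f :=
  (ex_const p c).symm.trans_le (ex_mono h)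

lemma ex_nonneg {p : PMF α} {f : α → ℝ} (h : ∀ a ∈ p.support, 0 ≤ f a) : 0 ≤ ex p f :=
  const_le_ex h

lemma ex_pure (a : α) (f : α → ℝ) : ex (PMF.pure a) f = f a := by
  simp only [ex, PMF.pure_apply]
  rw [Finset.sum_eq_single a]
  · simp
  · intro b _ hb; simp [hb]
  · simp

lemma ex_bind (p : PMF α) (q : α → PMF β) (f : β → ℝ) :
    ex (p.bind q) f = ex p fun a => ex (q a) f := by
  simp only [ex, PMF.bind_apply, tsum_fintype, Finset.mul_sum]
  rw [Finset.sum_comm]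
  refine Finset.sum_congr rfl fun b _ => ?_
  rw [ENNReal.toReal_sum fun a _ => ENNReal.mul_ne_top (p.apply_ne_top a) ((q a).apply_ne_top b),
    Finset.sum_mul]
  exact Finset.sum_congr rfl fun a _ => by rw [ENNReal.toReal_mul, mul_assoc]

lemma ex_map (p : PMF α) (g : α → β) (f : β → ℝ) : ex (p.map g) f = ex p fun a => f (g a) := by
  rw [PMF.map, ex_bind]
  simp [ex_pure]

lemma pr_le_one (p : PMF α) (P : α → Prop) : pr p P ≤ 1 :=
  ex_le_const fun a _ => by split_ifs <;> norm_num

lemma pr_mono {p : PMF α} {P Q : α → Prop} (h : ∀ a ∈ p.support, P a → Q a) :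
    pr p P ≤ pr p Q := by
  refine ex_mono fun a ha => ?_
  by_cases hP : P a
  · simp [hP, h a ha hP]
  · simp only [hP, if_false]; split_ifs <;> norm_num

lemma pr_eq_zero {p : PMF α} {P : α → Prop} (h : ∀ a ∈ p.support, ¬ P a) : pr p P = 0 := by
  rw [pr, ex_congr (g := fun _ => 0) fun a ha => by simp [h a ha], ex_const]

lemma pr_not (p : PMF α) (P : α → Prop) :
    pr p (fun a => ¬ P a) = ex p fun a => if P a then 0 else 1 :=
  ex_congr fun a _ => by by_cases h : P a <;> simp [h]

lemma pr_or_le (p : PMF α) (P Q : α → Prop) : pr p (fun a => P a ∨ Q a) ≤ pr p P + pr p Q := by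
  rw [pr, pr, pr, ← ex_add]
  refine ex_mono fun a _ => ?_
  by_cases hP : P a <;> by_cases hQ : Q a <;> simp [hP, hQ]

lemma pr_exists_le {ι : Type*} (p : PMF α) (s : Finset ι) (P : ι → α → Prop) :
    pr p (fun a => ∃ i ∈ s, P i a) ≤ ∑ i ∈ s, pr p (P i) := by
  simp only [pr]
  rw [← ex_sum]
  refine ex_mono fun a _ => ?_
  split_ifs with h
  · obtain ⟨i, hi, hP⟩ := h
    refine (by simp [hP] : (1 : ℝ) ≤ if P i a then 1 else 0).trans
      (Finset.single_le_sum (f := fun i => if P i a then (1 : ℝ) else 0) (fun j _ => ?_) hi)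
    split_ifs <;> norm_num
  · exact Finset.sum_nonneg fun j _ => by split_ifs <;> norm_num

lemma pr_exists_le_card_mul {ι : Type*} (p : PMF α) (s : Finset ι) (P : ι → α → Prop) {b : ℝ}
    (h : ∀ i ∈ s, pr p (P i) ≤ b) : pr p (fun a => ∃ i ∈ s, P i a) ≤ s.card * b :=
  (pr_exists_le p s P).trans ((Finset.sum_le_sum h).trans_eq (by simp))

lemma pr_map (p : PMF α) (g : α → β) (P : β → Prop) :
    pr (p.map g) P = pr p fun a => P (g a) := ex_map _ _ _

/-- An event after a random step is unlikely when a bad first step is unlikely and the event is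
unlikely after every good first step. -/
lemma pr_bind_le {p : PMF α} {q : α → PMF β} {B : α → Prop} {P : β → Prop} {b : ℝ} (hb : 0 ≤ b)
    (h : ∀ a ∈ p.support, ¬ B a → pr (q a) P ≤ b) : pr (p.bind q) P ≤ pr p B + b := by
  have e : pr p B + b = ex p fun a => (if B a then 1 else 0) + b := by rw [ex_add, ex_const]; rfl
  rw [pr, ex_bind, e]
  refine ex_mono fun a ha => ?_
  by_cases hB : B a
  · simp only [hB, if_true]
    exact (pr_le_one (q a) P).trans (by linarith)
  · simp only [hB, if_false, zero_add]
    exact h a ha hB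

/-- The link between the real-valued calculus used below and the outer measure in the theorem. -/
lemma ofReal_pr (p : PMF α) (P : α → Prop) :
    ENNReal.ofReal (pr p P) = p.toOuterMeasure {a | P a} := by
  rw [PMF.toOuterMeasure_apply_fintype, pr, ex, ENNReal.ofReal_sum_of_nonneg]
  · refine Finset.sum_congr rfl fun a _ => ?_
    by_cases h : P a
    · simp [h, ENNReal.ofReal_toReal (p.apply_ne_top a)]
    · simp [h]
  · intro a _
    split_ifs <;> simp

/-- Markov's inequality. -/
lemma pr_le_ex_div {p : PMF α} {f : α → ℝ} {c : ℝ} (hc : 0 < c) (hf : ∀ a ∈ p.support, 0 ≤ f a) :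
    pr p (fun a => c ≤ f a) ≤ ex p f / c := by
  rw [le_div_iff₀ hc, pr, ← ex_mul_const]
  refine ex_mono fun a ha => ?_
  split_ifs with h
  · simpa using h
  · simpa using hf a ha

end Expectation

/-! ### Independent families -/

section Indep

variable {ι β : Type*} [Fintype ι] [Fintype β]

lemma mem_support_indep {p : ι → PMF β} {f : ι → β} :
    f ∈ (indep p).support ↔ ∀ i, f i ∈ (p i).support := by
  simp [indep, PMF.mem_support_iff, Finset.prod_eq_zero_iff]

variable [DecidableEq ι]

lemma ex_indep_prod (p : ι → PMF β) (g : ι → β → ℝ) :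
    ex (indep p) (fun f => ∏ i, g i (f i)) = ∏ i, ex (p i) (g i) := by
  simp only [ex, indep, PMF.ofFintype_apply, ENNReal.toReal_prod, ← Finset.prod_mul_distrib]
  rw [Fintype.prod_sum]

lemma ex_indep_apply (p : ι → PMF β) (i : ι) (g : β → ℝ) :
    ex (indep p) (fun f => g (f i)) = ex (p i) g := by
  have h := ex_indep_prod p (fun j b => if j = i then g b else 1)
  have h1 : ∀ f : ι → β, (∏ j, if j = i then g (f j) else 1) = g (f i) := fun f => by
    rw [Finset.prod_ite_eq' Finset.univ i (fun j => g (f j))]; simp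
  simp only [h1] at h
  rw [h, Finset.prod_eq_single i]
  · simp
  · intro j _ hj; simp [hj, ex_const]
  · simp

lemma exp_sub_one_le {x : ℝ} (h : |x| ≤ 1) : Real.exp x - 1 ≤ x + x ^ 2 := by
  have := (abs_le.1 (Real.abs_exp_sub_one_sub_id_le h)).2
  linarith

lemma exp_mul_le {t x : ℝ} (hx0 : 0 ≤ x) (hx1 : x ≤ 1) :
    Real.exp (t * x) ≤ 1 + (Real.exp t - 1) * x := by
  have h := convexOn_exp.2 (Set.mem_univ 0) (Set.mem_univ t) (sub_nonneg.2 hx1) hx0 (by ring)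
  simp only [smul_eq_mul, mul_zero, zero_add, Real.exp_zero, mul_one] at h
  rw [mul_comm t x]
  linarith

/-- By independence the exponential moment factors. Convexity bounds each factor by a function
linear in `g`, so only the mean matters, and 1 + u ≤ exp u turns the product back into one
exponential. -/
lemma ex_exp_sum_le (p : ι → PMF β) (g : ι → β → ℝ) (h0 : ∀ i b, 0 ≤ g i b)
    (h1 : ∀ i b, g i b ≤ 1) (t : ℝ) :
    ex (indep p) (fun f => Real.exp (t * ∑ i, g i (f i))) ≤
      Real.exp ((Real.exp t - 1) * ∑ i, ex (p i) (g i)) := by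
  have h : ∀ f : ι → β, Real.exp (t * ∑ i, g i (f i)) = ∏ i, Real.exp (t * g i (f i)) := fun f => by
    rw [Finset.mul_sum, Real.exp_sum]
  simp only [h]
  rw [ex_indep_prod p (fun i b => Real.exp (t * g i b)), Finset.mul_sum, Real.exp_sum]
  refine Finset.prod_le_prod (fun i _ => ex_nonneg fun b _ => (Real.exp_pos _).le) fun i _ => ?_
  calc ex (p i) (fun b => Real.exp (t * g i b))
      ≤ ex (p i) (fun b => 1 + (Real.exp t - 1) * g i b) :=
        ex_mono fun b _ => exp_mul_le (h0 i b) (h1 i b)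
    _ = (Real.exp t - 1) * ex (p i) (g i) + 1 := by
        rw [ex_add, ex_const, ex_const_mul, add_comm]
    _ ≤ _ := Real.add_one_le_exp _

/-- Exponential Markov inequality, with the sign `s` treating both tails at once. `M` need only
bound the mean from above, so the mean itself never has to be known precisely. -/
lemma one_sided_chernoff (p : ι → PMF β) (g : ι → β → ℝ) (h0 : ∀ i b, 0 ≤ g i b)
    (h1 : ∀ i b, g i b ≤ 1) {M l s : ℝ} (hM : ∑ i, ex (p i) (g i) ≤ M) (hl : 0 ≤ l)
    (hlM : l ≤ 2 * M) (hM0 : 0 < M) (hs : |s| = 1) :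
    pr (indep p) (fun f => l ≤ s * (∑ i, g i (f i) - ∑ i, ex (p i) (g i))) ≤
      Real.exp (-(l ^ 2 / (4 * M))) := by
  set mu := ∑ i, ex (p i) (g i) with hmu
  -- This value minimises -tl + t²M; the assumption l ≤ 2M gives t ≤ 1, where exp x - 1 ≤ x + x² is
  -- available.
  set t := l / (2 * M) with ht
  have ht0 : 0 ≤ t := by positivity
  have ht1 : t ≤ 1 := by rw [ht, div_le_one (by positivity)]; exact hlM
  have hst : |t * s| ≤ 1 := by rw [abs_mul, hs, mul_one, abs_of_nonneg ht0]; exact ht1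
  have hs2 : s ^ 2 = 1 := by rw [← sq_abs, hs]; norm_num
  have hmu0 : 0 ≤ mu := Finset.sum_nonneg fun i _ => ex_nonneg fun b _ => h0 i b
  calc pr (indep p) (fun f => l ≤ s * (∑ i, g i (f i) - mu))
      ≤ ex (indep p) (fun f => Real.exp (-(t * l) - t * s * mu) *
          Real.exp (t * s * ∑ i, g i (f i))) := by
        refine ex_mono fun f _ => ?_
        split_ifs with h
        · rw [← Real.exp_add]
          refine Real.one_le_exp ?_
          have := mul_le_mul_of_nonneg_left h ht0
          linarith
        · positivity
    _ ≤ Real.exp (-(t * l) - t * s * mu) * Real.exp ((Real.exp (t * s) - 1) * mu) := by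
        rw [ex_const_mul]
        exact mul_le_mul_of_nonneg_left (ex_exp_sum_le p g h0 h1 _) (Real.exp_pos _).le
    _ = Real.exp (-(t * l) - t * s * mu + (Real.exp (t * s) - 1) * mu) := (Real.exp_add _ _).symm
    _ ≤ Real.exp (-(l ^ 2 / (4 * M))) := by
        refine Real.exp_le_exp.2 ?_
        have e1 := mul_le_mul_of_nonneg_right (exp_sub_one_le hst) hmu0
        have e2 : (t * s) ^ 2 = t ^ 2 := by rw [mul_pow, hs2, mul_one]
        have e3 : t ^ 2 * mu ≤ t ^ 2 * M := mul_le_mul_of_nonneg_left hM (sq_nonneg t)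
        have e4 : t ^ 2 * M = l ^ 2 / (4 * M) := by rw [ht]; field_simp; ring
        have e5 : t * l = 2 * (l ^ 2 / (4 * M)) := by rw [ht]; field_simp; ring
        rw [e2] at e1
        linarith

/-- A two-sided Chernoff bound. -/
lemma chernoff (p : ι → PMF β) (g : ι → β → ℝ) (h0 : ∀ i b, 0 ≤ g i b)
    (h1 : ∀ i b, g i b ≤ 1) {M l : ℝ} (hM : ∑ i, ex (p i) (g i) ≤ M) (hl : 0 ≤ l)
    (hlM : l ≤ 2 * M) (hM0 : 0 < M) :
    pr (indep p) (fun f => l ≤ |∑ i, g i (f i) - ∑ i, ex (p i) (g i)|) ≤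
      2 * Real.exp (-(l ^ 2 / (4 * M))) := by
  have e1 := one_sided_chernoff p g h0 h1 hM hl hlM hM0 (s := 1) (by simp)
  have e2 := one_sided_chernoff p g h0 h1 hM hl hlM hM0 (s := -1) (by simp)
  rw [two_mul]
  refine (pr_mono fun f _ h => ?_).trans ((pr_or_le _ _ _).trans (add_le_add e1 e2))
  rcases le_abs.1 h with h | h
  · left; simpa using h
  · right; linarith

end Indep

/-! ### Random subsets -/

section RandomSubset

variable {V : Type*} [Fintype V]

lemma ex_coin {p : ℝ} (h0 : 0 ≤ p) (h1 : p ≤ 1) (f : Bool → ℝ) :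
    ex (coin p) f = p * f true + (1 - p) * f false := by
  simp only [ex, coin, PMF.ofFintype_apply, Fintype.sum_bool, cond_true, cond_false,
    max_eq_right h0, min_eq_right h1]
  rw [ENNReal.toReal_ofReal h0, ENNReal.toReal_ofReal (sub_nonneg.2 h1)]

lemma ex_randomSubset (A : Finset V) (p : V → ℝ) (f : Finset V → ℝ) :
    ex (randomSubset A p) f =
      ex (indep fun v => coin (p v)) fun c => f (A.filter fun v => c v = true) :=
  ex_map _ _ _

lemma subset_of_mem_support_randomSubset {A X : Finset V} {p : V → ℝ}
    (h : X ∈ (randomSubset A p).support) : X ⊆ A := by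
  rw [randomSubset, PMF.mem_support_map_iff] at h
  obtain ⟨c, -, rfl⟩ := h
  exact Finset.filter_subset _ _

lemma ex_randomSubset_sum {A : Finset V} {p : V → ℝ} (h0 : ∀ v ∈ A, 0 ≤ p v)
    (h1 : ∀ v ∈ A, p v ≤ 1) (f : V → ℝ) :
    ex (randomSubset A p) (fun X => ∑ v ∈ X, f v) = ∑ v ∈ A, p v * f v := by
  rw [ex_randomSubset]
  simp only [Finset.sum_filter]
  rw [ex_sum]
  refine Finset.sum_congr rfl fun v hv => ?_
  rw [ex_indep_apply (fun v => coin (p v)) v (fun b => if b = true then f v else 0),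
    ex_coin (h0 v hv) (h1 v hv)]
  simp

lemma pr_notMem_randomSubset {A : Finset V} {p : V → ℝ} {v : V} (hv : v ∈ A) (h0 : 0 ≤ p v)
    (h1 : p v ≤ 1) : pr (randomSubset A p) (fun X => v ∉ X) = 1 - p v := by
  rw [pr, ex_randomSubset]
  simp only [Finset.mem_filter, hv, true_and]
  rw [ex_indep_apply (fun v => coin (p v)) v (fun b => if ¬ b = true then 1 else 0), ex_coin h0 h1]
  simp

lemma chernoff_randomSubset {A B : Finset V} (hB : B ⊆ A) {p f : V → ℝ} (h0 : ∀ v ∈ A, 0 ≤ p v)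
    (h1 : ∀ v ∈ A, p v ≤ 1) (f0 : ∀ v, 0 ≤ f v) (f1 : ∀ v, f v ≤ 1) {M l : ℝ}
    (hM : ∑ v ∈ B, p v * f v ≤ M) (hl : 0 ≤ l) (hlM : l ≤ 2 * M) (hM0 : 0 < M) :
    pr (randomSubset A p) (fun X => l ≤ |∑ v ∈ B ∩ X, f v - ∑ v ∈ B, p v * f v|) ≤
      2 * Real.exp (-(l ^ 2 / (4 * M))) := by
  set g : V → Bool → ℝ := fun v b => if v ∈ B ∧ b = true then f v else 0 with hg
  have hmean : ∑ v, ex (coin (p v)) (g v) = ∑ v ∈ B, p v * f v := by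
    rw [← Finset.sum_subset (Finset.subset_univ B) fun v _ hv => by simp [hg, hv, ex_const]]
    refine Finset.sum_congr rfl fun v hv => ?_
    rw [ex_coin (h0 v (hB hv)) (h1 v (hB hv))]
    simp [hg, hv]
  have hsum : ∀ c : V → Bool, ∑ v, g v (c v) = ∑ v ∈ B ∩ A.filter (fun v => c v = true), f v := by
    intro c
    simp only [hg]
    rw [← Finset.sum_filter]
    refine Finset.sum_congr ?_ fun _ _ => rfl
    ext v
    simp only [Finset.mem_filter, Finset.mem_univ, true_and, Finset.mem_inter]
    exact ⟨fun h => ⟨h.1, hB h.1, h.2⟩, fun h => ⟨h.1, h.2.2⟩⟩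
  have key := chernoff (fun v => coin (p v)) g
    (fun v b => by simp only [hg]; split_ifs; exacts [f0 v, le_rfl])
    (fun v b => by simp only [hg]; split_ifs; exacts [f1 v, zero_le_one]) (hmean.trans_le hM) hl hlM hM0
  rw [hmean] at key
  simp only [hsum] at key
  rw [randomSubset, pr_map]
  exact key

/-- Concentration for the vertices that are not selected: the phases are analysed through their
survivors, and the deviation is measured against the surviving mass. -/
lemma chernoff_compl_randomSubset {A B : Finset V} (hB : B ⊆ A) {p f : V → ℝ}
    (h0 : ∀ v ∈ A, 0 ≤ p v) (h1 : ∀ v ∈ A, p v ≤ 1) (f0 : ∀ v, 0 ≤ f v) (f1 : ∀ v, f v ≤ 1)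
    {M l : ℝ} (hM : ∑ v ∈ B, (1 - p v) * f v ≤ M) (hl : 0 ≤ l) (hlM : l ≤ 2 * M) (hM0 : 0 < M) :
    pr (randomSubset A p) (fun X => l ≤ |∑ v ∈ B \ X, f v - ∑ v ∈ B, (1 - p v) * f v|) ≤
      2 * Real.exp (-(l ^ 2 / (4 * M))) := by
  set g : V → Bool → ℝ := fun v b => if v ∈ B ∧ b = false then f v else 0 with hg
  have hmean : ∑ v, ex (coin (p v)) (g v) = ∑ v ∈ B, (1 - p v) * f v := by
    rw [← Finset.sum_subset (Finset.subset_univ B) fun v _ hv => by simp [hg, hv, ex_const]]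
    refine Finset.sum_congr rfl fun v hv => ?_
    rw [ex_coin (h0 v (hB hv)) (h1 v (hB hv))]
    simp [hg, hv]
  have hsum : ∀ c : V → Bool, ∑ v, g v (c v) = ∑ v ∈ B \ A.filter (fun v => c v = true), f v := by
    intro c
    simp only [hg]
    rw [← Finset.sum_filter]
    refine Finset.sum_congr ?_ fun _ _ => rfl
    ext v
    simp only [Finset.mem_filter, Finset.mem_univ, true_and, Finset.mem_sdiff]
    refine ⟨fun h => ⟨h.1, fun h' => by simp [h.2] at h'⟩, fun h => ⟨h.1, ?_⟩⟩
    by_contra h'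
    exact h.2 ⟨hB h.1, by simpa using h'⟩
  have key := chernoff (fun v => coin (p v)) g
    (fun v b => by simp only [hg]; split_ifs; exacts [f0 v, le_rfl])
    (fun v b => by simp only [hg]; split_ifs; exacts [f1 v, zero_le_one]) (hmean.trans_le hM) hl hlM hM0
  rw [hmean] at key
  simp only [hsum] at key
  rw [randomSubset, pr_map]
  exact key

end RandomSubset

/-! ### Matchings -/

section MatchingLemmas

variable {V : Type*}

lemma IsMatching.mono {G G' : SimpleGraph V} {M : Finset (Sym2 V)} (h : G ≤ G')
    (hM : IsMatching G M) : IsMatching G' M :=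
  ⟨fun e he => SimpleGraph.edgeSet_mono h (hM.1 e he), hM.2⟩

lemma isMatching_empty (G : SimpleGraph V) : IsMatching G ∅ := by simp [IsMatching]

lemma inducedOn_le (G : SimpleGraph V) (A : Finset V) : inducedOn G A ≤ G := fun _ _ h => h.1

lemma inducedOn_mono (G : SimpleGraph V) {A B : Finset V} (h : A ⊆ B) :
    inducedOn G A ≤ inducedOn G B := fun _ _ h' => ⟨h'.1, h h'.2.1, h h'.2.2⟩

lemma mem_of_mem_edgeSet_inducedOn {G : SimpleGraph V} {A : Finset V} {e : Sym2 V} {v : V}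
    (he : e ∈ (inducedOn G A).edgeSet) (hv : v ∈ e) : v ∈ A := by
  induction e with
  | _ x y =>
    rcases Sym2.mem_iff.1 hv with rfl | rfl
    exacts [he.2.1, he.2.2]

lemma mem_edgeSet_inducedOn {G : SimpleGraph V} {A : Finset V} {e : Sym2 V} :
    e ∈ (inducedOn G A).edgeSet ↔ e ∈ G.edgeSet ∧ ∀ v ∈ e, v ∈ A := by
  induction e with
  | _ x y => simp [inducedOn]

/-- Matchings inside disjoint sets of vertices can be combined. -/
lemma IsMatching.union {G : SimpleGraph V} {B B' : Finset V} {M M' : Finset (Sym2 V)}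
    (hB : Disjoint B B') (hM : IsMatching (inducedOn G B) M)
    (hM' : IsMatching (inducedOn G B') M') :
    IsMatching (inducedOn G (B ∪ B')) (M ∪ M') ∧ Disjoint M M' := by
  have key : ∀ e ∈ M, ∀ f ∈ M', ∀ v, v ∈ e → v ∈ f → False := fun e he f hf v hve hvf =>
    Finset.disjoint_left.1 hB (mem_of_mem_edgeSet_inducedOn (hM.1 e he) hve)
      (mem_of_mem_edgeSet_inducedOn (hM'.1 f hf) hvf)
  refine ⟨⟨fun e he => ?_, fun e he f hf v hve hvf => ?_⟩, Finset.disjoint_left.2 fun e he he' => ?_⟩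
  · rcases Finset.mem_union.1 he with h | h
    · exact SimpleGraph.edgeSet_mono (inducedOn_mono G Finset.subset_union_left) (hM.1 e h)
    · exact SimpleGraph.edgeSet_mono (inducedOn_mono G Finset.subset_union_right) (hM'.1 e h)
  · rcases Finset.mem_union.1 he with h | h <;> rcases Finset.mem_union.1 hf with h' | h'
    · exact hM.2 e h f h' v hve hvf
    · exact (key e h f h' v hve hvf).elim
    · exact (key f h' e h v hvf hve).elim
    · exact hM'.2 e h f h' v hve hvf
  · induction e with
    | _ x y => exact key _ he _ he' x (Sym2.mem_mk_left x y) (Sym2.mem_mk_left x y)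

/-- `M` is a matching of `G` whose edges live on the vertices that are in `A` but no longer in the
set `A'` of remaining vertices. -/
def Sound (G : SimpleGraph V) (A A' : Finset V) (M : Finset (Sym2 V)) : Prop :=
  A' ⊆ A ∧ IsMatching (inducedOn G (A \ A')) M

lemma Sound.trans {G : SimpleGraph V} {A A' A'' : Finset V} {M M' : Finset (Sym2 V)}
    (h : Sound G A A' M) (h' : Sound G A' A'' M') :
    Sound G A A'' (M ∪ M') ∧ (M ∪ M').card = M.card + M'.card := by
  have hd : Disjoint (A \ A') (A' \ A'') :=
    Finset.disjoint_left.2 fun v hv hv' =>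
      (Finset.mem_sdiff.1 hv).2 (Finset.mem_sdiff.1 hv').1
  obtain ⟨hu, hdM⟩ := IsMatching.union hd h.2 h'.2
  refine ⟨⟨h'.1.trans h.1, hu.mono (inducedOn_mono G ?_)⟩, Finset.card_union_of_disjoint hdM⟩
  intro v hv
  rcases Finset.mem_union.1 hv with hv | hv
  · exact Finset.mem_sdiff.2 ⟨(Finset.mem_sdiff.1 hv).1, fun h3 => (Finset.mem_sdiff.1 hv).2 (h'.1 h3)⟩
  · exact Finset.mem_sdiff.2 ⟨h.1 (Finset.mem_sdiff.1 hv).1, (Finset.mem_sdiff.1 hv).2⟩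

lemma Sound.mono {G : SimpleGraph V} {A B A' : Finset V} {M : Finset (Sym2 V)} (hA : A ⊆ B)
    (h : Sound G A A' M) : Sound G B A' M :=
  ⟨h.1.trans hA, h.2.mono (inducedOn_mono G (Finset.sdiff_subset_sdiff hA subset_rfl))⟩

lemma sound_biUnion {ι : Type*} {G : SimpleGraph V} (s : Finset ι) (A A' : ι → Finset V)
    (M : ι → Finset (Sym2 V)) (hd : ∀ i ∈ s, ∀ j ∈ s, i ≠ j → Disjoint (A i) (A j))
    (h : ∀ i ∈ s, Sound G (A i) (A' i) (M i)) :
    Sound G (s.biUnion A) (s.biUnion A') (s.biUnion M) ∧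
      (s.biUnion M).card = ∑ i ∈ s, (M i).card := by
  have hmem : ∀ i ∈ s, ∀ e ∈ M i, ∀ v ∈ e, v ∈ A i ∧ v ∉ A' i := fun i hi e he v hv =>
    Finset.mem_sdiff.1 (mem_of_mem_edgeSet_inducedOn ((h i hi).2.1 e he) hv)
  have hidx : ∀ i ∈ s, ∀ j ∈ s, ∀ v, v ∈ A i → v ∈ A j → i = j := fun i hi j hj v hvi hvj => by
    by_contra hij
    exact Finset.disjoint_left.1 (hd i hi j hj hij) hvi hvj
  refine ⟨⟨fun v hv => ?_, fun e he => ?_, fun e he f hf v hve hvf => ?_⟩, ?_⟩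
  · obtain ⟨i, hi, hv⟩ := Finset.mem_biUnion.1 hv
    exact Finset.mem_biUnion.2 ⟨i, hi, (h i hi).1 hv⟩
  · obtain ⟨i, hi, he⟩ := Finset.mem_biUnion.1 he
    refine mem_edgeSet_inducedOn.2 ⟨(mem_edgeSet_inducedOn.1 ((h i hi).2.1 e he)).1, fun v hv => ?_⟩
    refine Finset.mem_sdiff.2 ⟨Finset.mem_biUnion.2 ⟨i, hi, (hmem i hi e he v hv).1⟩, fun h' => ?_⟩
    obtain ⟨j, hj, hv'⟩ := Finset.mem_biUnion.1 h'
    obtain rfl := hidx i hi j hj v (hmem i hi e he v hv).1 ((h j hj).1 hv')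
    exact (hmem i hi e he v hv).2 hv'
  · obtain ⟨i, hi, he⟩ := Finset.mem_biUnion.1 he
    obtain ⟨j, hj, hf⟩ := Finset.mem_biUnion.1 hf
    obtain rfl := hidx i hi j hj v (hmem i hi e he v hve).1 (hmem j hj f hf v hvf).1
    exact (h i hi).2.2 e he f hf v hve hvf
  · refine Finset.card_biUnion fun i hi j hj hij => Finset.disjoint_left.2 fun e he he' => ?_
    induction e with
    | _ x y =>
      exact hij (hidx i hi j hj x (hmem i hi _ he x (Sym2.mem_mk_left x y)).1
        (hmem j hj _ he' x (Sym2.mem_mk_left x y)).1)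

/-- A matching all of whose edges meet `U` has at most `|U|` edges. -/
lemma IsMatching.card_le_of_cover {G : SimpleGraph V} {N : Finset (Sym2 V)} (hN : IsMatching G N)
    (U : Finset V) (hU : ∀ e ∈ N, ∃ v ∈ U, v ∈ e) : N.card ≤ U.card := by
  choose f hf using hU
  rw [← Finset.card_attach]
  refine Finset.card_le_card_of_injOn (fun e => f e.1 e.2) (fun e _ => (hf e.1 e.2).1)
    fun e _ e' _ h => Subtype.ext (hN.2 e.1 e.2 e'.1 e'.2 (f e.1 e.2) (hf e.1 e.2).2 ?_)
  have h' : f e.1 e.2 = f e'.1 e'.2 := h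
  rw [h']
  exact (hf e'.1 e'.2).2

lemma exists_vertices (M : Finset (Sym2 V)) :
    ∃ U : Finset V, U.card ≤ 2 * M.card ∧ ∀ v, v ∈ U ↔ ∃ e ∈ M, v ∈ e := by
  refine ⟨M.biUnion fun e => e.toFinset, ?_, fun v => by simp⟩
  rw [mul_comm]
  refine Finset.card_biUnion_le_card_mul _ _ _ fun e _ => ?_
  rw [Sym2.card_toFinset]
  split_ifs <;> norm_num

/-- A maximal matching has at least half as many edges as any matching. -/
lemma card_le_two_mul_of_maximal {G : SimpleGraph V} {M T : Finset (Sym2 V)}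
    (hM : Maximal (IsMatching G) M) (hT : IsMatching G T) : T.card ≤ 2 * M.card := by
  obtain ⟨U, hU, hU'⟩ := exists_vertices M
  refine (hT.card_le_of_cover U fun e he => ?_).trans hU
  by_contra! hcon
  have hfree : ∀ f ∈ M, ∀ v, v ∈ f → v ∈ e → False := fun f hf v hvf hve =>
    hcon v ((hU' v).2 ⟨f, hf, hvf⟩) hve
  have hins : IsMatching G (insert e M) := by
    refine ⟨fun f hf => ?_, fun f hf g hg v hvf hvg => ?_⟩
    · rcases Finset.mem_insert.1 hf with h | h
      exacts [h ▸ hT.1 _ he, hM.1.1 f h]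
    · rcases Finset.mem_insert.1 hf with h | h <;> rcases Finset.mem_insert.1 hg with h' | h'
      · exact h.trans h'.symm
      · exact (hfree g h' v hvg (h ▸ hvf)).elim
      · exact (hfree f h v hvf (h' ▸ hvg)).elim
      · exact hM.1.2 f h g h' v hvf hvg
  have heM : e ∈ M := hM.2 hins (Finset.subset_insert _ _) (Finset.mem_insert_self _ _)
  induction e with
  | _ x y => exact hfree _ heM x (Sym2.mem_mk_left x y) (Sym2.mem_mk_left x y)

/-- The edges of `N` inside `A`. -/
def edgesIn (N : Finset (Sym2 V)) (A : Finset V) : Finset (Sym2 V) := N.filter fun e => ∀ v ∈ e, v ∈ A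

lemma edgesIn_mono (N : Finset (Sym2 V)) {A B : Finset V} (h : A ⊆ B) :
    edgesIn N A ⊆ edgesIn N B := fun e he => by
  rw [edgesIn, Finset.mem_filter] at he ⊢
  exact ⟨he.1, fun v hv => h (he.2 v hv)⟩

lemma isMatching_edgesIn {G : SimpleGraph V} {N : Finset (Sym2 V)} (hN : IsMatching G N)
    (A : Finset V) : IsMatching G (edgesIn N A) :=
  ⟨fun e he => hN.1 e (Finset.mem_filter.1 he).1, fun e he f hf =>
    hN.2 e (Finset.mem_filter.1 he).1 f (Finset.mem_filter.1 hf).1⟩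

/-- Removing vertices destroys at most one edge of a matching each. -/
lemma card_edgesIn_le {G : SimpleGraph V} {N : Finset (Sym2 V)} (hN : IsMatching G N)
    {A A' : Finset V} (U : Finset V) (h : ∀ v ∈ A, v ∉ A' → (∃ e ∈ edgesIn N A, v ∈ e) → v ∈ U) :
    (edgesIn N A).card ≤ (edgesIn N A').card + U.card := by
  have hsub : edgesIn N A ⊆ edgesIn N A' ∪ (edgesIn N A).filter fun e => ∃ v ∈ U, v ∈ e := by
    intro e he
    by_cases hA : ∀ v ∈ e, v ∈ A'
    · exact Finset.mem_union_left _ (Finset.mem_filter.2 ⟨(Finset.mem_filter.1 he).1, hA⟩)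
    · push Not at hA
      obtain ⟨v, hv, hvA⟩ := hA
      exact Finset.mem_union_right _ (Finset.mem_filter.2
        ⟨he, v, h v ((Finset.mem_filter.1 he).2 v hv) hvA ⟨e, he, hv⟩, hv⟩)
  refine (Finset.card_le_card hsub).trans ((Finset.card_union_le _ _).trans ?_)
  gcongr
  refine IsMatching.card_le_of_cover (G := G) ⟨fun e he => ?_, fun e he f hf => ?_⟩ U fun e he =>
    (Finset.mem_filter.1 he).2
  · exact hN.1 e (Finset.mem_filter.1 (Finset.mem_filter.1 he).1).1
  · exact hN.2 e (Finset.mem_filter.1 (Finset.mem_filter.1 he).1).1 f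
      (Finset.mem_filter.1 (Finset.mem_filter.1 hf).1).1

/-- Counting adjacent pairs from both sides. -/
lemma sum_nbrCount_comm (G : SimpleGraph V) (A B : Finset V) :
    ∑ v ∈ A, nbrCount G B v = ∑ v ∈ B, nbrCount G A v := by
  simp only [nbrCount, Finset.card_filter]
  rw [Finset.sum_comm]
  simp only [G.adj_comm]

lemma nbrCount_mono (G : SimpleGraph V) {A B : Finset V} (h : A ⊆ B) (v : V) :
    nbrCount G A v ≤ nbrCount G B v := Finset.card_le_card (Finset.filter_subset_filter _ h)

lemma nbrCount_le_card (G : SimpleGraph V) (A : Finset V) (v : V) : nbrCount G A v ≤ A.card :=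
  Finset.card_filter_le _ _

/-- The expected number of friends is at most proportional to the number of heavy vertices. -/
lemma sum_nbrCount_div_le (G : SimpleGraph V) {A H : Finset V} {D c : ℝ} (hD : 0 < D)
    (hdeg : ∀ v ∈ H, (nbrCount G A v : ℝ) ≤ 4 * c * D) :
    ∑ v ∈ A, (nbrCount G H v : ℝ) / (4 * D) ≤ c * H.card := by
  rw [← Finset.sum_div, div_le_iff₀ (by positivity)]
  have h : ∑ v ∈ A, (nbrCount G H v : ℝ) = ∑ v ∈ H, (nbrCount G A v : ℝ) := by
    exact_mod_cast sum_nbrCount_comm G A H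
  rw [h]
  refine (Finset.sum_le_sum hdeg).trans_eq ?_
  rw [Finset.sum_const, nsmul_eq_mul]
  ring

lemma edgesIn_eq_empty {G : SimpleGraph V} {N : Finset (Sym2 V)} (hN : IsMatching G N)
    {A : Finset V} (h : ∀ v ∈ A, (nbrCount G A v : ℝ) < 1) : edgesIn N A = ∅ := by
  refine Finset.eq_empty_of_forall_notMem fun e he => ?_
  obtain ⟨heN, heA⟩ := Finset.mem_filter.1 he
  induction e with
  | _ x y =>
    have hx := h x (heA x (Sym2.mem_mk_left x y))
    have : 0 < nbrCount G A x := Finset.card_pos.2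
      ⟨y, Finset.mem_filter.2 ⟨heA y (Sym2.mem_mk_right x y), hN.1 _ heN⟩⟩
    have h1 : (1 : ℝ) ≤ nbrCount G A x := by exact_mod_cast this
    linarith

lemma sound_refl (G : SimpleGraph V) (A : Finset V) : Sound G A A ∅ :=
  ⟨subset_rfl, isMatching_empty _⟩

lemma securityCheck_subset (G : SimpleGraph V) (S : ℕ) (B : Finset V) :
    securityCheck G S B ⊆ B := by
  rw [securityCheck]
  split_ifs
  exacts [Finset.empty_subset _, subset_rfl]

lemma biUnion_fiber {m : ℕ} (A : Finset V) (Φ : V → Fin m) :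
    (Finset.univ.biUnion fun i => A.filter fun v => Φ v = i) = A := by
  ext v; simp

lemma nbrCount_eq_sum {G : SimpleGraph V} {A R : Finset V} (hR : R ⊆ A) (w : V) :
    (nbrCount G R w : ℝ) = ∑ _v ∈ (A.filter fun u => G.Adj w u) ∩ R, (1 : ℝ) := by
  rw [Finset.sum_const, nsmul_eq_mul, mul_one, nbrCount]
  congr 2
  ext v
  simp only [Finset.mem_filter, Finset.mem_inter]
  exact ⟨fun h => ⟨⟨hR h.1, h.2⟩, h.1⟩, fun h => ⟨h.2, h.1.2⟩⟩

/-- The outcome of the main loop's body, from the outcomes on the machines. -/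
lemma sound_collect {G : SimpleGraph V} {m : ℕ} {A : Finset V} (Φ : V → Fin m)
    {out : Fin m → Finset V × Finset (Sym2 V)}
    (h : ∀ i, Sound G (A.filter fun v => Φ v = i) (out i).1 (out i).2) :
    Sound G A (Finset.univ.biUnion fun i => (out i).1) (Finset.univ.biUnion fun i => (out i).2) ∧
      (Finset.univ.biUnion fun i => (out i).2).card = ∑ i, (out i).2.card := by
  have := sound_biUnion Finset.univ (fun i => A.filter fun v => Φ v = i) (fun i => (out i).1)
    (fun i => (out i).2) (fun i _ j _ hij => Finset.disjoint_left.2 fun v hv hv' =>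
      hij ((Finset.mem_filter.1 hv).2.symm.trans (Finset.mem_filter.1 hv').2)) fun i _ => h i
  rwa [biUnion_fiber] at this

lemma ncard_edgeSet_inducedOn_le (G : SimpleGraph V) (B : Finset V) :
    (inducedOn G B).edgeSet.ncard ≤ ∑ v ∈ B, nbrCount G B v := by
  have hsub : (inducedOn G B).edgeSet ⊆
      ((B.sigma fun v => B.filter fun u => G.Adj v u).image fun p => s(p.1, p.2) : Finset (Sym2 V)) := by
    intro e he
    induction e with
    | _ x y =>
      simp only [Finset.coe_image, Set.mem_image, Finset.mem_coe, Finset.mem_sigma,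
        Finset.mem_filter]
      exact ⟨⟨x, y⟩, ⟨he.2.1, he.2.2, he.1⟩, rfl⟩
  refine (Set.ncard_le_ncard hsub (Finset.finite_toSet _)).trans ?_
  rw [Set.ncard_coe_finset]
  refine Finset.card_image_le.trans ?_
  rw [Finset.card_sigma]
  rfl

lemma nbrCount_biUnion_le {ι : Type*} (G : SimpleGraph V) (t : Finset ι) (B : ι → Finset V) (v : V) :
    nbrCount G (t.biUnion B) v ≤ ∑ i ∈ t, nbrCount G (B i) v := by
  rw [nbrCount, Finset.filter_biUnion]
  exact Finset.card_biUnion_le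

end MatchingLemmas

/-! ### The output of `matchHeavy` -/

section MatchHeavy

variable {V : Type*}

/-- The law of `v⋆`. -/
def starLaw (G : SimpleGraph V) (H F : Finset V) (v : V) : PMF (Option V) :=
  if h : v ∈ F ∧ (H.filter fun u => G.Adj v u).Nonempty then
    (PMF.uniformOfFinset (H.filter fun u => G.Adj v u) h.2).map some
  else PMF.pure none

lemma adj_of_mem_support_starLaw {G : SimpleGraph V} {H F : Finset V} {v w : V} {x : Option V}
    (hx : x ∈ (starLaw G H F v).support) (h : x = some w) : w ∈ H ∧ G.Adj v w := by
  rw [starLaw] at hx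
  split_ifs at hx with hv
  · rw [PMF.mem_support_map_iff] at hx
    obtain ⟨u, hu, rfl⟩ := hx
    obtain rfl : u = w := by simpa using h
    rw [PMF.mem_support_uniformOfFinset_iff, Finset.mem_filter] at hu
    exact hu
  · rw [PMF.mem_support_pure_iff] at hx
    rw [hx] at h
    cases h

variable [Fintype V]

/-- The set `E⋆`. -/
def starEdges (H F : Finset V) (star : V → Option V) (red : V → Bool) : Finset (V × V) :=
  Finset.univ.filter fun e : V × V =>
    e.1 ∈ F ∧ star e.1 = some e.2 ∧ red e.1 = true ∧ e.2 ∈ H ∧ red e.2 = false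

lemma matchHeavy_eq (ρ : OpenChoices V) (G : SimpleGraph V) (H F : Finset V) :
    matchHeavy ρ G H F =
      (indep fun v => starLaw G H F v).bind fun star =>
      (indep fun _ : V => PMF.uniformOfFintype Bool).bind fun red =>
      (ρ.selectEdges (starEdges H F star red)).map fun M => M.image fun e => s(e.1, e.2) := rfl

lemma mem_starEdges {H F : Finset V} {star : V → Option V} {red : V → Bool} {e : V × V} :
    e ∈ starEdges H F star red ↔
      e.1 ∈ F ∧ star e.1 = some e.2 ∧ red e.1 = true ∧ e.2 ∈ H ∧ red e.2 = false := by
  simp [starEdges]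

/-- The colours recover the direction of an edge: it runs from its red end to its blue end. -/
lemma starEdges_inj {H F : Finset V} {star : V → Option V} {red : V → Bool} {e f : V × V}
    (he : e ∈ starEdges H F star red) (hf : f ∈ starEdges H F star red)
    (h : s(e.1, e.2) = s(f.1, f.2)) : e = f := by
  rw [mem_starEdges] at he hf
  rcases Sym2.eq_iff.1 h with h | h
  · exact Prod.ext h.1 h.2
  · have := he.2.2.1
    rw [h.1, hf.2.2.2.2] at this
    cases this

/-- A red vertex lies only on the edge to its own star, a blue vertex only on the edge selected for
it, and the colours forbid playing both roles. -/
lemma isMatching_of_mem_support_matchHeavy {ρ : OpenChoices V} {G : SimpleGraph V}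
    {H F : Finset V} {T : Finset (Sym2 V)} (hT : T ∈ (matchHeavy ρ G H F).support) :
    IsMatching (inducedOn G (H ∪ F)) T := by
  rw [matchHeavy_eq, PMF.mem_support_bind_iff] at hT
  obtain ⟨star, hstar, hT⟩ := hT
  rw [PMF.mem_support_bind_iff] at hT
  obtain ⟨red, -, hT⟩ := hT
  rw [PMF.mem_support_map_iff] at hT
  obtain ⟨M, hM, rfl⟩ := hT
  obtain ⟨hsub, huniq⟩ := ρ.selectEdges_spec _ M hM
  rw [mem_support_indep] at hstar
  refine ⟨fun e he => ?_, fun e he f hf v hve hvf => ?_⟩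
  · obtain ⟨⟨a, b⟩, hab, rfl⟩ := Finset.mem_image.1 he
    have h := mem_starEdges.1 (hsub hab)
    exact ⟨(adj_of_mem_support_starLaw (hstar a) h.2.1).2, Finset.mem_union_right _ h.1,
      Finset.mem_union_left _ h.2.2.2.1⟩
  · obtain ⟨⟨a, b⟩, hab, rfl⟩ := Finset.mem_image.1 he
    obtain ⟨⟨c, d⟩, hcd, rfl⟩ := Finset.mem_image.1 hf
    have h := mem_starEdges.1 (hsub hab)
    have h' := mem_starEdges.1 (hsub hcd)
    simp only [Sym2.mem_iff] at hve hvf h h' ⊢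
    rcases hve with rfl | rfl <;> rcases hvf with rfl | rfl
    · have : some b = some d := h.2.1.symm.trans h'.2.1
      rw [Option.some.inj this]
    · have := h.2.2.1; rw [h'.2.2.2.2] at this; cases this
    · have := h'.2.2.1; rw [h.2.2.2.2] at this; cases this
    · rw [(huniq v ⟨a, hsub hab⟩).unique hab hcd]

/-- Every blue vertex reached by a red friend receives a selected edge, and different blue vertices
receive different edges. -/
lemma card_covered_le {ρ : OpenChoices V} {H F : Finset V} {star : V → Option V}
    {red : V → Bool} {M : Finset (V × V)}
    (hM : M ∈ (ρ.selectEdges (starEdges H F star red)).support) :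
    (H.filter fun w => red w = false ∧ ∃ v, (v ∈ F ∧ star v = some w) ∧ red v = true).card ≤
      (M.image fun e => s(e.1, e.2)).card := by
  obtain ⟨hsub, huniq⟩ := ρ.selectEdges_spec _ M hM
  rw [Finset.card_image_of_injOn fun e he f hf h => starEdges_inj (hsub he) (hsub hf) h]
  refine (Finset.card_le_card fun w hw => ?_).trans (Finset.card_image_le (f := Prod.snd))
  obtain ⟨hwH, hb, v, hv, hr⟩ := Finset.mem_filter.1 hw
  obtain ⟨u, hu, -⟩ := huniq w ⟨v, mem_starEdges.2 ⟨hv.1, hv.2, hr, hwH, hb⟩⟩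
  exact Finset.mem_image.2 ⟨(u, w), hu, rfl⟩

lemma ex_uniform_bool (f : Bool → ℝ) :
    ex (PMF.uniformOfFintype Bool) f = (f true + f false) / 2 := by
  simp [ex]; ring

/-- The probability that `w` is blue and one of the vertices in `X` is red. -/
lemma ex_red (X : V → Prop) {w : V} (hw : ¬ X w) :
    pr (indep fun _ : V => PMF.uniformOfFintype Bool)
      (fun red => red w = false ∧ ∃ v, X v ∧ red v = true) =
      1 / 2 - 1 / 2 * ∏ v, (1 - if X v then 1 / 2 else 0) := by
  -- The event that `w` is blue is split according to whether some vertex of `X` is red. The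
  -- complementary part, "`w` blue and no vertex of `X` red", is a product of one indicator per
  -- vertex, so its probability factors.
  set g : V → Bool → ℝ := fun v b =>
    if (v = w → b = false) ∧ ¬ (X v ∧ b = true) then 1 else 0 with hg
  have h1 : ∀ red : V → Bool, (if red w = false ∧ ∃ v, X v ∧ red v = true then (1 : ℝ) else 0) =
      (if red w = false then 1 else 0) - ∏ v, g v (red v) := by
    intro red
    simp only [hg]
    rw [Finset.prod_ite_zero]
    simp only [Finset.prod_const_one, Finset.mem_univ, true_imp_iff]
    by_cases hr : red w = false
    · by_cases he : ∃ v, X v ∧ red v = true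
      · have : ¬ ∀ v, (v = w → red v = false) ∧ ¬ (X v ∧ red v = true) := fun h => by
          obtain ⟨v, hv⟩ := he; exact (h v).2 hv
        rw [if_pos ⟨hr, he⟩, if_pos hr, if_neg this]; norm_num
      · have : ∀ v, (v = w → red v = false) ∧ ¬ (X v ∧ red v = true) := fun v =>
          ⟨fun h => h ▸ hr, fun h => he ⟨v, h⟩⟩
        rw [if_neg (fun h => he h.2), if_pos hr, if_pos this]; norm_num
    · have : ¬ ∀ v, (v = w → red v = false) ∧ ¬ (X v ∧ red v = true) := fun h => hr ((h w).1 rfl)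
      rw [if_neg (fun h => hr h.1), if_neg hr, if_neg this]; norm_num
  rw [pr, ex_congr fun red _ => (by congr! : _ = ite _ (1 : ℝ) 0).trans (h1 red), ex_sub,
    ex_indep_apply (fun _ : V => PMF.uniformOfFintype Bool) w
    (fun b => if b = false then 1 else 0), ex_indep_prod, ex_uniform_bool]
  have h2 : ∀ v, ex (PMF.uniformOfFintype Bool) (g v) =
      (if v = w then 1 / 2 else 1) * (1 - if X v then 1 / 2 else 0) := by
    intro v
    rw [ex_uniform_bool]
    simp only [hg]
    by_cases hv : v = w
    · subst hv; simp [hw]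
    · by_cases hX : X v <;> simp [hv, hX]
      norm_num
  rw [Finset.prod_congr rfl fun v _ => h2 v, Finset.prod_mul_distrib, Finset.prod_ite_eq']
  simp

lemma ex_starLaw {G : SimpleGraph V} {H F : Finset V} {v w : V} (hw : w ∈ H) :
    ex (starLaw G H F v) (fun x => 1 - if v ∈ F ∧ x = some w then 1 / 2 else 0) =
      1 - if v ∈ F ∧ G.Adj v w then 1 / (2 * (nbrCount G H v : ℝ)) else 0 := by
  rw [ex_sub, ex_const]
  congr 1
  rw [starLaw]
  split_ifs with h h' h'
  · rw [ex_map]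
    have hwm : w ∈ H.filter fun u => G.Adj v u := Finset.mem_filter.2 ⟨hw, h'.2⟩
    rw [ex, Finset.sum_eq_single w]
    · rw [PMF.uniformOfFinset_apply_of_mem _ hwm]
      simp [h.1, nbrCount, mul_comm]
    · intro u _ hu; simp [hu]
    · simp
  · rw [ex_map, ex]
    refine Finset.sum_eq_zero fun u _ => ?_
    by_cases hu : u = w
    · subst hu
      rw [PMF.uniformOfFinset_apply_of_notMem]
      · simp
      · exact fun hm => h' ⟨h.1, (Finset.mem_filter.1 hm).2⟩
    · simp [hu]
  · exact (h ⟨h'.1, w, Finset.mem_filter.2 ⟨hw, h'.2⟩⟩).elim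
  · rw [ex_pure]; simp

/-- The expected number of edges found by `matchHeavy` when the friends are chosen with the
prescribed probabilities. -/
lemma le_ex_matchHeavy (ρ : OpenChoices V) (G : SimpleGraph V) {A H B : Finset V} {D : ℝ}
    (hD : 0 < D) (hBH : B ⊆ H) {p : V → ℝ} (hp : ∀ v ∈ A, p v = (nbrCount G H v : ℝ) / (4 * D))
    (hp1 : ∀ v ∈ A, p v ≤ 1) (hB : ∀ w ∈ B, D / 8 ≤ (nbrCount G A w : ℝ)) :
    1 / 130 * (B.card : ℝ) ≤
      ex (randomSubset A p) fun F => ex (matchHeavy ρ G H F) fun T => (T.card : ℝ) := by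
  set cov : V → Finset V → (V → Option V) → (V → Bool) → Prop := fun w F star red =>
    red w = false ∧ ∃ v, (v ∈ F ∧ star v = some w) ∧ red v = true with hcov
  have step1 : ∀ F, ∑ w ∈ B, ex (indep fun v => starLaw G H F v) (fun star =>
      1 / 2 - 1 / 2 * ∏ v, (1 - if v ∈ F ∧ star v = some w then 1 / 2 else 0)) ≤
      ex (matchHeavy ρ G H F) fun T => (T.card : ℝ) := by
    intro F
    rw [matchHeavy_eq, ex_bind, ← ex_sum]
    refine ex_mono fun star hstar => ?_
    rw [mem_support_indep] at hstar
    rw [ex_bind]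
    have h1 : ∀ w ∈ B, 1 / 2 - 1 / 2 * ∏ v, (1 - if v ∈ F ∧ star v = some w then (1 : ℝ) / 2 else 0) =
        pr (indep fun _ : V => PMF.uniformOfFintype Bool) (cov w F star) := by
      intro w _
      have h2 := ex_red (fun v => v ∈ F ∧ star v = some w) (w := w) fun h =>
        G.loopless.irrefl w (adj_of_mem_support_starLaw (hstar w) h.2).2
      refine Eq.trans ?_ h2.symm
      congr!
    rw [Finset.sum_congr rfl h1]
    simp only [pr]
    rw [← ex_sum]
    refine ex_mono fun red _ => ?_
    rw [ex_map]
    refine const_le_ex fun M hM => ?_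
    have h2 : ∑ w ∈ B, (if cov w F star red then (1 : ℝ) else 0) =
        ((B.filter fun w => cov w F star red).card : ℝ) := by
      rw [Finset.card_filter]
      push_cast
      exact Finset.sum_congr rfl fun w _ => by congr!
    refine (le_of_eq ((Finset.sum_congr rfl fun w _ => by congr!).trans h2)).trans ?_
    exact_mod_cast (Finset.card_le_card (Finset.filter_subset_filter _ hBH)).trans
      (card_covered_le hM)
  -- Averaging over stars and colours leaves a product over the friends; averaging over the friends
  -- makes it at most 64/65. Hence 1/2 - (1/2)(64/65) = 1/130.
  have step2 : ∀ w ∈ B, (1 : ℝ) / 130 ≤ ex (randomSubset A p) fun F =>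
      ex (indep fun v => starLaw G H F v) (fun star =>
      1 / 2 - 1 / 2 * ∏ v, (1 - if v ∈ F ∧ star v = some w then 1 / 2 else 0)) := by
    intro w hw
    have h1 : ∀ F, ex (indep fun v => starLaw G H F v) (fun star =>
      1 / 2 - 1 / 2 * ∏ v, (1 - if v ∈ F ∧ star v = some w then 1 / 2 else 0)) =
      1 / 2 - 1 / 2 * ∏ v, (1 - if v ∈ F ∧ G.Adj v w then 1 / (2 * (nbrCount G H v : ℝ)) else 0) := by
      intro F
      rw [ex_sub, ex_const, ex_const_mul, ex_indep_prod (fun v => starLaw G H F v)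
        (fun v x => 1 - if v ∈ F ∧ x = some w then 1 / 2 else 0)]
      simp only [ex_starLaw (hBH hw)]
    simp only [h1]
    rw [ex_sub, ex_const, ex_const_mul, ex_randomSubset]
    have h2 := ex_indep_prod (fun v => coin (p v)) (fun v b =>
      1 - if (v ∈ A ∧ b = true) ∧ G.Adj v w then 1 / (2 * (nbrCount G H v : ℝ)) else 0)
    simp only [Finset.mem_filter]
    rw [h2]
    -- The number of heavy neighbours of `v` cancels between `p v` and the choice of the star, so
    -- every neighbour of `w` in `A` contributes the same factor 1 - 1/(8D).
    have h3 : ∏ v, ex (coin (p v)) (fun b =>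
        1 - if (v ∈ A ∧ b = true) ∧ G.Adj v w then 1 / (2 * (nbrCount G H v : ℝ)) else 0) ≤
        ∏ v, Real.exp (-if v ∈ A ∧ G.Adj w v then 1 / (8 * D) else 0) := by
      refine Finset.prod_le_prod (fun v _ => ex_nonneg fun b _ => ?_) fun v _ => ?_
      · split_ifs with h
        · have h5 : (1 : ℝ) ≤ nbrCount G H v := by
            exact_mod_cast Finset.card_pos.2 ⟨w, Finset.mem_filter.2 ⟨hBH hw, h.2⟩⟩
          have : 1 / (2 * (nbrCount G H v : ℝ)) ≤ 1 := by
            rw [div_le_one (by positivity)]; linarith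
          linarith
        · norm_num
      · by_cases h : v ∈ A ∧ G.Adj w v
        · have hvw : G.Adj v w := h.2.symm
          have h5 : (0 : ℝ) < nbrCount G H v := by
            exact_mod_cast Finset.card_pos.2 ⟨w, Finset.mem_filter.2 ⟨hBH hw, hvw⟩⟩
          have hp0 : 0 ≤ p v := by rw [hp v h.1]; positivity
          rw [ex_coin hp0 (hp1 v h.1)]
          simp only [h.1, hvw, if_true, h.2, true_and, and_true]
          refine le_trans (le_of_eq ?_) (Real.add_one_le_exp _)
          rw [hp v h.1]
          simp only [Bool.false_eq_true, if_false]
          field_simp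
          ring
        · have : ∀ b, ¬ ((v ∈ A ∧ b = true) ∧ G.Adj v w) := fun b hb => h ⟨hb.1.1, hb.2.symm⟩
          simp only [this, h, if_false, sub_zero, neg_zero, Real.exp_zero]
          rw [ex_const]
    have h4 : ∏ v, Real.exp (-if v ∈ A ∧ G.Adj w v then 1 / (8 * D) else 0) ≤ 64 / 65 := by
      rw [← Real.exp_sum, Finset.sum_neg_distrib, ← Finset.sum_filter, Finset.sum_const,
        nsmul_eq_mul]
      have hc : (Finset.univ.filter fun v => v ∈ A ∧ G.Adj w v).card = nbrCount G A w := by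
        rw [nbrCount]; congr 1; ext v; simp
      rw [hc]
      have h6 : 1 / 64 ≤ (nbrCount G A w : ℝ) * (1 / (8 * D)) := by
        have := mul_le_mul_of_nonneg_right (hB w hw) (by positivity : 0 ≤ 1 / (8 * D))
        refine le_trans (le_of_eq ?_) this
        field_simp; norm_num
      have h7 := Real.add_one_le_exp (1 / 64 : ℝ)
      calc Real.exp (-((nbrCount G A w : ℝ) * (1 / (8 * D)))) ≤ Real.exp (-(1 / 64)) :=
            Real.exp_le_exp.2 (by linarith)
        _ = (Real.exp (1 / 64))⁻¹ := Real.exp_neg _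
        _ ≤ (65 / 64)⁻¹ := inv_anti₀ (by norm_num) (by linarith)
        _ = 64 / 65 := by norm_num
    linarith [h3.trans h4]
  calc 1 / 130 * (B.card : ℝ) = ∑ w ∈ B, (1 : ℝ) / 130 := by simp [mul_comm]
    _ ≤ _ := Finset.sum_le_sum step2
    _ = _ := (ex_sum _ _ _).symm
    _ ≤ _ := ex_mono fun F _ => step1 F

end MatchHeavy

/-! ### The analysis of `globalAlg` -/

section GlobalAlg

variable {V : Type*} [Fintype V]

lemma ex_card_randomSubset {A : Finset V} {p : V → ℝ} (h0 : ∀ v ∈ A, 0 ≤ p v)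
    (h1 : ∀ v ∈ A, p v ≤ 1) : ex (randomSubset A p) (fun X => (X.card : ℝ)) = ∑ v ∈ A, p v := by
  simpa using ex_randomSubset_sum h0 h1 (fun _ => 1)

lemma globalAlg_of_one_le (ρ : OpenChoices V) (G : SimpleGraph V) {D : ℝ} (A : Finset V)
    (hD : 1 ≤ D) :
    globalAlg ρ G D A =
      (randomSubset A fun v => (nbrCount G (A.filter fun v => D / 2 ≤ (nbrCount G A v : ℝ)) v : ℝ) /
        (4 * D)).bind fun F =>
      (matchHeavy ρ G (A.filter fun v => D / 2 ≤ (nbrCount G A v : ℝ)) F).bind fun M =>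
      (globalAlg ρ G (D / 2) (A \ ((A.filter fun v => D / 2 ≤ (nbrCount G A v : ℝ)) ∪ F))).map
        fun M' => M ∪ M' := by
  rw [globalAlg]
  simp [hD]

lemma globalAlg_of_lt_one (ρ : OpenChoices V) (G : SimpleGraph V) {D : ℝ} (A : Finset V)
    (hD : ¬ 1 ≤ D) : globalAlg ρ G D A = PMF.pure ∅ := by
  rw [globalAlg]
  simp [hD]

lemma isMatching_of_mem_support_globalAlg {ρ : OpenChoices V} {G : SimpleGraph V} {D : ℝ}
    {A : Finset V} {M : Finset (Sym2 V)} (hM : M ∈ (globalAlg ρ G D A).support) :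
    IsMatching (inducedOn G A) M := by
  induction hk : ⌊D⌋₊ using Nat.strong_induction_on generalizing D A M with
  | _ k ih =>
  by_cases hD : 1 ≤ D
  · rw [globalAlg_of_one_le ρ G A hD, PMF.mem_support_bind_iff] at hM
    set H := A.filter fun v => D / 2 ≤ (nbrCount G A v : ℝ)
    obtain ⟨F, hF, hM⟩ := hM
    rw [PMF.mem_support_bind_iff] at hM
    obtain ⟨M₁, hM₁, hM⟩ := hM
    rw [PMF.mem_support_map_iff] at hM
    obtain ⟨M₂, hM₂, rfl⟩ := hM
    have h2 := ih _ (hk ▸ floor_half_lt hD) hM₂ rfl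
    have h1 := isMatching_of_mem_support_matchHeavy hM₁
    have hFA := subset_of_mem_support_randomSubset hF
    refine (IsMatching.union Finset.disjoint_sdiff h1 h2).1.mono (inducedOn_mono G ?_)
    exact Finset.union_subset (Finset.union_subset (Finset.filter_subset _ _) hFA)
      Finset.sdiff_subset
  · rw [globalAlg_of_lt_one ρ G A hD, PMF.mem_support_pure_iff] at hM
    exact hM ▸ isMatching_empty _

/-- `globalAlg` computes a constant-factor approximation in expectation. -/
lemma card_edgesIn_le_ex_globalAlg (ρ : OpenChoices V) {G : SimpleGraph V} {N : Finset (Sym2 V)}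
    (hN : IsMatching G N) {D : ℝ} {A : Finset V} (hdeg : ∀ v ∈ A, (nbrCount G A v : ℝ) ≤ D) :
    ((edgesIn N A).card : ℝ) ≤ 400 * ex (globalAlg ρ G D A) fun M => (M.card : ℝ) := by
  induction hk : ⌊D⌋₊ using Nat.strong_induction_on generalizing D A with
  | _ k ih =>
  by_cases hD : 1 ≤ D
  · rw [globalAlg_of_one_le ρ G A hD]
    set H := A.filter fun v => D / 2 ≤ (nbrCount G A v : ℝ) with hH
    have hD0 : 0 < D := by linarith
    have hHA : H ⊆ A := Finset.filter_subset _ _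
    have hp0 : ∀ v ∈ A, 0 ≤ (nbrCount G H v : ℝ) / (4 * D) := fun v _ => by positivity
    have hp1 : ∀ v ∈ A, (nbrCount G H v : ℝ) / (4 * D) ≤ 1 := fun v hv => by
      rw [div_le_one (by positivity)]
      have : (nbrCount G H v : ℝ) ≤ nbrCount G A v := by exact_mod_cast nbrCount_mono G hHA v
      linarith [hdeg v hv]
    have hMH := le_ex_matchHeavy ρ G (A := A) (H := H) (B := H) hD0 subset_rfl
      (p := fun v => (nbrCount G H v : ℝ) / (4 * D)) (fun _ _ => rfl) hp1 (fun w hw => by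
        have := (Finset.mem_filter.1 hw).2
        linarith)
    have hF : ex (randomSubset A fun v => (nbrCount G H v : ℝ) / (4 * D))
        (fun F => (F.card : ℝ)) ≤ 1 / 4 * H.card := by
      rw [ex_card_randomSubset hp0 hp1]
      exact sum_nbrCount_div_le G hD0 fun v hv => by linarith [hdeg v (hHA hv)]
    -- Potential argument: the round destroys at most |H| + |F| edges of `N`, the induction
    -- hypothesis covers the edges that remain, and the round's own matching pays, because 400/130
    -- exceeds 1 + 1/4.
    have hlow : ex (randomSubset A fun v => (nbrCount G H v : ℝ) / (4 * D)) (fun F =>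
        ((edgesIn N A).card : ℝ) - H.card - F.card +
          400 * ex (matchHeavy ρ G H F) fun T => (T.card : ℝ)) ≤
        ex (randomSubset A fun v => (nbrCount G H v : ℝ) / (4 * D)) fun F =>
          400 * ex ((matchHeavy ρ G H F).bind fun M =>
            (globalAlg ρ G (D / 2) (A \ (H ∪ F))).map fun M' => M ∪ M') fun M => (M.card : ℝ) := by
      refine ex_mono fun F hFs => ?_
      have hih := ih _ (hk ▸ floor_half_lt hD) (D := D / 2) (A := A \ (H ∪ F)) (fun v hv => by
        obtain ⟨hvA, hvn⟩ := Finset.mem_sdiff.1 hv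
        have h1 : ¬ D / 2 ≤ (nbrCount G A v : ℝ) := fun h =>
          hvn (Finset.mem_union_left _ (Finset.mem_filter.2 ⟨hvA, h⟩))
        have h2 : (nbrCount G (A \ (H ∪ F)) v : ℝ) ≤ nbrCount G A v := by
          exact_mod_cast nbrCount_mono G Finset.sdiff_subset v
        linarith) rfl
      have hsplit : ex ((matchHeavy ρ G H F).bind fun M =>
          (globalAlg ρ G (D / 2) (A \ (H ∪ F))).map fun M' => M ∪ M') (fun M => (M.card : ℝ)) =
          ex (matchHeavy ρ G H F) (fun T => (T.card : ℝ)) +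
          ex (globalAlg ρ G (D / 2) (A \ (H ∪ F))) fun T => (T.card : ℝ) := by
        rw [ex_bind]
        trans ex (matchHeavy ρ G H F) fun M => (M.card : ℝ) +
          ex (globalAlg ρ G (D / 2) (A \ (H ∪ F))) fun T => (T.card : ℝ)
        · refine ex_congr fun M hM => ?_
          rw [ex_map]
          trans ex (globalAlg ρ G (D / 2) (A \ (H ∪ F))) fun M' => (M.card : ℝ) + M'.card
          · refine ex_congr fun M' hM' => ?_
            have := (IsMatching.union Finset.disjoint_sdiff
              (isMatching_of_mem_support_matchHeavy hM)
              (isMatching_of_mem_support_globalAlg hM')).2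
            rw [Finset.card_union_of_disjoint this]
            push_cast; rfl
          · rw [ex_add, ex_const]
        · rw [ex_add, ex_const]
      have hrem := card_edgesIn_le hN (A := A) (A' := A \ (H ∪ F)) (H ∪ F) fun v hv hv' _ => by
        by_contra h; exact hv' (Finset.mem_sdiff.2 ⟨hv, h⟩)
      have hu := Finset.card_union_le H F
      have hrem' : ((edgesIn N A).card : ℝ) ≤
          (edgesIn N (A \ (H ∪ F))).card + (H.card + F.card) := by
        exact_mod_cast hrem.trans (by omega)
      rw [hsplit]
      linarith
    rw [ex_bind, ← ex_const_mul]
    refine le_trans ?_ hlow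
    rw [ex_add, ex_sub, ex_const, ex_const_mul]
    linarith [Nat.cast_nonneg (α := ℝ) H.card]
  · rw [edgesIn_eq_empty hN fun v hv => (hdeg v hv).trans_lt (not_le.1 hD)]
    rw [Finset.card_empty, Nat.cast_zero]
    exact mul_nonneg (by norm_num) (ex_nonneg fun _ _ => Nat.cast_nonneg _)

end GlobalAlg

/-! ### Soundness of the algorithms -/

section Soundness

variable {V : Type*} [Fintype V]

lemma localPhase_eq (ρ : OpenChoices V) (G : SimpleGraph V) (D : ℝ) (A : Finset V) :
    localPhase ρ G D A =
      (randomSubset A fun _ => muR (Fintype.card V)).bind fun R =>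
      (randomSubset A fun v =>
        muH (Fintype.card V) ((nbrCount G R v : ℝ) / muR (Fintype.card V) / D)).bind fun H =>
      (randomSubset A fun v => muF ((nbrCount G H v : ℝ) / D)).bind fun F =>
      (ρ.maximalMatching (inducedOn G (H ∪ F))).map fun M => (A \ (R ∪ H ∪ F), M) := rfl

lemma sound_of_mem_support_localPhase {ρ : OpenChoices V} {G : SimpleGraph V} {D : ℝ}
    {A : Finset V} {x : Finset V × Finset (Sym2 V)} (hx : x ∈ (localPhase ρ G D A).support) :
    Sound G A x.1 x.2 := by
  rw [localPhase_eq, PMF.mem_support_bind_iff] at hx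
  obtain ⟨R, hR, hx⟩ := hx
  rw [PMF.mem_support_bind_iff] at hx
  obtain ⟨H, hH, hx⟩ := hx
  rw [PMF.mem_support_bind_iff] at hx
  obtain ⟨F, hF, hx⟩ := hx
  rw [PMF.mem_support_map_iff] at hx
  obtain ⟨M, hM, rfl⟩ := hx
  refine ⟨Finset.sdiff_subset, (ρ.maximalMatching_spec _ M hM).1.mono (inducedOn_mono G ?_)⟩
  intro v hv
  have hvA : v ∈ A := by
    rcases Finset.mem_union.1 hv with h | h
    exacts [subset_of_mem_support_randomSubset hH h, subset_of_mem_support_randomSubset hF h]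
  refine Finset.mem_sdiff.2 ⟨hvA, fun h => (Finset.mem_sdiff.1 h).2 ?_⟩
  rw [Finset.union_assoc]
  exact Finset.mem_union_right _ hv

lemma sound_of_mem_support_localPhases {ρ : OpenChoices V} {G : SimpleGraph V} {t : ℕ} {D : ℝ}
    {A : Finset V} {x : Finset V × Finset (Sym2 V)} (hx : x ∈ (localPhases ρ G t D A).support) :
    Sound G A x.1 x.2 := by
  induction t generalizing D A x with
  | zero =>
    rw [localPhases, PMF.mem_support_pure_iff] at hx
    exact hx ▸ sound_refl G A
  | succ t ih =>
    rw [localPhases, PMF.mem_support_bind_iff] at hx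
    obtain ⟨y, hy, hx⟩ := hx
    rw [PMF.mem_support_map_iff] at hx
    obtain ⟨z, hz, rfl⟩ := hx
    exact ((sound_of_mem_support_localPhase hy).trans (ih hz)).1

lemma sound_of_mem_support_machines {ρ : OpenChoices V} {G : SimpleGraph V} {S m t : ℕ} {D : ℝ}
    {A : Finset V} {Φ : V → Fin m} {out : Fin m → Finset V × Finset (Sym2 V)}
    (hout : out ∈ (indep fun i : Fin m =>
      localPhases ρ G t D (securityCheck G S (A.filter fun v => Φ v = i))).support) (i : Fin m) :
    Sound G (A.filter fun v => Φ v = i) (out i).1 (out i).2 :=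
  (sound_of_mem_support_localPhases (mem_support_indep.1 hout i)).mono (securityCheck_subset _ _ _)

lemma sound_of_mem_support_loopBody {ρ : OpenChoices V} {G : SimpleGraph V} {S m t : ℕ} [NeZero m]
    {D : ℝ} {A : Finset V} {x : Finset V × Finset (Sym2 V)}
    (hx : x ∈ (loopBody ρ G S m t D A).support) : Sound G A x.1 x.2 := by
  rw [loopBody, PMF.mem_support_bind_iff] at hx
  obtain ⟨Φ, -, hx⟩ := hx
  rw [PMF.mem_support_map_iff] at hx
  obtain ⟨out, hout, rfl⟩ := hx
  exact (sound_collect Φ fun i => sound_of_mem_support_machines hout i).1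

lemma parallelLoop_of_le (ρ : OpenChoices V) (G : SimpleGraph V) {S : ℕ}
    (hn : 2 ≤ Fintype.card V) (hS : 1 ≤ S) (hSn : S ≤ Fintype.card V) {D : ℝ} (A : Finset V)
    (h : threshold (Fintype.card V) S ≤ D) :
    parallelLoop ρ G S hn hS hSn D A =
      have : NeZero (numMachines (Fintype.card V) S D) := ⟨(numMachines_pos hn hS hSn h).ne'⟩
      (loopBody ρ G S (numMachines (Fintype.card V) S D) (numPhases (Fintype.card V) S D) D A).bind
        fun x => (parallelLoop ρ G S hn hS hSn (D / 2 ^ numPhases (Fintype.card V) S D) x.1).map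
          fun M => x.2 ∪ M := by
  rw [parallelLoop]
  simp [h]

lemma parallelLoop_of_lt (ρ : OpenChoices V) (G : SimpleGraph V) {S : ℕ}
    (hn : 2 ≤ Fintype.card V) (hS : 1 ≤ S) (hSn : S ≤ Fintype.card V) {D : ℝ} (A : Finset V)
    (h : ¬ threshold (Fintype.card V) S ≤ D) :
    parallelLoop ρ G S hn hS hSn D A =
      globalAlg ρ G (2 * D) (A.filter fun v => (nbrCount G A v : ℝ) < 2 * D) := by
  rw [parallelLoop]
  simp [h]

lemma isMatching_of_mem_support_parallelLoop {ρ : OpenChoices V} {G : SimpleGraph V} {S : ℕ}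
    {hn : 2 ≤ Fintype.card V} {hS : 1 ≤ S} {hSn : S ≤ Fintype.card V} {D : ℝ}
    {A : Finset V} {M : Finset (Sym2 V)}
    (hM : M ∈ (parallelLoop ρ G S hn hS hSn D A).support) : IsMatching (inducedOn G A) M := by
  induction hk : ⌊D⌋₊ using Nat.strong_induction_on generalizing D A M with
  | _ k ih =>
  by_cases hD : threshold (Fintype.card V) S ≤ D
  · rw [parallelLoop_of_le ρ G hn hS hSn A hD, PMF.mem_support_bind_iff] at hM
    obtain ⟨x, hx, hM⟩ := hM
    rw [PMF.mem_support_map_iff] at hM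
    obtain ⟨M', hM', rfl⟩ := hM
    have h2 := ih _ (hk ▸ floor_next_lt hn hS hSn hD) hM' rfl
    have : NeZero (numMachines (Fintype.card V) S D) := ⟨(numMachines_pos hn hS hSn hD).ne'⟩
    have h1 := sound_of_mem_support_loopBody hx
    have h3 : Sound G x.1 ∅ M' := ⟨Finset.empty_subset _, by rwa [Finset.sdiff_empty]⟩
    have h4 := (h1.trans h3).1.2
    rwa [Finset.sdiff_empty] at h4
  · rw [parallelLoop_of_lt ρ G hn hS hSn A hD] at hM
    exact (isMatching_of_mem_support_globalAlg hM).mono (inducedOn_mono G (Finset.filter_subset _ _))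

end Soundness

/-! ### The selection probabilities -/

section Probabilities

lemma log_pos_of_two_le {n : ℕ} (hn : 2 ≤ n) : 1 / 2 < Real.log n := by
  have h1 : Real.log 2 ≤ Real.log n := Real.log_le_log (by norm_num) (by exact_mod_cast hn)
  have h2 := Real.log_two_gt_d9
  linarith

lemma muR_pos {n : ℕ} (hn : 2 ≤ n) : 0 < muR n := by
  have := log_pos_of_two_le hn
  unfold muR; positivity

lemma muR_le {n : ℕ} (hn : 2 ≤ n) : muR n ≤ 1 / 100 := by
  have := log_pos_of_two_le hn
  unfold muR
  rw [inv_le_comm₀ (by positivity) (by norm_num)]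
  norm_num
  linarith

lemma alpha_pos {n : ℕ} (hn : 2 ≤ n) : 48 < alpha n := by
  have := log_pos_of_two_le hn
  unfold alpha; linarith

lemma muH_of_le (n : ℕ) {r : ℝ} (h : r ≤ 1 / 2) :
    muH n r = 1 / 2 * Real.exp (alpha n / 2 * (r - 1 / 2)) := if_pos h

lemma muH_of_ge (n : ℕ) {r : ℝ} (h : 1 / 2 ≤ r) :
    muH n r = 1 - 1 / 2 * Real.exp (-(alpha n / 2) * (r - 1 / 2)) := by
  rcases h.eq_or_lt with rfl | h
  · rw [muH_of_le n le_rfl]; norm_num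
  · exact if_neg (not_le.2 h)

lemma muH_nonneg {n : ℕ} (hn : 2 ≤ n) (r : ℝ) : 0 ≤ muH n r := by
  have ha := alpha_pos hn
  rcases le_total r (1 / 2) with h | h
  · rw [muH_of_le n h]; positivity
  · rw [muH_of_ge n h]
    have : Real.exp (-(alpha n / 2) * (r - 1 / 2)) ≤ 1 := Real.exp_le_one_iff.2 (by nlinarith)
    linarith

lemma muH_lt_one {n : ℕ} (hn : 2 ≤ n) (r : ℝ) : muH n r < 1 := by
  have ha := alpha_pos hn
  rcases le_total r (1 / 2) with h | h
  · rw [muH_of_le n h]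
    have : Real.exp (alpha n / 2 * (r - 1 / 2)) ≤ 1 := Real.exp_le_one_iff.2 (by nlinarith)
    linarith
  · rw [muH_of_ge n h]
    have := Real.exp_pos (-(alpha n / 2) * (r - 1 / 2))
    linarith

lemma muH_mono {n : ℕ} (hn : 2 ≤ n) : Monotone (muH n) := by
  intro x y hxy
  have ha := alpha_pos hn
  rcases le_total y (1 / 2) with hy | hy
  · rw [muH_of_le n hy, muH_of_le n (hxy.trans hy)]
    gcongr
  rcases le_total x (1 / 2) with hx | hx
  · rw [muH_of_le n hx, muH_of_ge n hy]
    have h1 : Real.exp (alpha n / 2 * (x - 1 / 2)) ≤ 1 := Real.exp_le_one_iff.2 (by nlinarith)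
    have h2 : Real.exp (-(alpha n / 2) * (y - 1 / 2)) ≤ 1 := Real.exp_le_one_iff.2 (by nlinarith)
    linarith
  · rw [muH_of_ge n hx, muH_of_ge n hy]
    have : Real.exp (-(alpha n / 2) * (y - 1 / 2)) ≤ Real.exp (-(alpha n / 2) * (x - 1 / 2)) :=
      Real.exp_le_exp.2 (by nlinarith)
    linarith

/-- Above 1/2 the function 1 - `muH` is exactly an exponential of rate α/2. Below 1/2 it decays no
faster. This relative smoothness keeps an error in the estimated degree a relative error of the
survival probability. -/
lemma one_sub_muH_le {n : ℕ} (hn : 2 ≤ n) {x y : ℝ} (hxy : x ≤ y) :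
    1 - muH n x ≤ Real.exp (alpha n / 2 * (y - x)) * (1 - muH n y) := by
  have ha := alpha_pos hn
  -- This is the monotonicity of t(1 - t/2) on [0, 1].
  have key : ∀ a b : ℝ, 0 < a → a ≤ b → b ≤ 1 → 1 - 1 / 2 * a ≤ b / a * (1 - 1 / 2 * b) := by
    intro a b ha hab hb
    have e : b / a * (1 - 1 / 2 * b) = b * (1 - 1 / 2 * b) / a := by ring
    rw [e, le_div_iff₀ ha]
    nlinarith
  have hle : ∀ z : ℝ, x ≤ z → z ≤ 1 / 2 →
      1 - muH n x ≤ Real.exp (alpha n / 2 * (z - x)) * (1 - muH n z) := by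
    intro z hxz hz
    rw [muH_of_le n (hxz.trans hz), muH_of_le n hz]
    have := key (Real.exp (alpha n / 2 * (x - 1 / 2))) (Real.exp (alpha n / 2 * (z - 1 / 2)))
      (Real.exp_pos _) (Real.exp_le_exp.2 (by nlinarith)) (Real.exp_le_one_iff.2 (by nlinarith))
    rw [← Real.exp_sub] at this
    convert this using 3
    ring
  have hge : ∀ z : ℝ, 1 / 2 ≤ z → z ≤ y →
      1 - muH n z = Real.exp (alpha n / 2 * (y - z)) * (1 - muH n y) := by
    intro z hz hzy
    rw [muH_of_ge n hz, muH_of_ge n (hz.trans hzy), sub_sub_cancel, sub_sub_cancel, mul_left_comm,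
      ← Real.exp_add]
    congr 2
    ring
  rcases le_total y (1 / 2) with hy | hy
  · exact hle y hxy hy
  rcases le_total x (1 / 2) with hx | hx
  · calc 1 - muH n x ≤ Real.exp (alpha n / 2 * (1 / 2 - x)) * (1 - muH n (1 / 2)) :=
          hle _ hx le_rfl
      _ = Real.exp (alpha n / 2 * (y - x)) * (1 - muH n y) := by
          rw [hge _ le_rfl hy, ← mul_assoc, ← Real.exp_add]
          congr 2
          ring
  · exact (hge x hx hxy).le

/-- Small changes of the argument change `1 - muH` by a small factor. -/
lemma abs_muH_sub_le {n : ℕ} (hn : 2 ≤ n) {x y : ℝ} (h : alpha n * |x - y| ≤ 1) :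
    |muH n x - muH n y| ≤ alpha n * |x - y| * (1 - muH n y) := by
  have ha := alpha_pos hn
  have hy := muH_lt_one hn y
  rcases le_total x y with hxy | hxy
  · have h1 := muH_mono hn hxy
    have h2 := one_sub_muH_le hn hxy
    rw [abs_sub_comm x y, abs_of_nonneg (sub_nonneg.2 hxy)] at h ⊢
    rw [abs_sub_comm, abs_of_nonneg (sub_nonneg.2 h1)]
    set t := alpha n / 2 * (y - x) with ht
    have ht0 : 0 ≤ t := mul_nonneg (by linarith) (sub_nonneg.2 hxy)
    have ht1 : |t| ≤ 1 := by rw [abs_of_nonneg ht0, ht]; linarith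
    have h3 := exp_sub_one_le ht1
    have h4 : Real.exp t - 1 ≤ alpha n * (y - x) := by
      have : t ^ 2 ≤ t := by nlinarith [le_abs_self t]
      have e : alpha n * (y - x) = 2 * t := by rw [ht]; ring
      linarith
    nlinarith
  · have h1 := muH_mono hn hxy
    have h2 := one_sub_muH_le hn hxy
    rw [abs_of_nonneg (sub_nonneg.2 hxy)] at h ⊢
    rw [abs_of_nonneg (sub_nonneg.2 h1)]
    set t := alpha n / 2 * (x - y) with ht
    have ht0 : 0 ≤ t := mul_nonneg (by linarith) (sub_nonneg.2 hxy)
    have h3 : Real.exp (-t) * (1 - muH n y) ≤ 1 - muH n x := by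
      calc Real.exp (-t) * (1 - muH n y) ≤ Real.exp (-t) * (Real.exp t * (1 - muH n x)) := by gcongr
        _ = 1 - muH n x := by rw [← mul_assoc, ← Real.exp_add]; simp
    have h4 := Real.add_one_le_exp (-t)
    have e : alpha n * (x - y) = 2 * t := by rw [ht]; ring
    nlinarith

lemma muF_nonneg (r : ℝ) : 0 ≤ muF r := by
  unfold muF
  split_ifs
  exacts [le_max_right _ _, zero_le_one]

lemma muF_le_one (r : ℝ) : muF r ≤ 1 := by
  unfold muF
  split_ifs with h
  exacts [max_le (by linarith) zero_le_one, le_rfl]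

lemma muF_eq {r : ℝ} (h0 : 0 ≤ r) (h4 : r ≤ 4) : muF r = r / 4 := by
  rw [muF, if_pos h4, max_eq_left (by positivity)]

lemma exp_neg_mul_log {n : ℕ} (hn : 2 ≤ n) (k : ℕ) :
    Real.exp (-(k * Real.log n)) = 1 / (n : ℝ) ^ k := by
  have hn' : (0 : ℝ) < n := by exact_mod_cast (by omega : 0 < n)
  rw [Real.exp_neg, mul_comm, Real.exp_mul, Real.exp_log hn', Real.rpow_natCast, one_div]

end Probabilities

/-! ### The expected size of the matching found in one local phase -/

section LocalPhase

variable {V : Type*} [Fintype V]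

/-- A vertex of small degree is unlikely to be classified as heavy. -/
lemma ex_muH_light_le (G : SimpleGraph V) {A : Finset V} {D : ℝ} (hn : 2 ≤ Fintype.card V)
    (hR : 320 * Real.log (Fintype.card V) ≤ muR (Fintype.card V) * D) {w : V}
    (hw : (nbrCount G A w : ℝ) < D / 8) :
    ex (randomSubset A fun _ => muR (Fintype.card V)) (fun R =>
      muH (Fintype.card V) ((nbrCount G R w : ℝ) / muR (Fintype.card V) / D)) ≤
      3 / (Fintype.card V : ℝ) ^ 10 := by
  set n := Fintype.card V with hndef
  have hlog := log_pos_of_two_le hn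
  have hmu := muR_pos hn
  have hmu1 := muR_le hn
  have hD : 0 < D := by
    by_contra h
    nlinarith
  have hch := chernoff_randomSubset (A := A) (B := A.filter fun u => G.Adj w u)
    (Finset.filter_subset _ _) (p := fun _ => muR n) (f := fun _ => 1) (fun _ _ => hmu.le)
    (fun _ _ => by linarith) (fun _ => zero_le_one) (fun _ => le_rfl) (M := muR n * D / 8)
    (l := muR n * D / 8) (by
      rw [Finset.sum_const, nsmul_eq_mul]
      change (nbrCount G A w : ℝ) * _ ≤ _
      nlinarith) (by positivity) (by linarith [mul_pos hmu hD]) (by positivity)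
  have hexp : 2 * Real.exp (-((muR n * D / 8) ^ 2 / (4 * (muR n * D / 8)))) ≤ 2 / (n : ℝ) ^ 10 := by
    have h1 := exp_neg_mul_log hn 10
    push_cast at h1
    rw [show (2 : ℝ) / (n : ℝ) ^ 10 = 2 * (1 / (n : ℝ) ^ 10) by ring, ← h1]
    have h2 : (muR n * D / 8) ^ 2 / (4 * (muR n * D / 8)) = muR n * D / 32 := by
      field_simp; norm_num
    rw [h2]
    gcongr
    linarith
  -- A true degree below D/8 is estimated below D/4 unless sampling fails; at 1/4 the exponent in
  -- `muH` is -12 ln n.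
  have hmuH : muH n (1 / 4) ≤ 1 / (n : ℝ) ^ 10 := by
    rw [muH_of_le n (by norm_num), ← exp_neg_mul_log hn 10]
    push_cast
    have : Real.exp (alpha n / 2 * (1 / 4 - 1 / 2)) ≤ Real.exp (-(10 * Real.log n)) :=
      Real.exp_le_exp.2 (by unfold alpha; linarith)
    linarith [Real.exp_pos (-(10 * Real.log n))]
  calc _ ≤ ex (randomSubset A fun _ => muR n) (fun R =>
        (if muR n * D / 8 ≤ |∑ v ∈ (A.filter fun u => G.Adj w u) ∩ R, (1 : ℝ) -
          ∑ v ∈ A.filter fun u => G.Adj w u, muR n * 1| then 1 else 0) + muH n (1 / 4)) := by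
        refine ex_mono fun R hR' => ?_
        have hRA := subset_of_mem_support_randomSubset hR'
        rw [← nbrCount_eq_sum hRA]
        split_ifs with h
        · linarith [muH_lt_one hn ((nbrCount G R w : ℝ) / muR n / D), muH_nonneg hn (1 / 4)]
        · rw [zero_add]
          refine muH_mono hn ?_
          rw [div_div, div_le_iff₀ (by positivity)]
          have h1 := (abs_lt.1 (not_le.1 h)).2
          have h2 : ∑ v ∈ A.filter (fun u => G.Adj w u), muR n * 1 = muR n * nbrCount G A w := by
            rw [Finset.sum_const, nsmul_eq_mul, nbrCount]; ring
          rw [h2] at h1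
          nlinarith
    _ ≤ 2 / (n : ℝ) ^ 10 + 1 / (n : ℝ) ^ 10 := by
        rw [ex_add, ex_const]
        exact add_le_add (hch.trans hexp) hmuH
    _ = 3 / (n : ℝ) ^ 10 := by ring

/-- A local phase does not run `matchHeavy`. It serves only as a competitor that bounds an arbitrary
maximal matching from below. -/
lemma half_card_le_ex_maximalMatching (ρ : OpenChoices V) (G : SimpleGraph V) (H F : Finset V) :
    ex (matchHeavy ρ G H F) (fun T => (T.card : ℝ)) ≤
      2 * ex (ρ.maximalMatching (inducedOn G (H ∪ F))) fun M => (M.card : ℝ) := by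
  refine ex_le_const fun T hT => ?_
  rw [← ex_const_mul]
  refine const_le_ex fun M hM => ?_
  exact_mod_cast card_le_two_mul_of_maximal (ρ.maximalMatching_spec _ M hM)
    (isMatching_of_mem_support_matchHeavy hT)

/-- One local phase removes few vertices of `X` compared to the expected size of the matching that
it finds. -/
lemma card_inter_le_ex_localPhase (ρ : OpenChoices V) {G : SimpleGraph V} {A : Finset V} {D : ℝ}
    (hn : 2 ≤ Fintype.card V)
    (hR : 320 * Real.log (Fintype.card V) ≤ muR (Fintype.card V) * D)
    (hdeg : ∀ v ∈ A, (nbrCount G A v : ℝ) ≤ 2 * D) (X : Finset V) :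
    ((A ∩ X).card : ℝ) ≤
      ex (localPhase ρ G D A) (fun x => ((x.1 ∩ X).card : ℝ) + 400 * (x.2.card : ℝ)) +
        muR (Fintype.card V) * (A ∩ X).card + 5 / (Fintype.card V : ℝ) ^ 9 := by
  set n := Fintype.card V with hndef
  have hlog := log_pos_of_two_le hn
  have hmu := muR_pos hn
  have hmu1 := muR_le hn
  have hD : 0 < D := by
    by_contra h
    nlinarith
  set light : V → ℝ := fun w => if (nbrCount G A w : ℝ) < D / 8 then 1 else 0 with hlight
  -- Each heavy vertex costs at most 3/2 in expectation, itself and its share of friends. If it is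
  -- not light it earns at least 200/130 > 3/2, as 400 times the maximal matching is at least 200
  -- times the competitor. Light vertices remain unpaid.
  have stepF : ∀ R ⊆ A, ∀ H ⊆ A, ((A ∩ X).card : ℝ) - (R ∩ X).card - 3 / 2 * ∑ w ∈ H, light w ≤
      ex (randomSubset A fun v => muF ((nbrCount G H v : ℝ) / D)) fun F =>
        ex (ρ.maximalMatching (inducedOn G (H ∪ F))) fun M =>
          (((A \ (R ∪ H ∪ F)) ∩ X).card : ℝ) + 400 * (M.card : ℝ) := by
    intro R hRA H hHA
    set B := H.filter fun w => ¬ (nbrCount G A w : ℝ) < D / 8 with hB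
    have hH4 : ∀ v ∈ A, (nbrCount G H v : ℝ) ≤ 2 * D := fun v hv => by
      have : (nbrCount G H v : ℝ) ≤ nbrCount G A v := by exact_mod_cast nbrCount_mono G hHA v
      exact this.trans (hdeg v hv)
    have hp : ∀ v ∈ A, muF ((nbrCount G H v : ℝ) / D) = (nbrCount G H v : ℝ) / (4 * D) :=
      fun v hv => by
        rw [muF_eq (by positivity) (by rw [div_le_iff₀ hD]; linarith [hH4 v hv])]
        field_simp
    have hmatch := le_ex_matchHeavy ρ G (A := A) (H := H) (B := B) hD (Finset.filter_subset _ _)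
      (p := fun v => muF ((nbrCount G H v : ℝ) / D)) hp (fun _ _ => muF_le_one _)
      fun w hw => not_lt.1 (Finset.mem_filter.1 hw).2
    have hF : ex (randomSubset A fun v => muF ((nbrCount G H v : ℝ) / D))
        (fun F => (F.card : ℝ)) ≤ 1 / 2 * H.card := by
      rw [ex_card_randomSubset (fun _ _ => muF_nonneg _) (fun _ _ => muF_le_one _),
        Finset.sum_congr rfl hp]
      exact sum_nbrCount_div_le G hD fun v hv => by linarith [hdeg v (hHA hv)]
    have hsplit : (H.card : ℝ) = ∑ w ∈ H, light w + B.card := by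
      rw [hlight, Finset.sum_boole, hB]
      exact_mod_cast (Finset.card_filter_add_card_filter_not _).symm
    have hpt : ex (randomSubset A fun v => muF ((nbrCount G H v : ℝ) / D)) (fun F =>
        ((A ∩ X).card : ℝ) - (R ∩ X).card - H.card - F.card +
          200 * ex (matchHeavy ρ G H F) fun T => (T.card : ℝ)) ≤
        ex (randomSubset A fun v => muF ((nbrCount G H v : ℝ) / D)) fun F =>
          ex (ρ.maximalMatching (inducedOn G (H ∪ F))) fun M =>
          (((A \ (R ∪ H ∪ F)) ∩ X).card : ℝ) + 400 * (M.card : ℝ) := by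
      refine ex_mono fun F _ => ?_
      rw [ex_add, ex_const, ex_const_mul]
      have h1 := half_card_le_ex_maximalMatching ρ G H F
      have h2 : A ∩ X ⊆ ((A \ (R ∪ H ∪ F)) ∩ X) ∪ (R ∩ X) ∪ H ∪ F := by
        intro v hv
        simp only [Finset.mem_inter, Finset.mem_union, Finset.mem_sdiff] at hv ⊢
        tauto
      have h3 : (A ∩ X).card ≤ ((A \ (R ∪ H ∪ F)) ∩ X).card + (R ∩ X).card + H.card + F.card := by
        refine (Finset.card_le_card h2).trans ?_
        refine (Finset.card_union_le _ _).trans (Nat.add_le_add_right ?_ _)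
        refine (Finset.card_union_le _ _).trans (Nat.add_le_add_right ?_ _)
        exact Finset.card_union_le _ _
      have h4 : ((A ∩ X).card : ℝ) ≤
          ((A \ (R ∪ H ∪ F)) ∩ X).card + (R ∩ X).card + H.card + F.card := by exact_mod_cast h3
      linarith
    refine le_trans ?_ hpt
    rw [ex_add, ex_sub, ex_const, ex_const_mul]
    have hBn : (0 : ℝ) ≤ B.card := Nat.cast_nonneg _
    linarith
  -- Light vertices are selected with probability at most 3/n^10 each, so all of them together cost
  -- a negligible additive amount.
  have hlightR : ex (randomSubset A fun _ => muR n) (fun R =>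
      ∑ w ∈ A, muH n ((nbrCount G R w : ℝ) / muR n / D) * light w) ≤ 3 / (n : ℝ) ^ 9 := by
    rw [ex_sum]
    have hn0 : (0 : ℝ) < n := by exact_mod_cast (by omega : 0 < n)
    calc _ ≤ ∑ w ∈ A, 3 / (n : ℝ) ^ 10 := by
          refine Finset.sum_le_sum fun w _ => ?_
          rw [ex_mul_const]
          simp only [hlight]
          split_ifs with h
          · rw [mul_one]; exact ex_muH_light_le G hn hR h
          · rw [mul_zero]; positivity
      _ ≤ n * (3 / (n : ℝ) ^ 10) := by
          rw [Finset.sum_const, nsmul_eq_mul]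
          gcongr
          exact_mod_cast Finset.card_le_univ A
      _ = 3 / (n : ℝ) ^ 9 := by field_simp
  have hRX : ex (randomSubset A fun _ => muR n) (fun R => ((R ∩ X).card : ℝ)) =
      muR n * (A ∩ X).card := by
    have h := ex_randomSubset_sum (A := A) (p := fun _ => muR n) (fun _ _ => hmu.le)
      (fun _ _ => by linarith) (fun v => if v ∈ X then 1 else 0)
    simp only [Finset.sum_boole, ← Finset.mul_sum, Finset.filter_mem_eq_inter] at h
    exact h
  have hall : ((A ∩ X).card : ℝ) - muR n * (A ∩ X).card - 3 / 2 * (3 / (n : ℝ) ^ 9) ≤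
      ex (localPhase ρ G D A) (fun x => ((x.1 ∩ X).card : ℝ) + 400 * (x.2.card : ℝ)) := by
    rw [localPhase_eq, ex_bind]
    calc _ ≤ ex (randomSubset A fun _ => muR n) (fun R => ((A ∩ X).card : ℝ) - (R ∩ X).card -
            3 / 2 * ∑ w ∈ A, muH n ((nbrCount G R w : ℝ) / muR n / D) * light w) := by
          rw [ex_sub, ex_sub, ex_const, ex_const_mul, hRX]
          linarith
      _ ≤ _ := by
          refine ex_mono fun R hRs => ?_
          rw [ex_bind, ← ex_randomSubset_sum (fun _ _ => muH_nonneg hn _)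
            (fun _ _ => (muH_lt_one hn _).le) light]
          have hRA := subset_of_mem_support_randomSubset hRs
          calc _ = ex (randomSubset A fun v => muH n ((nbrCount G R v : ℝ) / muR n / D)) (fun H =>
                ((A ∩ X).card : ℝ) - (R ∩ X).card - 3 / 2 * ∑ w ∈ H, light w) := by
                rw [ex_sub, ex_const, ex_const_mul]
            _ ≤ _ := by
                refine ex_mono fun H hHs => ?_
                refine (stepF R hRA H (subset_of_mem_support_randomSubset hHs)).trans_eq ?_
                rw [ex_bind]
                simp only [ex_map]
  have h9 : 3 / 2 * (3 / (n : ℝ) ^ 9) ≤ 5 / (n : ℝ) ^ 9 := by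
    rw [← mul_div_assoc]
    gcongr
    norm_num
  linarith

end LocalPhase

/-! ### One local phase follows its mean field -/

section MeanFieldStep

variable {V : Type*}

lemma nbrCount_eq_sum_one (G : SimpleGraph V) (A : Finset V) (w : V) :
    (nbrCount G A w : ℝ) = ∑ _v ∈ A.filter (fun v => G.Adj w v), (1 : ℝ) := by
  simp [nbrCount]

/-- If the coefficients `x` are relatively close to `y`, so are weighted sums. -/
lemma abs_sum_mul_sub_le (B : Finset V) {c x y : V → ℝ} {δ : ℝ} (hc : ∀ v ∈ B, 0 ≤ c v)
    (h : ∀ v ∈ B, |x v - y v| ≤ δ * y v) :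
    |∑ v ∈ B, x v * c v - ∑ v ∈ B, c v * y v| ≤ δ * ∑ v ∈ B, c v * y v := by
  rw [← Finset.sum_sub_distrib, Finset.mul_sum]
  refine (Finset.abs_sum_le_sum_abs _ _).trans (Finset.sum_le_sum fun v hv => ?_)
  have e : x v * c v - c v * y v = c v * (x v - y v) := by ring
  rw [e, abs_mul, abs_of_nonneg (hc v hv)]
  nlinarith [mul_le_mul_of_nonneg_left (h v hv) (hc v hv)]

variable [Fintype V]

/-- The mean-field probability that a vertex with mean degree `d` and mean number `h` of heavy
neighbours survives a local phase. -/
def survival (n : ℕ) (D d h : ℝ) : ℝ :=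
  -- Above the cutoff the heavy selection keeps a vertex with probability at most n^(-9) in a
  -- typical run. Replacing this by 0 makes the support of the mean field an exact degree condition,
  -- while 7/10 leaves room for `muH` to be close to 1 there.
  if d ≤ 7 / 10 * D then (1 - muR n) * (1 - muH n (d / D)) * (1 - muF (h / D)) else 0

/-- The set `A` of remaining vertices is close to the mean field given by the degrees `d` and the
numbers `h` of heavy neighbours, also in terms of the linear statistics `f i` of its survivors. -/
structure NearMeanField {ι : Type*} (G : SimpleGraph V) (A : Finset V) (D η : ℝ) (d h : V → ℝ)
    (I : Finset ι) (f : ι → V → ℝ) (t E : ι → ℝ) : Prop where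
  deg : ∀ w ∈ A, |(nbrCount G A w : ℝ) - d w| ≤ η * D
  deg_le : ∀ w ∈ A, d w ≤ 3 / 2 * D
  heavy : ∀ w ∈ A, |∑ v ∈ A.filter (fun v => G.Adj w v), muH (Fintype.card V) (d v / D) - h w| ≤ η * D
  heavy_nonneg : ∀ w ∈ A, 0 ≤ h w
  heavy_le : ∀ w ∈ A, h w ≤ 2 * D
  nonneg : ∀ i w, 0 ≤ f i w
  le_one : ∀ i w, f i w ≤ 1
  stat : ∀ i ∈ I, |∑ w ∈ A, f i w * survival (Fintype.card V) D (d w) (h w) - t i| ≤ η * E i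
  target_le : ∀ i ∈ I, t i ≤ 3 / 2 * E i

/-- The scales `D` and `E i` are so large that sampling causes only relative errors `ξ`. -/
structure SmallNoise {ι : Type*} (n : ℕ) (D ξ η : ℝ) (I : Finset ι) (E : ι → ℝ) : Prop where
  pos : 0 < ξ
  le : ξ ≤ η
  small : alpha n * η ≤ 1 / 1000
  scale : 100 * Real.log n ≤ ξ ^ 2 * (muR n * D)
  scale_stat : ∀ i ∈ I, 100 * Real.log n ≤ ξ ^ 2 * E i

variable {ι : Type*} {G : SimpleGraph V} {A : Finset V} {D ξ η : ℝ} {d h : V → ℝ}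
  {I : Finset ι} {f : ι → V → ℝ} {t E : ι → ℝ}

lemma SmallNoise.eta_le {n : ℕ} (hn : 2 ≤ n) (hs : SmallNoise n D ξ η I E) : η ≤ 1 / 48000 := by
  have := alpha_pos hn
  have h1 := hs.small
  have h2 := hs.pos
  have h3 := hs.le
  nlinarith

lemma pos_of_scale {n : ℕ} (hn : 2 ≤ n) {ξ x : ℝ} (h : 100 * Real.log n ≤ ξ ^ 2 * x) : 0 < x := by
  have := log_pos_of_two_le hn
  by_contra hx
  nlinarith [sq_nonneg ξ]

lemma SmallNoise.D_pos {n : ℕ} (hn : 2 ≤ n) (hs : SmallNoise n D ξ η I E) : 0 < D := by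
  have := pos_of_scale hn hs.scale
  exact (pos_iff_pos_of_mul_pos this).1 (muR_pos hn)

/-- The form in which the Chernoff bound is applied throughout: mean at most 2x and deviation ξx
give the exponent ξ²x/8 ≥ 12.5 ln n. -/
lemma two_mul_exp_le {n : ℕ} (hn : 2 ≤ n) {ξ x : ℝ} (h : 100 * Real.log n ≤ ξ ^ 2 * x) :
    2 * Real.exp (-((ξ * x) ^ 2 / (4 * (2 * x)))) ≤ 2 / (n : ℝ) ^ 10 := by
  have hx := pos_of_scale hn h
  have hlog := log_pos_of_two_le hn
  have h1 := exp_neg_mul_log hn 10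
  push_cast at h1
  rw [show (2 : ℝ) / (n : ℝ) ^ 10 = 2 * (1 / (n : ℝ) ^ 10) by ring, ← h1]
  have h2 : (ξ * x) ^ 2 / (4 * (2 * x)) = ξ ^ 2 * x / 8 := by field_simp; ring
  rw [h2]
  gcongr
  linarith

/-- The reference sets of a typical run of a local phase. -/
def GoodR (G : SimpleGraph V) (A : Finset V) (D η : ℝ) (d h : V → ℝ) (I : Finset ι)
    (f : ι → V → ℝ) (t E : ι → ℝ) (R : Finset V) : Prop :=
  (∀ w ∈ A, |(nbrCount G R w : ℝ) / muR (Fintype.card V) / D - d w / D| ≤ 2 * η) ∧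
  ∀ i ∈ I, |∑ w ∈ A \ R, f i w * (if d w ≤ 7 / 10 * D then 1 else 0) *
    (1 - muF (h w / D)) * (1 - muH (Fintype.card V) (d w / D)) - t i| ≤ 2 * η * E i

lemma NearMeanField.nbrCount_le (hn : 2 ≤ Fintype.card V)
    (hm : NearMeanField G A D η d h I f t E) (hs : SmallNoise (Fintype.card V) D ξ η I E) {w : V}
    (hw : w ∈ A) : (nbrCount G A w : ℝ) ≤ 2 * D := by
  have h1 := (abs_le.1 (hm.deg w hw)).2
  have h2 := hm.deg_le w hw
  have h3 := hs.eta_le hn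
  have h4 := hs.D_pos hn
  nlinarith

/-- The survival probability has three factors, and the three random choices realise them in turn.
Here the factor 1 - `muR` is absorbed; the other two stay as deterministic weights. -/
lemma pr_not_goodR_le (hn : 2 ≤ Fintype.card V) (hm : NearMeanField G A D η d h I f t E)
    (hs : SmallNoise (Fintype.card V) D ξ η I E) :
    pr (randomSubset A fun _ => muR (Fintype.card V)) (fun R => ¬ GoodR G A D η d h I f t E R) ≤
      (Fintype.card V + I.card) * (2 / (Fintype.card V : ℝ) ^ 10) := by
  have hm' := fun w => NearMeanField.nbrCount_le (w := w) hn hm hs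
  set n := Fintype.card V with hndef
  have hmu := muR_pos hn
  have hmu1 := muR_le hn
  have hD := hs.D_pos hn
  have hη := hs.eta_le hn
  have hξ := hs.pos
  have hξη := hs.le
  set q : ι → V → ℝ := fun i w => f i w * (if d w ≤ 7 / 10 * D then 1 else 0) *
    (1 - muF (h w / D)) * (1 - muH n (d w / D)) with hq
  have hq0 : ∀ i w, 0 ≤ q i w := fun i w => by
    refine mul_nonneg (mul_nonneg (mul_nonneg (hm.nonneg i w) ?_) ?_) ?_
    · split_ifs <;> norm_num
    · exact sub_nonneg.2 (muF_le_one _)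
    · exact sub_nonneg.2 (muH_lt_one hn _).le
  have hq1 : ∀ i w, q i w ≤ 1 := fun i w => by
    refine mul_le_one₀ (mul_le_one₀ (mul_le_one₀ (hm.le_one i w) ?_ ?_) ?_ ?_) ?_ ?_
    · split_ifs <;> norm_num
    · split_ifs <;> norm_num
    · exact sub_nonneg.2 (muF_le_one _)
    · linarith [muF_nonneg (h w / D)]
    · exact sub_nonneg.2 (muH_lt_one hn _).le
    · linarith [muH_nonneg hn (d w / D)]
  have hsurv : ∀ i w, (1 - muR n) * q i w = f i w * survival n D (d w) (h w) := fun i w => by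
    simp only [hq, survival]
    split_ifs <;> ring
  have hb1 : ∀ w ∈ A, pr (randomSubset A fun _ => muR n) (fun R => ξ * (muR n * D) ≤
      |∑ _v ∈ A.filter (fun u => G.Adj w u) ∩ R, (1 : ℝ) -
        ∑ _v ∈ A.filter (fun u => G.Adj w u), muR n * 1|) ≤ 2 / (n : ℝ) ^ 10 := by
    intro w hw
    have hE := pos_of_scale hn hs.scale
    refine (chernoff_randomSubset (Finset.filter_subset _ _) (fun _ _ => hmu.le)
      (fun _ _ => by linarith) (fun _ => zero_le_one) (fun _ => le_rfl) (M := 2 * (muR n * D)) ?_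
      (by positivity) (by nlinarith) (by positivity)).trans (two_mul_exp_le hn hs.scale)
    rw [← Finset.mul_sum, ← nbrCount_eq_sum_one]
    nlinarith [hm' w hw]
  have hb2 : ∀ i ∈ I, pr (randomSubset A fun _ => muR n) (fun R => ξ * E i ≤
      |∑ v ∈ A \ R, q i v - ∑ v ∈ A, (1 - muR n) * q i v|) ≤ 2 / (n : ℝ) ^ 10 := by
    intro i hi
    have hE := pos_of_scale hn (hs.scale_stat i hi)
    refine (chernoff_compl_randomSubset subset_rfl (fun _ _ => hmu.le)
      (fun _ _ => by linarith) (hq0 i) (hq1 i) (M := 2 * E i) ?_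
      (by positivity) (by nlinarith) (by positivity)).trans (two_mul_exp_le hn (hs.scale_stat i hi))
    simp only [hsurv]
    have h1 := (abs_le.1 (hm.stat i hi)).2
    have h2 := hm.target_le i hi
    nlinarith
  have hcard : (A.card : ℝ) ≤ n := by exact_mod_cast Finset.card_le_univ A
  calc _ ≤ pr (randomSubset A fun _ => muR n) (fun R => (∃ w ∈ A, ξ * (muR n * D) ≤
      |∑ _v ∈ A.filter (fun u => G.Adj w u) ∩ R, (1 : ℝ) -
        ∑ _v ∈ A.filter (fun u => G.Adj w u), muR n * 1|) ∨ ∃ i ∈ I, ξ * E i ≤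
      |∑ v ∈ A \ R, q i v - ∑ v ∈ A, (1 - muR n) * q i v|) := by
        refine pr_mono fun R hR hbad => ?_
        by_contra hcon
        push Not at hcon
        refine hbad ⟨fun w hw => ?_, fun i hi => ?_⟩
        · have h1 := hcon.1 w hw
          rw [← nbrCount_eq_sum (subset_of_mem_support_randomSubset hR), ← Finset.mul_sum,
            ← nbrCount_eq_sum_one] at h1
          have h2 := hm.deg w hw
          rw [abs_lt] at h1
          rw [abs_le] at h2 ⊢
          have e : (nbrCount G R w : ℝ) / muR n / D - d w / D =
              ((nbrCount G R w : ℝ) / muR n - d w) / D := by rw [sub_div]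
          rw [e, le_div_iff₀ hD, div_le_iff₀ hD, le_sub_iff_add_le, sub_le_iff_le_add,
            le_div_iff₀ hmu, div_le_iff₀ hmu]
          constructor <;> nlinarith [mul_pos hmu hD]
        · have h1 := hcon.2 i hi
          simp only [hsurv] at h1
          have h2 := hm.stat i hi
          have hE := pos_of_scale hn (hs.scale_stat i hi)
          rw [abs_lt] at h1
          rw [abs_le] at h2 ⊢
          constructor <;> nlinarith
    _ ≤ A.card * (2 / (n : ℝ) ^ 10) + I.card * (2 / (n : ℝ) ^ 10) :=
        (pr_or_le _ _ _).trans (add_le_add (pr_exists_le_card_mul _ _ _ hb1)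
          (pr_exists_le_card_mul _ _ _ hb2))
    _ ≤ _ := by rw [add_mul]; gcongr

/-- The heavy sets of a typical run of a local phase. -/
def GoodH (G : SimpleGraph V) (A : Finset V) (D η : ℝ) (d h : V → ℝ) (I : Finset ι)
    (f : ι → V → ℝ) (t E : ι → ℝ) (R H : Finset V) : Prop :=
  (∀ w ∈ A, |(nbrCount G H w : ℝ) / D - h w / D| ≤ 5 * (alpha (Fintype.card V) * η)) ∧
  (∀ w ∈ A, ¬ d w ≤ 7 / 10 * D → w ∈ H) ∧
  ∀ i ∈ I, |∑ w ∈ (A \ R) \ H, f i w * (if d w ≤ 7 / 10 * D then 1 else 0) *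
    (1 - muF (h w / D)) - t i| ≤ 5 * (alpha (Fintype.card V) * η) * E i

/-- For a good reference set the estimates are off by at most 2η, so 1 - `muH` has relative error at
most 2αη. This shifts a heavy count by at most 2αη times the degree bound 2D, and the survivor
statistics by O(αη)E; sampling adds ξ. -/
lemma pr_not_goodH_le (hn : 2 ≤ Fintype.card V) (hm : NearMeanField G A D η d h I f t E)
    (hs : SmallNoise (Fintype.card V) D ξ η I E) {R : Finset V}
    (hR : GoodR G A D η d h I f t E R) :
    pr (randomSubset A fun v =>
        muH (Fintype.card V) ((nbrCount G R v : ℝ) / muR (Fintype.card V) / D))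
      (fun H => ¬ GoodH G A D η d h I f t E R H) ≤
      (Fintype.card V + I.card) * (2 / (Fintype.card V : ℝ) ^ 10) +
        Fintype.card V * (1 / (Fintype.card V : ℝ) ^ 9) := by
  have hm' := fun w => NearMeanField.nbrCount_le (w := w) hn hm hs
  obtain ⟨hR1, hR2⟩ := hR
  set n := Fintype.card V with hndef
  set r : V → ℝ := fun v => (nbrCount G R v : ℝ) / muR n / D with hr
  have hmu := muR_pos hn
  have hmu1 := muR_le hn
  have hD := hs.D_pos hn
  have hη := hs.eta_le hn
  have hξ := hs.pos
  have hξη := hs.le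
  have ha := alpha_pos hn
  have haη := hs.small
  have hη0 : 0 < η := by linarith
  have haη' : 48 * η ≤ alpha n * η := by nlinarith
  set q : ι → V → ℝ := fun i w => f i w * (if d w ≤ 7 / 10 * D then 1 else 0) *
    (1 - muF (h w / D)) with hq
  have hq0 : ∀ i w, 0 ≤ q i w := fun i w => by
    refine mul_nonneg (mul_nonneg (hm.nonneg i w) ?_) ?_
    · split_ifs <;> norm_num
    · exact sub_nonneg.2 (muF_le_one _)
  have hq1 : ∀ i w, q i w ≤ 1 := fun i w => by
    refine mul_le_one₀ (mul_le_one₀ (hm.le_one i w) ?_ ?_) ?_ ?_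
    · split_ifs <;> norm_num
    · split_ifs <;> norm_num
    · exact sub_nonneg.2 (muF_le_one _)
    · linarith [muF_nonneg (h w / D)]
  have hrel : ∀ v ∈ A, |muH n (r v) - muH n (d v / D)| ≤
      2 * (alpha n * η) * (1 - muH n (d v / D)) := fun v hv => by
    have h1 := hR1 v hv
    have h2 : alpha n * |r v - d v / D| ≤ 2 * (alpha n * η) := by nlinarith
    have h3 := abs_muH_sub_le hn (x := r v) (y := d v / D) (by linarith)
    have h4 := muH_lt_one hn (d v / D)
    exact h3.trans (mul_le_mul_of_nonneg_right h2 (by linarith))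
  have hstat : ∀ i ∈ I, |∑ v ∈ A \ R, (1 - muH n (r v)) * q i v - t i| ≤ 9 / 2 * (alpha n * η) * E i ∧
      ∑ v ∈ A \ R, (1 - muH n (r v)) * q i v ≤ 2 * E i := by
    intro i hi
    have hE := pos_of_scale hn (hs.scale_stat i hi)
    have h1 := abs_sum_mul_sub_le (A \ R) (c := q i) (x := fun v => 1 - muH n (r v))
      (y := fun v => 1 - muH n (d v / D)) (δ := 2 * (alpha n * η)) (fun v _ => hq0 i v)
      (fun v hv => by
        have e : 1 - muH n (r v) - (1 - muH n (d v / D)) = -(muH n (r v) - muH n (d v / D)) := by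
          ring
        rw [e, abs_neg]
        exact hrel v (Finset.mem_sdiff.1 hv).1)
    have h2 := hR2 i hi
    have h3 := hm.target_le i hi
    set S := ∑ v ∈ A \ R, q i v * (1 - muH n (d v / D)) with hS
    have hS2 : S ≤ (3 / 2 + 2 * η) * E i := by nlinarith [(abs_le.1 h2).2]
    have hS3 : 2 * (alpha n * η) * S ≤ 2 * (alpha n * η) * ((3 / 2 + 2 * η) * E i) := by gcongr
    have hS4 : 2 * (alpha n * η) * ((3 / 2 + 2 * η) * E i) ≤ 4 * (alpha n * η) * E i := by
      have : 0 ≤ alpha n * η * E i := by positivity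
      nlinarith
    rw [abs_le] at h1 h2 ⊢
    have h5 : 48 * (η * E i) ≤ alpha n * η * E i := by nlinarith
    have h6 : alpha n * η * E i ≤ 1 / 1000 * E i := by nlinarith
    refine ⟨⟨?_, ?_⟩, ?_⟩ <;> linarith
  have hb1 : ∀ w ∈ A, pr (randomSubset A fun v => muH n (r v)) (fun H => ξ * D ≤
      |∑ _v ∈ A.filter (fun u => G.Adj w u) ∩ H, (1 : ℝ) -
        ∑ v ∈ A.filter (fun u => G.Adj w u), muH n (r v) * 1|) ≤ 2 / (n : ℝ) ^ 10 := by
    intro w hw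
    have hsc : 100 * Real.log n ≤ ξ ^ 2 * D := hs.scale.trans (by
      have : muR n * D ≤ D := by nlinarith
      gcongr)
    refine (chernoff_randomSubset (Finset.filter_subset _ _) (fun _ _ => muH_nonneg hn _)
      (fun _ _ => (muH_lt_one hn _).le) (fun _ => zero_le_one) (fun _ => le_rfl) (M := 2 * D) ?_
      (by positivity) (by nlinarith) (by positivity)).trans (two_mul_exp_le hn hsc)
    refine le_trans (Finset.sum_le_sum fun v _ => ?_) ((nbrCount_eq_sum_one G A w).symm.le.trans
      (hm' w hw))
    rw [mul_one]
    exact (muH_lt_one hn _).le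
  have hb2 : ∀ w ∈ A.filter (fun w => ¬ d w ≤ 7 / 10 * D),
      pr (randomSubset A fun v => muH n (r v)) (fun H => w ∉ H) ≤ 1 / (n : ℝ) ^ 9 := by
    intro w hw
    obtain ⟨hwA, hwd⟩ := Finset.mem_filter.1 hw
    rw [pr_notMem_randomSubset hwA (muH_nonneg hn _) (muH_lt_one hn _).le, ← exp_neg_mul_log hn 9]
    have h1 := (abs_le.1 (hR1 w hwA)).1
    have h2 : 7 / 10 ≤ d w / D := by rw [le_div_iff₀ hD]; linarith
    -- The error 2η costs less than 1/100, and 48 · (69/100 - 1/2) > 9 gives the failure probability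
    -- n^(-9).
    have h3 : 69 / 100 ≤ r w := by simp only [hr]; linarith
    rw [muH_of_ge n (by linarith)]
    have h4 : Real.exp (-(alpha n / 2) * (r w - 1 / 2)) ≤ Real.exp (-((9 : ℕ) * Real.log n)) := by
      refine Real.exp_le_exp.2 ?_
      have := log_pos_of_two_le hn
      unfold alpha
      push_cast
      nlinarith
    linarith [Real.exp_pos (-(alpha n / 2) * (r w - 1 / 2))]
  have hb3 : ∀ i ∈ I, pr (randomSubset A fun v => muH n (r v)) (fun H => ξ * E i ≤
      |∑ v ∈ (A \ R) \ H, q i v - ∑ v ∈ A \ R, (1 - muH n (r v)) * q i v|) ≤ 2 / (n : ℝ) ^ 10 := by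
    intro i hi
    have hE := pos_of_scale hn (hs.scale_stat i hi)
    exact (chernoff_compl_randomSubset Finset.sdiff_subset (fun _ _ => muH_nonneg hn _)
      (fun _ _ => (muH_lt_one hn _).le) (hq0 i) (hq1 i) (M := 2 * E i) (hstat i hi).2
      (by positivity) (by nlinarith) (by positivity)).trans (two_mul_exp_le hn (hs.scale_stat i hi))
  have hcard : (A.card : ℝ) ≤ n := by exact_mod_cast Finset.card_le_univ A
  have hcard' : ((A.filter (fun w => ¬ d w ≤ 7 / 10 * D)).card : ℝ) ≤ n := by
    exact_mod_cast Finset.card_le_univ _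
  calc _ ≤ pr (randomSubset A fun v => muH n (r v)) (fun H => ((∃ w ∈ A, ξ * D ≤
      |∑ _v ∈ A.filter (fun u => G.Adj w u) ∩ H, (1 : ℝ) -
        ∑ v ∈ A.filter (fun u => G.Adj w u), muH n (r v) * 1|) ∨ ∃ i ∈ I, ξ * E i ≤
      |∑ v ∈ (A \ R) \ H, q i v - ∑ v ∈ A \ R, (1 - muH n (r v)) * q i v|) ∨
      ∃ w ∈ A.filter (fun w => ¬ d w ≤ 7 / 10 * D), w ∉ H) := by
        refine pr_mono fun H hH hbad => ?_
        by_contra hcon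
        push Not at hcon
        obtain ⟨⟨hc1, hc2⟩, hc3⟩ := hcon
        refine hbad ⟨fun w hw => ?_, fun w hw hwd => hc3 w (Finset.mem_filter.2 ⟨hw, not_le.1 hwd⟩),
          fun i hi => ?_⟩
        · have h1 := hc1 w hw
          rw [← nbrCount_eq_sum (subset_of_mem_support_randomSubset hH)] at h1
          have h2 := hm.heavy w hw
          have h3 : |∑ v ∈ A.filter (fun u => G.Adj w u), muH n (r v) * 1 -
              ∑ v ∈ A.filter (fun v => G.Adj w v), muH n (d v / D)| ≤ 2 * (alpha n * η) * (2 * D) := by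
            rw [← Finset.sum_sub_distrib]
            refine (Finset.abs_sum_le_sum_abs _ _).trans ?_
            have h4 : ∀ v ∈ A.filter (fun u => G.Adj w u),
                |muH n (r v) * 1 - muH n (d v / D)| ≤ 2 * (alpha n * η) := fun v hv => by
              rw [mul_one]
              refine (hrel v (Finset.mem_filter.1 hv).1).trans ?_
              nlinarith [muH_nonneg hn (d v / D), mul_pos (by linarith : 0 < alpha n) hη0]
            refine (Finset.sum_le_sum h4).trans ?_
            rw [Finset.sum_const, nsmul_eq_mul, mul_comm]
            exact mul_le_mul_of_nonneg_left (hm' w hw) (by positivity)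
          rw [← sub_div, abs_div, abs_of_pos hD, div_le_iff₀ hD]
          have h5 : 48 * (η * D) ≤ alpha n * η * D := by nlinarith
          have h6 : ξ * D ≤ η * D := by gcongr
          rw [abs_lt] at h1
          rw [abs_le] at h2 h3 ⊢
          constructor <;> linarith
        · have h1 := hc2 i hi
          have h2 := (hstat i hi).1
          have hE := pos_of_scale hn (hs.scale_stat i hi)
          have h5 : 48 * (η * E i) ≤ alpha n * η * E i := by nlinarith
          have h6 : ξ * E i ≤ η * E i := by gcongr
          rw [abs_lt] at h1
          rw [abs_le] at h2 ⊢
          constructor <;> linarith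
    _ ≤ (A.card * (2 / (n : ℝ) ^ 10) + I.card * (2 / (n : ℝ) ^ 10)) +
          (A.filter (fun w => ¬ d w ≤ 7 / 10 * D)).card * (1 / (n : ℝ) ^ 9) :=
        (pr_or_le _ _ _).trans (add_le_add ((pr_or_le _ _ _).trans
          (add_le_add (pr_exists_le_card_mul _ _ _ hb1) (pr_exists_le_card_mul _ _ _ hb3)))
          (pr_exists_le_card_mul _ _ _ hb2))
    _ ≤ _ := by rw [add_mul]; gcongr

/-- The mean-field value satisfies h ≤ 2D, so 1 - `muF` is at least 1/2 and an additive error in the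
heavy count is also a small relative one. Adding the previous errors and the sampling noise stays
below 120αη. -/
lemma pr_friends_le (hn : 2 ≤ Fintype.card V) (hm : NearMeanField G A D η d h I f t E)
    (hs : SmallNoise (Fintype.card V) D ξ η I E) {R H : Finset V} (hHA : H ⊆ A)
    (hH : GoodH G A D η d h I f t E R H) :
    pr (randomSubset A fun v => muF ((nbrCount G H v : ℝ) / D))
      (fun F => ¬ ∀ i ∈ I, |∑ w ∈ ((A \ R) \ H) \ F, f i w - t i| ≤
        120 * alpha (Fintype.card V) * η * E i) ≤
      I.card * (2 / (Fintype.card V : ℝ) ^ 10) := by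
  have hm' := fun w => NearMeanField.nbrCount_le (w := w) hn hm hs
  obtain ⟨hH1, hH2, hH3⟩ := hH
  set n := Fintype.card V with hndef
  set r : V → ℝ := fun v => (nbrCount G H v : ℝ) / D with hr
  have hD := hs.D_pos hn
  have hη := hs.eta_le hn
  have hξ := hs.pos
  have hξη := hs.le
  have ha := alpha_pos hn
  have haη := hs.small
  have hη0 : 0 < η := by linarith
  have haη' : 48 * η ≤ alpha n * η := by nlinarith
  set B := (A \ R) \ H with hB
  have hBA : B ⊆ A := Finset.sdiff_subset.trans Finset.sdiff_subset
  -- All vertices above the cutoff have entered `H`, so the cutoff indicator equals 1 on the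
  -- remaining vertices.
  have hκ : ∀ w ∈ B, d w ≤ 7 / 10 * D := fun w hw => by
    by_contra hcon
    exact (Finset.mem_sdiff.1 hw).2 (hH2 w (hBA hw) hcon)
  have hS : ∀ i, ∑ w ∈ B, f i w * (if d w ≤ 7 / 10 * D then 1 else 0) * (1 - muF (h w / D)) =
      ∑ w ∈ B, f i w * (1 - muF (h w / D)) := fun i =>
    Finset.sum_congr rfl fun w hw => by rw [if_pos (hκ w hw), mul_one]
  have hrel : ∀ v ∈ B, |1 - muF (r v) - (1 - muF (h v / D))| ≤
      5 / 2 * (alpha n * η) * (1 - muF (h v / D)) := fun v hv => by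
    have h1 := hH1 v (hBA hv)
    have h2 : (nbrCount G H v : ℝ) ≤ nbrCount G A v := by exact_mod_cast nbrCount_mono G hHA v
    have h3 : r v ≤ 4 := by
      simp only [hr]; rw [div_le_iff₀ hD]; linarith [hm' v (hBA hv)]
    have h4 : h v / D ≤ 2 := by rw [div_le_iff₀ hD]; exact hm.heavy_le v (hBA hv)
    rw [muF_eq (by positivity) h3, muF_eq (div_nonneg (hm.heavy_nonneg v (hBA hv)) hD.le)
      (by linarith)]
    have h5 : 0 ≤ alpha n * η := by positivity
    rw [abs_le] at h1 ⊢
    constructor <;> nlinarith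
  have hstat : ∀ i ∈ I, |∑ v ∈ B, (1 - muF (r v)) * f i v - t i| ≤ 10 * (alpha n * η) * E i ∧
      ∑ v ∈ B, (1 - muF (r v)) * f i v ≤ 2 * E i := by
    intro i hi
    have hE := pos_of_scale hn (hs.scale_stat i hi)
    have h1 := abs_sum_mul_sub_le B (c := f i) (x := fun v => 1 - muF (r v))
      (y := fun v => 1 - muF (h v / D)) (fun v _ => hm.nonneg i v) hrel
    have h2 := hH3 i hi
    rw [hS i] at h2
    have h3 := hm.target_le i hi
    set S := ∑ v ∈ B, f i v * (1 - muF (h v / D)) with hS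
    have h6 : alpha n * η * E i ≤ 1 / 1000 * E i := by nlinarith
    have hS2 : S ≤ 2 * E i := by linarith [(abs_le.1 h2).2]
    have hS3 : 5 / 2 * (alpha n * η) * S ≤ 5 / 2 * (alpha n * η) * (2 * E i) := by gcongr
    rw [abs_le] at h1 h2 ⊢
    refine ⟨⟨?_, ?_⟩, ?_⟩ <;> linarith
  have hb : ∀ i ∈ I, pr (randomSubset A fun v => muF (r v)) (fun F => ξ * E i ≤
      |∑ v ∈ B \ F, f i v - ∑ v ∈ B, (1 - muF (r v)) * f i v|) ≤ 2 / (n : ℝ) ^ 10 := by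
    intro i hi
    have hE := pos_of_scale hn (hs.scale_stat i hi)
    exact (chernoff_compl_randomSubset hBA (fun _ _ => muF_nonneg _)
      (fun _ _ => muF_le_one _) (hm.nonneg i) (hm.le_one i) (M := 2 * E i) (hstat i hi).2
      (by positivity) (by nlinarith) (by positivity)).trans (two_mul_exp_le hn (hs.scale_stat i hi))
  refine le_trans (pr_mono fun F _ hbad => ?_) (pr_exists_le_card_mul _ _ _ hb)
  by_contra hcon
  push Not at hcon
  refine hbad fun i hi => ?_
  have h1 := hcon i hi
  have h2 := (hstat i hi).1
  have hE := pos_of_scale hn (hs.scale_stat i hi)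
  have h5 : 48 * (η * E i) ≤ alpha n * η * E i := by nlinarith
  have h6 : ξ * E i ≤ η * E i := by gcongr
  rw [abs_lt] at h1
  rw [abs_le] at h2 ⊢
  constructor <;> linarith

/-- With high probability the survivors of a local phase follow the mean field. -/
lemma pr_localPhase_le (ρ : OpenChoices V) (hn : 2 ≤ Fintype.card V)
    (hm : NearMeanField G A D η d h I f t E) (hs : SmallNoise (Fintype.card V) D ξ η I E) :
    pr (localPhase ρ G D A) (fun x => ¬ ((∀ w ∈ x.1, d w ≤ 7 / 10 * D) ∧
      ∀ i ∈ I, |∑ w ∈ x.1, f i w - t i| ≤ 120 * alpha (Fintype.card V) * η * E i)) ≤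
      (5 * Fintype.card V + 6 * I.card) / (Fintype.card V : ℝ) ^ 9 := by
  set n := Fintype.card V with hndef
  have hn0 : (1 : ℝ) ≤ n := by exact_mod_cast (by omega : 1 ≤ n)
  rw [localPhase_eq]
  refine (pr_bind_le (B := fun R => ¬ GoodR G A D η d h I f t E R)
    (b := ((n + I.card) * (2 / (n : ℝ) ^ 10) + n * (1 / (n : ℝ) ^ 9)) +
      I.card * (2 / (n : ℝ) ^ 10)) (by positivity) fun R _ hR => ?_).trans ?_
  · refine (pr_bind_le (B := fun H => ¬ GoodH G A D η d h I f t E R H)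
      (b := I.card * (2 / (n : ℝ) ^ 10)) (by positivity) fun H hH hHg => ?_).trans
      (add_le_add_left (pr_not_goodH_le hn hm hs (not_not.1 hR)) _)
    have hHg' := not_not.1 hHg
    -- Computing the maximal matching adds no failure, because the remaining vertex set does not
    -- depend on it.
    rw [← add_zero (I.card * (2 / (n : ℝ) ^ 10))]
    refine (pr_bind_le (B := fun F => ¬ ∀ i ∈ I, |∑ w ∈ ((A \ R) \ H) \ F, f i w - t i| ≤
        120 * alpha n * η * E i) le_rfl fun F _ hF => ?_).trans (add_le_add_left
      (pr_friends_le hn hm hs (subset_of_mem_support_randomSubset hH) hHg') _)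
    refine (pr_eq_zero fun x hx hbad => hbad ?_).le
    rw [PMF.mem_support_map_iff] at hx
    obtain ⟨M, -, rfl⟩ := hx
    have e : A \ (R ∪ H ∪ F) = ((A \ R) \ H) \ F := by
      ext v
      simp only [Finset.mem_sdiff, Finset.mem_union]
      tauto
    dsimp only
    rw [e]
    refine ⟨fun w hw => ?_, not_not.1 hF⟩
    by_contra hcon
    have hwB := (Finset.mem_sdiff.1 hw).1
    exact (Finset.mem_sdiff.1 hwB).2 (hHg'.2.1 w (Finset.mem_sdiff.1
      (Finset.mem_sdiff.1 hwB).1).1 hcon)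
  · refine (add_le_add_left (pr_not_goodR_le hn hm hs) _).trans ?_
    have h1 : 1 / (n : ℝ) ^ 10 ≤ 1 / (n : ℝ) ^ 9 :=
      one_div_le_one_div_of_le (by positivity) (pow_le_pow_right₀ hn0 (by norm_num))
    have e1 : (2 : ℝ) / (n : ℝ) ^ 10 = 2 * (1 / (n : ℝ) ^ 10) := by ring
    have e2 : (5 * n + 6 * I.card) / (n : ℝ) ^ 9 = (5 * n + 6 * I.card) * (1 / (n : ℝ) ^ 9) := by
      ring
    rw [e1, e2]
    have h2 := mul_le_mul_of_nonneg_left h1 (by positivity : (0 : ℝ) ≤ 4 * n + 6 * I.card)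
    linarith

end MeanFieldStep

/-! ### The mean field of several local phases -/

section MeanField

variable {V : Type*} [Fintype V]

/-- The mean-field degree of `u` when each vertex `w` is present with probability `s w`. -/
def meanDeg (G : SimpleGraph V) (s : V → ℝ) (u : V) : ℝ :=
  ∑ w ∈ Finset.univ.filter (fun w => G.Adj u w), s w

/-- The mean-field number of heavy neighbours of `u`. -/
def meanHeavy (G : SimpleGraph V) (D : ℝ) (s : V → ℝ) (u : V) : ℝ :=
  ∑ w ∈ Finset.univ.filter (fun w => G.Adj u w), s w * muH (Fintype.card V) (meanDeg G s w / D)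

/-- The mean-field survival probabilities in one phase. -/
def meanSurvival (G : SimpleGraph V) (D : ℝ) (s : V → ℝ) (w : V) : ℝ :=
  survival (Fintype.card V) D (meanDeg G s w) (meanHeavy G D s w)

/-- The mean-field presence probabilities after `j` phases. -/
def density (G : SimpleGraph V) (D : ℝ) (s : V → ℝ) : ℕ → V → ℝ
  | 0 => s
  | j + 1 => fun w => density G D s j w * meanSurvival G (D / 2 ^ j) (density G D s j) w

/-- The two statistics that matter: degrees and numbers of heavy neighbours. -/
def testWeight (G : SimpleGraph V) (D : ℝ) (s : V → ℝ) (l : ℕ) (b : Bool) (w : V) : ℝ :=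
  if b = true then muH (Fintype.card V) (meanDeg G (density G D s l) w / (D / 2 ^ l)) else 1

/-- The mean-field contribution to a statistic after phase `l` of a vertex present after phase
`j`. -/
def pullback (G : SimpleGraph V) (D : ℝ) (s : V → ℝ) (j l : ℕ) (b : Bool) (w : V) : ℝ :=
  (∏ k ∈ Finset.Ico j l, meanSurvival G (D / 2 ^ k) (density G D s k) w) * testWeight G D s l b w

/-- The mean-field value of a statistic after phase `l`. -/
def target (G : SimpleGraph V) (D : ℝ) (s : V → ℝ) (l : ℕ) (b : Bool) (u : V) : ℝ :=
  ∑ w ∈ Finset.univ.filter (fun w => G.Adj u w), density G D s l w * testWeight G D s l b w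

/-- After `j` of `τ` phases, the set `A` of survivors follows the mean field up to `η`. -/
def FollowsMeanField (G : SimpleGraph V) (D : ℝ) (s : V → ℝ) (τ j : ℕ) (A : Finset V) (η : ℝ) :
    Prop :=
  (∀ w ∈ A, density G D s j w ≠ 0) ∧
  ∀ l, j ≤ l → l ≤ τ → ∀ u, density G D s l u ≠ 0 → ∀ b,
    |∑ w ∈ A.filter (fun w => G.Adj u w), pullback G D s j l b w - target G D s l b u| ≤
      η * (D / 2 ^ l)

/-- The conditions on the parameters of a machine under which its `τ` phases are analysed. -/
structure MachineParams (G : SimpleGraph V) (D : ℝ) (s : V → ℝ) (ξ : ℝ) (τ : ℕ) : Prop where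
  two_le : 2 ≤ Fintype.card V
  tau_le : τ ≤ Fintype.card V
  nonneg : ∀ w, 0 ≤ s w
  meanDeg_le : ∀ u, s u ≠ 0 → meanDeg G s u ≤ 3 / 2 * D
  pos : 0 < ξ
  small : alpha (Fintype.card V) * (ξ * (120 * alpha (Fintype.card V)) ^ τ) ≤ 1 / 1000
  scale : 100 * Real.log (Fintype.card V) ≤ ξ ^ 2 * (muR (Fintype.card V) * (D / 2 ^ τ))

variable {G : SimpleGraph V} {D ξ : ℝ} {s : V → ℝ} {τ : ℕ}

lemma survival_nonneg {n : ℕ} (hn : 2 ≤ n) (D d h : ℝ) : 0 ≤ survival n D d h := by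
  unfold survival
  split_ifs
  · refine mul_nonneg (mul_nonneg ?_ ?_) ?_
    · linarith [muR_le hn]
    · linarith [muH_lt_one hn (d / D)]
    · linarith [muF_le_one (h / D)]
  · exact le_rfl

lemma survival_le_one {n : ℕ} (hn : 2 ≤ n) (D d h : ℝ) : survival n D d h ≤ 1 := by
  unfold survival
  split_ifs
  · refine mul_le_one₀ (mul_le_one₀ ?_ ?_ ?_) ?_ ?_
    · linarith [muR_pos hn]
    · linarith [muH_lt_one hn (d / D)]
    · linarith [muH_nonneg hn (d / D)]
    · linarith [muF_le_one (h / D)]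
    · linarith [muF_nonneg (h / D)]
  · exact zero_le_one

namespace MachineParams

lemma D_pos (hp : MachineParams G D s ξ τ) : 0 < D := by
  have h1 := pos_of_scale hp.two_le hp.scale
  have h2 := (pos_iff_pos_of_mul_pos h1).1 (muR_pos hp.two_le)
  by_contra h
  have : D / 2 ^ τ ≤ 0 := div_nonpos_of_nonpos_of_nonneg (not_lt.1 h) (by positivity)
  linarith

lemma density_nonneg (hp : MachineParams G D s ξ τ) (j : ℕ) (w : V) : 0 ≤ density G D s j w := by
  induction j with
  | zero => exact hp.nonneg w
  | succ j ih => exact mul_nonneg ih (survival_nonneg hp.two_le _ _ _)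

lemma density_succ_le (hp : MachineParams G D s ξ τ) (j : ℕ) (w : V) :
    density G D s (j + 1) w ≤ density G D s j w :=
  mul_le_of_le_one_right (hp.density_nonneg j w) (survival_le_one hp.two_le _ _ _)

lemma meanHeavy_nonneg (hp : MachineParams G D s ξ τ) (j : ℕ) (D' : ℝ) (u : V) :
    0 ≤ meanHeavy G D' (density G D s j) u :=
  Finset.sum_nonneg fun w _ => mul_nonneg (hp.density_nonneg j w) (muH_nonneg hp.two_le _)

lemma meanHeavy_le (hp : MachineParams G D s ξ τ) (j : ℕ) (D' : ℝ) (u : V) :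
    meanHeavy G D' (density G D s j) u ≤ meanDeg G (density G D s j) u :=
  Finset.sum_le_sum fun w _ =>
    mul_le_of_le_one_right (hp.density_nonneg j w) (muH_lt_one hp.two_le _).le

/-- Below the cutoff all three survival factors are positive; for friends this holds since the mean
heavy count is at most the mean degree. Hence the support of the density is governed by the cutoff
alone. -/
lemma density_succ_ne_zero_iff (hp : MachineParams G D s ξ τ) (j : ℕ) (w : V) :
    density G D s (j + 1) w ≠ 0 ↔
      density G D s j w ≠ 0 ∧ meanDeg G (density G D s j) w ≤ 7 / 10 * (D / 2 ^ j) := by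
  have hD : 0 < D / 2 ^ j := div_pos hp.D_pos (by positivity)
  rw [density, mul_ne_zero_iff]
  refine and_congr_right fun _ => ?_
  rw [meanSurvival, survival]
  split_ifs with h
  · refine iff_of_true (ne_of_gt (mul_pos (mul_pos ?_ ?_) ?_)) h
    · linarith [muR_le hp.two_le]
    · linarith [muH_lt_one hp.two_le (meanDeg G (density G D s j) w / (D / 2 ^ j))]
    · have h1 := hp.meanHeavy_le j (D / 2 ^ j) w
      have h2 : meanHeavy G (D / 2 ^ j) (density G D s j) w / (D / 2 ^ j) ≤ 7 / 10 := by
        rw [div_le_iff₀ hD]; linarith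
      rw [muF_eq (div_nonneg (hp.meanHeavy_nonneg j _ w) hD.le) (by linarith)]
      linarith
  · exact iff_of_false (fun h' => h' rfl) h

/-- A vertex in the support passed the previous cutoff, and (7/10)(D/2^j) = (7/5)(D/2^(j+1));
densities only decrease. -/
lemma meanDeg_density_le (hp : MachineParams G D s ξ τ) {j : ℕ} {u : V}
    (hu : density G D s j u ≠ 0) : meanDeg G (density G D s j) u ≤ 3 / 2 * (D / 2 ^ j) := by
  have hD := hp.D_pos
  cases j with
  | zero => rw [pow_zero, div_one]; exact hp.meanDeg_le u hu
  | succ j =>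
    have h1 := ((hp.density_succ_ne_zero_iff j u).1 hu).2
    have h2 : meanDeg G (density G D s (j + 1)) u ≤ meanDeg G (density G D s j) u :=
      Finset.sum_le_sum fun w _ => hp.density_succ_le j w
    have h3 : D / 2 ^ j = 2 * (D / 2 ^ (j + 1)) := by rw [pow_succ]; field_simp
    have h4 : 0 < D / 2 ^ (j + 1) := by positivity
    linarith

/-- The sharper constant after at least one phase: the gap between 7/5 and 3/2 absorbs the final
deviation η. -/
lemma meanDeg_density_succ_le (hp : MachineParams G D s ξ τ) {j : ℕ} {u : V}
    (hu : density G D s (j + 1) u ≠ 0) :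
    meanDeg G (density G D s (j + 1)) u ≤ 7 / 5 * (D / 2 ^ (j + 1)) := by
  have h1 := ((hp.density_succ_ne_zero_iff j u).1 hu).2
  have h2 : meanDeg G (density G D s (j + 1)) u ≤ meanDeg G (density G D s j) u :=
    Finset.sum_le_sum fun w _ => hp.density_succ_le j w
  have h3 : D / 2 ^ j = 2 * (D / 2 ^ (j + 1)) := by rw [pow_succ]; field_simp
  linarith

lemma testWeight_nonneg (hp : MachineParams G D s ξ τ) (l : ℕ) (b : Bool) (w : V) :
    0 ≤ testWeight G D s l b w := by
  unfold testWeight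
  split_ifs
  exacts [muH_nonneg hp.two_le _, zero_le_one]

lemma testWeight_le_one (hp : MachineParams G D s ξ τ) (l : ℕ) (b : Bool) (w : V) :
    testWeight G D s l b w ≤ 1 := by
  unfold testWeight
  split_ifs
  exacts [(muH_lt_one hp.two_le _).le, le_rfl]

lemma pullback_nonneg (hp : MachineParams G D s ξ τ) (j l : ℕ) (b : Bool) (w : V) :
    0 ≤ pullback G D s j l b w :=
  mul_nonneg (Finset.prod_nonneg fun _ _ => survival_nonneg hp.two_le _ _ _)
    (hp.testWeight_nonneg l b w)

lemma pullback_le_one (hp : MachineParams G D s ξ τ) (j l : ℕ) (b : Bool) (w : V) :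
    pullback G D s j l b w ≤ 1 :=
  mul_le_one₀ (Finset.prod_le_one (fun _ _ => survival_nonneg hp.two_le _ _ _)
    fun _ _ => survival_le_one hp.two_le _ _ _) (hp.testWeight_nonneg l b w)
    (hp.testWeight_le_one l b w)

lemma target_le (hp : MachineParams G D s ξ τ) {l : ℕ} (b : Bool) {u : V}
    (hu : density G D s l u ≠ 0) : target G D s l b u ≤ 3 / 2 * (D / 2 ^ l) :=
  (Finset.sum_le_sum fun w _ => mul_le_of_le_one_right (hp.density_nonneg l w)
    (hp.testWeight_le_one l b w)).trans (hp.meanDeg_density_le hu)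

end MachineParams

/-- The statistic before phase `j` is the one after it weighted with the survival probability of
that phase. Its mean-field value is therefore conserved, and the same target serves for all `j`. -/
lemma pullback_eq (G : SimpleGraph V) (D : ℝ) (s : V → ℝ) {j l : ℕ} (h : j < l) (b : Bool) (w : V) :
    pullback G D s j l b w =
      pullback G D s (j + 1) l b w * meanSurvival G (D / 2 ^ j) (density G D s j) w := by
  rw [pullback, pullback, Finset.prod_eq_prod_Ico_succ_bot h]
  ring

lemma pullback_self (G : SimpleGraph V) (D : ℝ) (s : V → ℝ) (j : ℕ) (b : Bool) (w : V) :
    pullback G D s j j b w = testWeight G D s j b w := by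
  simp [pullback]

/-- The statistics that are followed through the phase with number `j`. -/
def statIndex (G : SimpleGraph V) (D : ℝ) (s : V → ℝ) (τ j : ℕ) : Finset (V × ℕ × Bool) :=
  (Finset.univ ×ˢ Finset.Icc (j + 1) τ ×ˢ Finset.univ).filter fun i => density G D s i.2.1 i.1 ≠ 0

lemma card_statIndex_le (G : SimpleGraph V) (D : ℝ) (s : V → ℝ) (τ j : ℕ) :
    (statIndex G D s τ j).card ≤ 2 * Fintype.card V * τ := by
  refine (Finset.card_filter_le _ _).trans ?_
  rw [Finset.card_product, Finset.card_product, Nat.card_Icc, Finset.card_univ, Finset.card_univ,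
    Fintype.card_bool]
  have : τ + 1 - (j + 1) ≤ τ := by omega
  nlinarith [Nat.mul_le_mul_left (Fintype.card V) this]

lemma mem_statIndex {j : ℕ} {i : V × ℕ × Bool} : i ∈ statIndex G D s τ j ↔
    (j + 1 ≤ i.2.1 ∧ i.2.1 ≤ τ) ∧ density G D s i.2.1 i.1 ≠ 0 := by
  simp [statIndex]

/-- The statistics with `l = j` are the current degrees and heavy counts, which steer the phase.
Those with later `l` are the quantities that it has to carry on. -/
lemma FollowsMeanField.nearMeanField {j : ℕ} {A : Finset V} {η : ℝ}
    (hp : MachineParams G D s ξ τ) (hj : j ≤ τ) (hA : FollowsMeanField G D s τ j A η) :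
    NearMeanField G A (D / 2 ^ j) η (meanDeg G (density G D s j))
      (meanHeavy G (D / 2 ^ j) (density G D s j)) (statIndex G D s τ j)
      (fun i w => if G.Adj i.1 w then pullback G D s (j + 1) i.2.1 i.2.2 w else 0)
      (fun i => target G D s i.2.1 i.2.2 i.1) (fun i => D / 2 ^ i.2.1) where
  deg w hw := by
    have h := hA.2 j le_rfl hj w (hA.1 w hw) false
    simp only [pullback_self, target, testWeight, mul_one, Bool.false_eq_true, if_false] at h
    rw [nbrCount_eq_sum_one]
    exact h
  deg_le w hw := hp.meanDeg_density_le (hA.1 w hw)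
  heavy w hw := by
    have h := hA.2 j le_rfl hj w (hA.1 w hw) true
    simp only [pullback_self, target, testWeight, if_true] at h
    exact h
  heavy_nonneg w _ := hp.meanHeavy_nonneg j _ w
  heavy_le w hw := by
    have h1 := hp.meanDeg_density_le (hA.1 w hw)
    have h2 := hp.meanHeavy_le j (D / 2 ^ j) w
    have h3 : 0 < D / 2 ^ j := div_pos hp.D_pos (by positivity)
    linarith
  nonneg i w := by
    split_ifs
    exacts [hp.pullback_nonneg _ _ _ _, le_rfl]
  le_one i w := by
    split_ifs
    exacts [hp.pullback_le_one _ _ _ _, zero_le_one]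
  stat i hi := by
    obtain ⟨⟨h1, h2⟩, h3⟩ := mem_statIndex.1 hi
    have h := hA.2 i.2.1 (by omega) h2 i.1 h3 i.2.2
    have e : ∑ w ∈ A, (if G.Adj i.1 w then pullback G D s (j + 1) i.2.1 i.2.2 w else 0) *
        survival (Fintype.card V) (D / 2 ^ j) (meanDeg G (density G D s j) w)
          (meanHeavy G (D / 2 ^ j) (density G D s j) w) =
        ∑ w ∈ A.filter (fun w => G.Adj i.1 w), pullback G D s j i.2.1 i.2.2 w := by
      rw [Finset.sum_filter]
      refine Finset.sum_congr rfl fun w _ => ?_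
      rw [pullback_eq G D s h1, ite_mul, zero_mul]
      rfl
    rw [e]
    exact h
  target_le i hi := hp.target_le _ (mem_statIndex.1 hi).2

namespace MachineParams

lemma one_le_growth (hp : MachineParams G D s ξ τ) : 1 ≤ 120 * alpha (Fintype.card V) := by
  linarith [alpha_pos hp.two_le]

lemma scale_of_le (hp : MachineParams G D s ξ τ) {j : ℕ} (hj : j ≤ τ) :
    100 * Real.log (Fintype.card V) ≤ ξ ^ 2 * (muR (Fintype.card V) * (D / 2 ^ j)) := by
  refine hp.scale.trans ?_
  have := hp.D_pos
  have := muR_pos hp.two_le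
  gcongr
  norm_num

/-- Both requirements are tightest after the last phase, where the error has grown most and the
scale is smallest; there they are assumptions on the machine. -/
lemma smallNoise (hp : MachineParams G D s ξ τ) {j : ℕ} (hj : j ≤ τ) :
    SmallNoise (Fintype.card V) (D / 2 ^ j) ξ (ξ * (120 * alpha (Fintype.card V)) ^ j)
      (statIndex G D s τ j) (fun i => D / 2 ^ i.2.1) where
  pos := hp.pos
  le := le_mul_of_one_le_right hp.pos.le (one_le_pow₀ hp.one_le_growth)
  small := by
    refine le_trans ?_ hp.small
    have h1 := hp.one_le_growth
    have h2 := hp.pos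
    have h3 := alpha_pos hp.two_le
    gcongr
  scale := hp.scale_of_le hj
  scale_stat i hi := by
    have h1 := hp.scale_of_le (mem_statIndex.1 hi).1.2
    refine h1.trans ?_
    have h2 : 0 < D / 2 ^ i.2.1 := div_pos hp.D_pos (by positivity)
    have h3 : muR (Fintype.card V) * (D / 2 ^ i.2.1) ≤ D / 2 ^ i.2.1 := by
      nlinarith [muR_le hp.two_le]
    gcongr

/-- Smallness of ξ makes ξ² at most 1/48000, which turns the noise condition into the much larger
sample needed to recognise light vertices. -/
lemma heavy_scale (hp : MachineParams G D s ξ τ) {j : ℕ} (hj : j ≤ τ) :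
    320 * Real.log (Fintype.card V) ≤ muR (Fintype.card V) * (D / 2 ^ j) := by
  have h1 := hp.scale_of_le hj
  have h2 := (hp.smallNoise hj).eta_le hp.two_le
  have h3 := (hp.smallNoise hj).le
  have h4 := hp.pos
  have h5 := pos_of_scale hp.two_le h1
  have h6 : ξ ^ 2 ≤ 1 / 48000 := by nlinarith
  have h7 := mul_le_mul_of_nonneg_right h6 h5.le
  have := log_pos_of_two_le hp.two_le
  linarith

end MachineParams

lemma card_pos_of_two_le (hn : 2 ≤ Fintype.card V) : (1 : ℝ) ≤ Fintype.card V := by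
  exact_mod_cast (by omega : 1 ≤ Fintype.card V)

/-- With high probability a local phase keeps the survivors close to the mean field. -/
lemma pr_not_followsMeanField_le (ρ : OpenChoices V) (hp : MachineParams G D s ξ τ) {j : ℕ}
    (hj : j < τ) {A : Finset V}
    (hA : FollowsMeanField G D s τ j A (ξ * (120 * alpha (Fintype.card V)) ^ j)) :
    pr (localPhase ρ G (D / 2 ^ j) A) (fun x => ¬ FollowsMeanField G D s τ (j + 1) x.1
      (ξ * (120 * alpha (Fintype.card V)) ^ (j + 1))) ≤ 17 / (Fintype.card V : ℝ) ^ 7 := by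
  have key := pr_localPhase_le ρ hp.two_le (hA.nearMeanField hp hj.le) (hp.smallNoise hj.le)
  have hn1 := card_pos_of_two_le hp.two_le
  refine le_trans (pr_mono ?_) (key.trans ?_)
  · intro x hx hbad hgood
    refine hbad ⟨fun w hw => ?_, fun l hl hlτ u hu b => ?_⟩
    · exact (hp.density_succ_ne_zero_iff j w).2
        ⟨hA.1 w ((sound_of_mem_support_localPhase hx).1 hw), hgood.1 w hw⟩
    · have h := hgood.2 (u, l, b) (mem_statIndex.2 ⟨⟨hl, hlτ⟩, hu⟩)
      rw [← Finset.sum_filter] at h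
      convert h using 2
      ring
  · have h1 := card_statIndex_le G D s τ j
    have h2 : ((statIndex G D s τ j).card : ℝ) ≤ 2 * Fintype.card V * Fintype.card V := by
      exact_mod_cast h1.trans (Nat.mul_le_mul_left _ hp.tau_le)
    set n := (Fintype.card V : ℝ)
    rw [div_le_div_iff₀ (by positivity) (by positivity)]
    have h3 : 5 * n + 6 * ((statIndex G D s τ j).card : ℝ) ≤ 17 * n ^ 2 := by nlinarith
    calc _ ≤ 17 * n ^ 2 * n ^ 7 := by gcongr
      _ = 17 * n ^ 9 := by ring

/-- With high probability the survivors of all local phases follow the mean field. -/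
lemma pr_localPhases_le (ρ : OpenChoices V) (hp : MachineParams G D s ξ τ) {k j : ℕ}
    (hj : j + k = τ) {A : Finset V}
    (hA : FollowsMeanField G D s τ j A (ξ * (120 * alpha (Fintype.card V)) ^ j)) :
    pr (localPhases ρ G k (D / 2 ^ j) A) (fun x => ¬ FollowsMeanField G D s τ τ x.1
      (ξ * (120 * alpha (Fintype.card V)) ^ τ)) ≤ k * (17 / (Fintype.card V : ℝ) ^ 7) := by
  induction k generalizing j A with
  | zero =>
    obtain rfl : j = τ := by omega
    refine (pr_eq_zero fun x hx hbad => hbad ?_).le.trans (by simp)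
    rw [localPhases, PMF.mem_support_pure_iff] at hx
    exact hx ▸ hA
  | succ k ih =>
    rw [localPhases]
    refine (pr_bind_le (b := k * (17 / (Fintype.card V : ℝ) ^ 7)) (by positivity)
      fun x _ hx => ?_).trans ((add_le_add_left
      (pr_not_followsMeanField_le ρ hp (by omega) hA) _).trans_eq (by push_cast; ring))
    rw [pr_map, div_div, ← pow_succ]
    exact ih (by omega) (not_not.1 hx)

/-- The local phases of a machine remove few vertices of `X` compared to the expected size of the
matching that they find. -/
lemma card_inter_le_ex_localPhases (ρ : OpenChoices V) (hp : MachineParams G D s ξ τ)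
    (X : Finset V) {k j : ℕ} (hj : j + k = τ) {A : Finset V}
    (hA : FollowsMeanField G D s τ j A (ξ * (120 * alpha (Fintype.card V)) ^ j)) :
    ((A ∩ X).card : ℝ) ≤
      ex (localPhases ρ G k (D / 2 ^ j) A) (fun x => ((x.1 ∩ X).card : ℝ) + 400 * (x.2.card : ℝ)) +
        k * (muR (Fintype.card V) * (A ∩ X).card) + k * (22 / (Fintype.card V : ℝ) ^ 6) := by
  induction k generalizing j A with
  | zero => simp [localPhases, ex_pure]
  | succ k ih =>
    have hstep := card_inter_le_ex_localPhase ρ hp.two_le (hp.heavy_scale (j := j) (by omega))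
      (fun v hv => (hA.nearMeanField hp (by omega)).nbrCount_le hp.two_le
        (hp.smallNoise (by omega)) hv) X
    have hn1 := card_pos_of_two_le hp.two_le
    have hmu := muR_pos hp.two_le
    have hbad := pr_not_followsMeanField_le ρ hp (by omega) hA
    set n := (Fintype.card V : ℝ) with hndef
    -- If the phase leaves the mean field, the trivial bound n is charged; this costs n times the
    -- failure probability, at most 17/n^6.
    have h1 : ex (localPhase ρ G (D / 2 ^ j) A)
        (fun x => ((x.1 ∩ X).card : ℝ) + 400 * (x.2.card : ℝ)) ≤
        ex (localPhase ρ G (D / 2 ^ j) A) (fun x =>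
          (ex (localPhases ρ G k (D / 2 ^ j / 2) x.1) (fun y =>
            ((y.1 ∩ X).card : ℝ) + 400 * ((x.2 ∪ y.2).card : ℝ)) +
          (k * (muR (Fintype.card V) * (A ∩ X).card) + k * (22 / n ^ 6))) +
          n * if FollowsMeanField G D s τ (j + 1) x.1
            (ξ * (120 * alpha (Fintype.card V)) ^ (j + 1)) then 0 else 1) := by
      refine ex_mono fun x hx => ?_
      have hsound := sound_of_mem_support_localPhase hx
      have h2 : ex (localPhases ρ G k (D / 2 ^ j / 2) x.1) (fun y =>
            ((y.1 ∩ X).card : ℝ) + 400 * ((x.2 ∪ y.2).card : ℝ)) =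
          ex (localPhases ρ G k (D / 2 ^ j / 2) x.1) (fun y =>
            ((y.1 ∩ X).card : ℝ) + 400 * (y.2.card : ℝ)) + 400 * x.2.card := by
        rw [← ex_const (localPhases ρ G k (D / 2 ^ j / 2) x.1) (400 * (x.2.card : ℝ)), ← ex_add]
        refine ex_congr fun y hy => ?_
        rw [(hsound.trans (sound_of_mem_support_localPhases hy)).2]
        push_cast
        ring
      have h4 : ((x.1 ∩ X).card : ℝ) ≤ (A ∩ X).card := by
        exact_mod_cast Finset.card_le_card (Finset.inter_subset_inter_right hsound.1)
      have h5 : (0 : ℝ) ≤ k * (muR (Fintype.card V) * (A ∩ X).card) := by positivity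
      have h6 : (0 : ℝ) ≤ k * (22 / n ^ 6) := by positivity
      rw [h2]
      split_ifs with hgood
      · have h3 := ih (j := j + 1) (by omega) hgood
        rw [pow_succ 2 j, ← div_div] at h3
        have h7 : (k : ℝ) * (muR (Fintype.card V) * (x.1 ∩ X).card) ≤
            k * (muR (Fintype.card V) * (A ∩ X).card) := by gcongr
        linarith
      · have h3 : ((x.1 ∩ X).card : ℝ) ≤ n := by rw [hndef]; exact_mod_cast Finset.card_le_univ (x.1 ∩ X)
        have h7 : 0 ≤ ex (localPhases ρ G k (D / 2 ^ j / 2) x.1) (fun y =>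
            ((y.1 ∩ X).card : ℝ) + 400 * (y.2.card : ℝ)) := ex_nonneg fun _ _ => by positivity
        linarith
    replace h1 := h1.trans_eq (by rw [ex_add, ex_add, ex_const, ex_const_mul])
    have h8 : ex (localPhases ρ G (k + 1) (D / 2 ^ j) A)
        (fun x => ((x.1 ∩ X).card : ℝ) + 400 * (x.2.card : ℝ)) =
        ex (localPhase ρ G (D / 2 ^ j) A) fun x =>
          ex (localPhases ρ G k (D / 2 ^ j / 2) x.1) (fun y =>
            ((y.1 ∩ X).card : ℝ) + 400 * ((x.2 ∪ y.2).card : ℝ)) := by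
      rw [localPhases, ex_bind]
      simp only [ex_map]
    have h9 : n * pr (localPhase ρ G (D / 2 ^ j) A) (fun x => ¬ FollowsMeanField G D s τ (j + 1) x.1
        (ξ * (120 * alpha (Fintype.card V)) ^ (j + 1))) ≤ 17 / n ^ 6 := by
      calc _ ≤ n * (17 / n ^ 7) := by gcongr
        _ = 17 / n ^ 6 := by field_simp
    have h10 : 5 / n ^ 9 ≤ 5 / n ^ 6 :=
      div_le_div_of_nonneg_left (by norm_num) (by positivity) (pow_le_pow_right₀ hn1 (by norm_num))
    rw [h8]
    rw [pr_not] at h9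
    push_cast
    have e : (22 : ℝ) / n ^ 6 = 17 / n ^ 6 + 5 / n ^ 6 := by ring
    rw [add_mul (k : ℝ) 1 (22 / n ^ 6), one_mul, e]
    rw [e] at h1
    linarith

end MeanField

/-! ### Numerical consequences of the loop condition -/

section Numerics

lemma le_log_of_two_pow_le {n k : ℕ} (h : 2 ^ k ≤ n) : 69 / 100 * k ≤ Real.log n := by
  have h1 : Real.log ((2 : ℝ) ^ k) ≤ Real.log n :=
    Real.log_le_log (by positivity) (by exact_mod_cast h)
  rw [Real.log_pow] at h1
  have h2 := Real.log_two_gt_d9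
  nlinarith [Nat.cast_nonneg (α := ℝ) k]

/-- The main loop only runs on graphs with a huge number of vertices. -/
lemma log_ge_of_pow_le {n : ℕ} (hn : 2 ≤ n) (h : (200 * Real.log n) ^ 32 ≤ n) :
    2 ^ 15 ≤ 200 * Real.log n := by
  -- Bootstrapping: with x = 200 ln n, a bound x ≥ 2^k gives n ≥ 2^(32k) and thus x ≥ 4416k. Two
  -- rounds, k = 6 and k = 14, suffice.
  have key : ∀ k : ℕ, (2 : ℝ) ^ k ≤ 200 * Real.log n → 4416 * (k : ℝ) ≤ 200 * Real.log n := by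
    intro k hk
    have h1 : ((2 : ℝ) ^ k) ^ 32 ≤ n := (pow_le_pow_left₀ (by positivity) hk 32).trans h
    have h2 := le_log_of_two_pow_le (n := n) (k := k * 32) (by
      rw [pow_mul]; exact_mod_cast h1)
    push_cast at h2
    linarith
  have h0 := log_pos_of_two_le hn
  have h1 := key 6 (by norm_num; linarith)
  have h2 := key 14 (by norm_num at h1 ⊢; linarith)
  norm_num at h2 ⊢
  linarith

variable {n S : ℕ} {D : ℝ}

/-- The parameters of an iteration of the main loop. -/
structure LoopNumerics (n S m τ : ℕ) (D ξ : ℝ) : Prop where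
  one_le_m : 1 ≤ m
  m_le : m ≤ n
  one_le_tau : 1 ≤ τ
  tau_le : τ ≤ n
  edges : 4 * (n : ℝ) * D ≤ 8 * S * (m : ℝ) ^ 2
  card : 40 * Real.log n ≤ n / m
  pos : 0 < ξ
  small : alpha n * (ξ * (120 * alpha n) ^ τ) ≤ 1 / 1000
  scale : 100 * Real.log n ≤ ξ ^ 2 * (muR n * (D / m / 2 ^ τ))

lemma pow_le_of_threshold_le (hn : 2 ≤ n) (hS : 1 ≤ S) (h : threshold n S ≤ D) :
    (200 * Real.log n) ^ 32 ≤ D * S / n := by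
  have hn0 : (0 : ℝ) < n := by exact_mod_cast (by omega : 0 < n)
  have hS0 : (0 : ℝ) < S := by exact_mod_cast hS
  rw [le_div_iff₀ hn0]
  unfold threshold at h
  rw [div_mul_eq_mul_div, div_le_iff₀ hS0] at h
  linarith

/-- Since m ≤ √(nD/S), the degree scale D/m on a machine is at least √(DS/n); the exponent 32 of the
threshold is halved. -/
lemma pow_le_machine_degree (hn : 2 ≤ n) (hS : 1 ≤ S) (hSn : S ≤ n) (h : threshold n S ≤ D) :
    (200 * Real.log n) ^ 16 ≤ D / numMachines n S D := by
  have hn0 : (0 : ℝ) < n := by exact_mod_cast (by omega : 0 < n)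
  have hS0 : (0 : ℝ) < S := by exact_mod_cast hS
  have hD := one_le_of_threshold_le hn hS hSn h
  have hm : (0 : ℝ) < numMachines n S D := by exact_mod_cast numMachines_pos hn hS hSn h
  have hx := one_le_log_aux hn
  set x := 200 * Real.log n with hxdef
  have h1 := pow_le_of_threshold_le hn hS h
  have hfl : (numMachines n S D : ℝ) ≤ Real.sqrt (n * D / S) := Nat.floor_le (Real.sqrt_nonneg _)
  rw [le_div_iff₀ hm]
  refine (mul_le_mul_of_nonneg_left hfl (by positivity)).trans ?_
  refine abs_le_of_sq_le_sq' ?_ (by linarith) |>.2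
  rw [mul_pow, Real.sq_sqrt (by positivity), ← pow_mul]
  calc x ^ (16 * 2) * (n * D / S) ≤ D * S / n * (n * D / S) := by gcongr
    _ = D ^ 2 := by field_simp

lemma exists_loopNumerics (hn : 2 ≤ n) (hS : 1 ≤ S) (hSn : S ≤ n) (h : threshold n S ≤ D)
    (hDn : D ≤ n) : ∃ ξ, LoopNumerics n S (numMachines n S D) (numPhases n S D) D ξ := by
  have hn0 : (0 : ℝ) < n := by exact_mod_cast (by omega : 0 < n)
  have hS0 : (0 : ℝ) < S := by exact_mod_cast hS
  have hS1 : (1 : ℝ) ≤ S := by exact_mod_cast hS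
  have hSn' : (S : ℝ) ≤ n := by exact_mod_cast hSn
  have hD := one_le_of_threshold_le hn hS hSn h
  have hD0 : 0 < D := by linarith
  have hm1 := numMachines_pos hn hS hSn h
  have hτ1 := numPhases_pos hn hS hSn h
  have hpow := pow_le_of_threshold_le hn hS h
  have hy := pow_le_machine_degree hn hS hSn h
  have hfl : (numMachines n S D : ℝ) ≤ Real.sqrt (n * D / S) := Nat.floor_le (Real.sqrt_nonneg _)
  have hfl' : Real.sqrt (n * D / S) < numMachines n S D + 1 := Nat.lt_floor_add_one _
  have hτ : (numPhases n S D : ℝ) < 1 / 16 * Real.logb (120 * alpha n) (D / numMachines n S D) + 1 := by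
    refine Nat.ceil_lt_add_one (mul_nonneg (by norm_num) (Real.logb_nonneg ?_ ?_))
    · linarith [alpha_pos hn]
    · exact (one_le_pow₀ (one_le_log_aux hn).le).trans hy
  have hDS : D * S / n ≤ n := by
    rw [div_le_iff₀ hn0]
    gcongr
  have hx15 := log_ge_of_pow_le hn (hpow.trans hDS)
  have hlog := log_pos_of_two_le hn
  set m := numMachines n S D with hm
  set τ := numPhases n S D with hτdef
  set L := Real.log n with hL
  set x := 200 * L with hx
  set y := D / m with hydef
  set B := 120 * alpha n with hB
  have hm0 : (0 : ℝ) < m := by exact_mod_cast hm1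
  have hm1' : (1 : ℝ) ≤ m := by exact_mod_cast hm1
  have hx0 : 0 < x := by linarith
  have hx1 : 1 ≤ x := by linarith
  have hy0 : 0 < y := by positivity
  have hBx : B = 288 / 5 * x := by rw [hB, hx, alpha, ← hL]; ring
  have hB0 : 0 < B := by rw [hBx]; positivity
  have hB2 : 2 ≤ B := by rw [hBx]; linarith
  -- All quantities are compared with powers of x and z, where x ≤ z and z^16 is the degree scale of
  -- a machine.
  set z := y ^ (1 / 16 : ℝ) with hz
  have hz0 : 0 < z := Real.rpow_pos_of_pos hy0 _
  have hzy : z ^ 16 = y := by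
    rw [hz, ← Real.rpow_natCast, ← Real.rpow_mul hy0.le]; norm_num
  have hxz : x ≤ z := by
    refine le_of_not_gt fun hlt => ?_
    have := pow_lt_pow_left₀ hlt hz0.le (n := 16) (by norm_num)
    linarith
  -- The definition of τ: without rounding B^τ would be z, and rounding up costs at most one factor
  -- B.
  have hBτ : B ^ τ ≤ B * z := by
    have h1 : (B : ℝ) ^ (τ : ℝ) ≤ B ^ (1 / 16 * Real.logb B y + 1) :=
      Real.rpow_le_rpow_of_exponent_le (by linarith) hτ.le
    rw [Real.rpow_natCast, Real.rpow_add hB0, Real.rpow_one, mul_comm (1 / 16 : ℝ),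
      Real.rpow_mul hB0.le, Real.rpow_logb hB0 (by linarith) hy0] at h1
    linarith
  have h2τ : (2 : ℝ) ^ τ ≤ B * z := (pow_le_pow_left₀ (by norm_num) hB2 τ).trans hBτ
  have hyn : y ≤ n := (div_le_self hD0.le hm1').trans hDn
  have hq1 : x ^ 32 ≤ n * D / S := by
    refine hpow.trans ?_
    rw [div_le_div_iff₀ hn0 hS0]
    have : (S : ℝ) * S ≤ n * n := by gcongr
    nlinarith
  have hq100 : 10 ≤ Real.sqrt (n * D / S) := by
    refine Real.le_sqrt_of_sq_le (le_trans ?_ hq1)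
    calc (10 : ℝ) ^ 2 ≤ x ^ 1 := by norm_num at hx15 ⊢; linarith
      _ ≤ x ^ 32 := pow_le_pow_right₀ hx1 (by norm_num)
  have hmu : muR n = 1 / (5000 * x) := by rw [muR, ← hL, hx, one_div]; congr 1; ring
  -- The witness is ξ = √w, the smallest noise level allowed by the scale condition, which then
  -- holds with equality.
  set w := 100 * L / (muR n * (y / 2 ^ τ)) with hw
  have hmu0 := muR_pos hn
  have hL0 : 0 < L := by linarith
  have hw0 : 0 < w := by positivity
  -- The final error squared is at most a constant times x^7/z^13, hence at most a constant times
  -- x^(-6). The bound x ≥ 2^15 defeats the constant.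
  have hsmall : alpha n ^ 2 * (w * (B ^ τ) ^ 2) ≤ (1 / 1000) ^ 2 := by
    have h1 : w = 2500 * x ^ 2 * 2 ^ τ / y := by
      rw [hw, hmu, hx]; field_simp; ring
    have h2 : w ≤ 2500 * x ^ 2 * (B * z) / z ^ 16 := by
      rw [h1, hzy]; gcongr
    have h3 : alpha n = 12 / 25 * x := by rw [alpha, hx]; ring
    calc alpha n ^ 2 * (w * (B ^ τ) ^ 2)
        ≤ alpha n ^ 2 * (2500 * x ^ 2 * (B * z) / z ^ 16 * (B * z) ^ 2) := by gcongr
      _ = (12 / 25) ^ 2 * 2500 * (288 / 5) ^ 3 * x ^ 7 / z ^ 13 := by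
          rw [h3, hBx]; field_simp
      _ ≤ (12 / 25) ^ 2 * 2500 * (288 / 5) ^ 3 * x ^ 7 / x ^ 13 := by gcongr
      _ = (12 / 25) ^ 2 * 2500 * (288 / 5) ^ 3 / x ^ 6 := by field_simp
      _ ≤ (12 / 25) ^ 2 * 2500 * (288 / 5) ^ 3 / (2 ^ 15) ^ 6 := by gcongr
      _ ≤ (1 / 1000) ^ 2 := by norm_num
  refine ⟨Real.sqrt w, hm1, ?_, hτ1, ?_, ?_, ?_, Real.sqrt_pos.2 hw0, ?_, ?_⟩
  · have h1 : Real.sqrt (n * D / S) ≤ n := by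
      refine Real.sqrt_le_iff.2 ⟨hn0.le, ?_⟩
      rw [div_le_iff₀ hS0]
      nlinarith
    exact_mod_cast hfl.trans h1
  · have h1 : (τ : ℝ) ≤ 2 ^ τ := by exact_mod_cast Nat.lt_two_pow_self.le
    have h2 : B * z ≤ z ^ 16 := by
      have hz1 : 2 ^ 15 ≤ z := hx15.trans hxz
      calc B * z ≤ z ^ 14 * z * z := by
            have : 288 / 5 ≤ z ^ 14 := by
              calc (288 / 5 : ℝ) ≤ (2 ^ 15) ^ 14 := by norm_num
                _ ≤ z ^ 14 := by gcongr
            rw [hBx]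
            gcongr
        _ = z ^ 16 := by ring
    have h3 : (τ : ℝ) ≤ n := by linarith
    exact_mod_cast h3
  · have h1 : 9 / 10 * Real.sqrt (n * D / S) ≤ m := by linarith
    have h2 : (9 / 10 * Real.sqrt (n * D / S)) ^ 2 ≤ (m : ℝ) ^ 2 := by gcongr
    rw [mul_pow, Real.sq_sqrt (by positivity)] at h2
    have h3 : (9 / 10) ^ 2 * (n * D / S) * S ≤ (m : ℝ) ^ 2 * S := by gcongr
    have h4 : (9 / 10) ^ 2 * (n * D / S) * S = (9 / 10) ^ 2 * (n * D) := by field_simp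
    rw [h4] at h3
    have : 0 < n * D := by positivity
    linarith
  · have h1 : y ≤ n / m := by rw [hydef]; gcongr
    have h2 : x ≤ x ^ 16 := le_self_pow₀ hx1 (by norm_num)
    linarith
  · have h1 : alpha n * (Real.sqrt w * B ^ τ) = Real.sqrt (alpha n ^ 2 * (w * (B ^ τ) ^ 2)) := by
      rw [Real.sqrt_mul (by positivity), Real.sqrt_mul hw0.le,
        Real.sqrt_sq (by linarith [alpha_pos hn]), Real.sqrt_sq (pow_pos hB0 τ).le]
    rw [h1]
    exact Real.sqrt_le_iff.2 ⟨by norm_num, hsmall⟩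
  · rw [Real.sq_sqrt hw0.le, hw]
    rw [div_mul_cancel₀ _ (ne_of_gt (by positivity))]

end Numerics

/-! ### The random partition -/

section Partition

variable {V : Type*} [Fintype V] {G : SimpleGraph V} {A : Finset V} {D ξ : ℝ} {S m τ : ℕ}

/-- Every remaining vertex is on a given machine with probability `1 / m`. -/
def initialDensity (A : Finset V) (m : ℕ) (w : V) : ℝ := if w ∈ A then 1 / m else 0

lemma density_eq_prod (G : SimpleGraph V) (D : ℝ) (s : V → ℝ) (l : ℕ) (w : V) :
    density G D s l w =
      s w * ∏ k ∈ Finset.Ico 0 l, meanSurvival G (D / 2 ^ k) (density G D s k) w := by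
  induction l with
  | zero => simp [density]
  | succ l ih =>
    rw [Finset.prod_Ico_succ_top (Nat.zero_le l), ← mul_assoc, ← ih]
    rfl

/-- The target is the expected value of the statistic on one machine of a uniformly random
partition, so concentration of the partition is the base case of the mean-field induction. -/
lemma target_initialDensity (G : SimpleGraph V) (D : ℝ) (A : Finset V) (m l : ℕ) (b : Bool) (u : V) :
    target G D (initialDensity A m) l b u =
      (∑ w ∈ A, if G.Adj u w then pullback G D (initialDensity A m) 0 l b w else 0) / m := by
  rw [target, Finset.sum_filter, Finset.sum_div,
    ← Finset.sum_subset (Finset.subset_univ A) fun w _ hw => by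
      rw [density_eq_prod, initialDensity, if_neg hw, zero_mul, zero_mul, ite_self]]
  refine Finset.sum_congr rfl fun w hw => ?_
  rw [density_eq_prod, pullback]
  split_ifs
  · conv_lhs => rw [initialDensity, if_pos hw]
    ring
  · rw [zero_div]

lemma machineParams (hn : 2 ≤ Fintype.card V) (hL : LoopNumerics (Fintype.card V) S m τ D ξ)
    (hdeg : ∀ v ∈ A, (nbrCount G A v : ℝ) ≤ 3 / 2 * D) :
    MachineParams G (D / m) (initialDensity A m) ξ τ where
  two_le := hn
  tau_le := hL.tau_le
  nonneg w := by unfold initialDensity; split_ifs <;> positivity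
  meanDeg_le u hu := by
    have huA : u ∈ A := by
      by_contra h
      exact hu (by rw [initialDensity, if_neg h])
    have e : meanDeg G (initialDensity A m) u = nbrCount G A u / m := by
      rw [nbrCount_eq_sum_one, Finset.sum_div, meanDeg, Finset.sum_filter, Finset.sum_filter,
        ← Finset.sum_subset (Finset.subset_univ A) fun w _ hw => by
          rw [initialDensity, if_neg hw, ite_self]]
      refine Finset.sum_congr rfl fun w hw => ?_
      rw [initialDensity, if_pos hw]
    rw [e, ← mul_div_assoc]
    gcongr
    exact hdeg u huA
  pos := hL.pos
  small := hL.small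
  scale := hL.scale

lemma ex_uniform_fin [NeZero m] (i : Fin m) (c : ℝ) :
    ex (PMF.uniformOfFintype (Fin m)) (fun j => if j = i then c else 0) = c / m := by
  rw [ex, Finset.sum_eq_single i]
  · simp [div_eq_inv_mul]
  · intro j _ hj; simp [hj]
  · simp

lemma chernoff_partition [NeZero m] (A : Finset V) (i : Fin m) {f : V → ℝ} (f0 : ∀ v, 0 ≤ f v)
    (f1 : ∀ v, f v ≤ 1) {M l : ℝ} (hM : (∑ v ∈ A, f v) / m ≤ M) (hl : 0 ≤ l) (hlM : l ≤ 2 * M)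
    (hM0 : 0 < M) :
    pr (indep fun _ : V => PMF.uniformOfFintype (Fin m)) (fun Φ =>
      l ≤ |∑ v ∈ A.filter (fun v => Φ v = i), f v - (∑ v ∈ A, f v) / m|) ≤
      2 * Real.exp (-(l ^ 2 / (4 * M))) := by
  set g : V → Fin m → ℝ := fun v j => if j = i then (if v ∈ A then f v else 0) else 0 with hg
  have hmean : ∑ v, ex (PMF.uniformOfFintype (Fin m)) (g v) = (∑ v ∈ A, f v) / m := by
    rw [Finset.sum_div, ← Finset.sum_subset (Finset.subset_univ A) fun v _ hv => by
      rw [hg, ex_uniform_fin, if_neg hv, zero_div]]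
    refine Finset.sum_congr rfl fun v hv => ?_
    rw [hg, ex_uniform_fin, if_pos hv]
  have hsum : ∀ Φ : V → Fin m, ∑ v, g v (Φ v) = ∑ v ∈ A.filter (fun v => Φ v = i), f v := by
    intro Φ
    rw [Finset.sum_filter, ← Finset.sum_subset (Finset.subset_univ A) fun v _ hv => by
      simp only [hg]; rw [if_neg hv, ite_self]]
    refine Finset.sum_congr rfl fun v hv => ?_
    simp only [hg]
    rw [if_pos hv]
  have key := chernoff (fun _ : V => PMF.uniformOfFintype (Fin m)) g
    (fun v b => by simp only [hg]; split_ifs; exacts [f0 v, le_rfl, le_rfl])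
    (fun v b => by simp only [hg]; split_ifs; exacts [f1 v, zero_le_one, zero_le_one])
    (hmean.trans_le hM) hl hlM hM0
  rw [hmean] at key
  simpa only [hsum] using key

/-- A partition that gives every machine a typical set of vertices. -/
def GoodPartition (G : SimpleGraph V) (A : Finset V) (D ξ : ℝ) (m τ : ℕ) (Φ : V → Fin m) : Prop :=
  ∀ i, FollowsMeanField G (D / m) (initialDensity A m) τ 0 (A.filter fun v => Φ v = i) ξ ∧
    ((A.filter fun v => Φ v = i).card : ℝ) ≤ 2 * (Fintype.card V / m)

lemma pr_not_goodPartition_le [NeZero m] (hn : 2 ≤ Fintype.card V)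
    (hL : LoopNumerics (Fintype.card V) S m τ D ξ)
    (hdeg : ∀ v ∈ A, (nbrCount G A v : ℝ) ≤ 3 / 2 * D) :
    pr (indep fun _ : V => PMF.uniformOfFintype (Fin m))
      (fun Φ => ¬ GoodPartition G A D ξ m τ Φ) ≤ 10 / (Fintype.card V : ℝ) ^ 7 := by
  have hp := machineParams hn hL hdeg
  have hn1 := card_pos_of_two_le hn
  have hm0 : (0 : ℝ) < m := by exact_mod_cast hL.one_le_m
  have hlog := log_pos_of_two_le hn
  set n := Fintype.card V with hndef
  set s : V → ℝ := initialDensity A m with hs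
  set I : Finset (V × ℕ × Bool) := (Finset.univ ×ˢ Finset.range (τ + 1) ×ˢ Finset.univ).filter
    fun i => density G (D / m) s i.2.1 i.1 ≠ 0 with hI
  set f : V × ℕ × Bool → V → ℝ := fun c w =>
    if G.Adj c.1 w then pullback G (D / m) s 0 c.2.1 c.2.2 w else 0 with hf
  have hIcard : (I.card : ℝ) ≤ 4 * (n : ℝ) ^ 2 := by
    have h1 : I.card ≤ n * ((τ + 1) * 2) := by
      refine (Finset.card_filter_le _ _).trans_eq ?_
      rw [Finset.card_product, Finset.card_product, Finset.card_range, Finset.card_univ,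
        Finset.card_univ, Fintype.card_bool]
    have h2 : (I.card : ℝ) ≤ n * ((τ + 1) * 2) := by exact_mod_cast h1
    have h3 : (τ : ℝ) ≤ n := by exact_mod_cast hL.tau_le
    nlinarith
  have hbad1 : ∀ i : Fin m, ∀ c ∈ I, pr (indep fun _ : V => PMF.uniformOfFintype (Fin m)) (fun Φ =>
      ξ * (D / m / 2 ^ c.2.1) ≤ |∑ v ∈ A.filter (fun v => Φ v = i), f c v - (∑ v ∈ A, f c v) / m|) ≤
      2 / (n : ℝ) ^ 10 := by
    intro i c hc
    simp only [hI, Finset.mem_filter, Finset.mem_product, Finset.mem_range, Finset.mem_univ,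
      true_and, and_true] at hc
    have hsc := hp.scale_of_le (j := c.2.1) (by omega)
    have hE : 0 < D / m / 2 ^ c.2.1 := div_pos hp.D_pos (by positivity)
    have hsc' : 100 * Real.log n ≤ ξ ^ 2 * (D / m / 2 ^ c.2.1) := by
      refine hsc.trans ?_
      have h3 : muR n * (D / m / 2 ^ c.2.1) ≤ D / m / 2 ^ c.2.1 := by nlinarith [muR_le hn]
      gcongr
    have hξ := hp.pos
    have hξ1 : ξ ≤ 1 := by
      have h1 := (hp.smallNoise (Nat.zero_le τ)).eta_le hn
      have h2 := (hp.smallNoise (Nat.zero_le τ)).le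
      linarith
    refine (chernoff_partition A i (M := 2 * (D / m / 2 ^ c.2.1)) (fun v => ?_) (fun v => ?_) ?_
      (by positivity) (by nlinarith) (by positivity)).trans (two_mul_exp_le hn hsc')
    · simp only [hf]; split_ifs
      exacts [hp.pullback_nonneg _ _ _ _, le_rfl]
    · simp only [hf]; split_ifs
      exacts [hp.pullback_le_one _ _ _ _, zero_le_one]
    · have h1 := hp.target_le c.2.2 hc.2
      rw [hs, target_initialDensity] at h1
      exact h1.trans (by linarith)
  have hbad2 : ∀ i : Fin m, pr (indep fun _ : V => PMF.uniformOfFintype (Fin m)) (fun Φ =>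
      (n : ℝ) / m ≤ |∑ v ∈ A.filter (fun v => Φ v = i), (1 : ℝ) - (∑ v ∈ A, (1 : ℝ)) / m|) ≤
      2 / (n : ℝ) ^ 10 := by
    intro i
    have hq : 0 < (n : ℝ) / m := by positivity
    refine (chernoff_partition A i (M := (n : ℝ) / m) (fun _ => zero_le_one) (fun _ => le_rfl) ?_
      hq.le (by linarith) hq).trans ?_
    · rw [Finset.sum_const, nsmul_eq_mul, mul_one]
      gcongr
      exact Finset.card_le_univ A
    · have h1 := exp_neg_mul_log hn 10
      push_cast at h1
      rw [show (2 : ℝ) / (n : ℝ) ^ 10 = 2 * (1 / (n : ℝ) ^ 10) by ring, ← h1]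
      have h2 : ((n : ℝ) / m) ^ 2 / (4 * ((n : ℝ) / m)) = (n : ℝ) / m / 4 := by field_simp
      rw [h2]
      have := hL.card
      gcongr
      linarith
  calc _ ≤ pr (indep fun _ : V => PMF.uniformOfFintype (Fin m)) (fun Φ =>
      ∃ i ∈ (Finset.univ : Finset (Fin m)), (∃ c ∈ I,
        ξ * (D / m / 2 ^ c.2.1) ≤ |∑ v ∈ A.filter (fun v => Φ v = i), f c v - (∑ v ∈ A, f c v) / m|) ∨
        (n : ℝ) / m ≤ |∑ v ∈ A.filter (fun v => Φ v = i), (1 : ℝ) - (∑ v ∈ A, (1 : ℝ)) / m|) := by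
        refine pr_mono ?_
        intro Φ _ hbad
        by_contra hcon
        push Not at hcon
        refine hbad fun i => ⟨⟨fun w hw => ?_, fun l _ hl u hu b => ?_⟩, ?_⟩
        · rw [density, initialDensity, if_pos (Finset.mem_filter.1 hw).1]
          positivity
        · have h := (hcon i (Finset.mem_univ i)).1 (u, l, b) (by
            simp only [hI, Finset.mem_filter, Finset.mem_product, Finset.mem_range,
              Finset.mem_univ, true_and, and_true]
            exact ⟨by omega, hu⟩)
          simp only [hf] at h
          rw [← target_initialDensity, ← Finset.sum_filter] at h
          exact h.le
        · have h := (abs_lt.1 (hcon i (Finset.mem_univ i)).2).2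
          rw [Finset.sum_const, Finset.sum_const, nsmul_eq_mul, nsmul_eq_mul, mul_one, mul_one] at h
          have h1 : (A.card : ℝ) / m ≤ n / m := by
            gcongr
            exact Finset.card_le_univ A
          linarith
    _ ≤ (Finset.univ : Finset (Fin m)).card * (I.card * (2 / (n : ℝ) ^ 10) + 2 / (n : ℝ) ^ 10) :=
        pr_exists_le_card_mul _ _ _ fun i _ => (pr_or_le _ _ _).trans
          (add_le_add (pr_exists_le_card_mul _ _ _ (hbad1 i)) (hbad2 i))
    _ ≤ n * (4 * (n : ℝ) ^ 2 * (2 / (n : ℝ) ^ 10) + (n : ℝ) ^ 2 * (2 / (n : ℝ) ^ 10)) := by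
        rw [Finset.card_univ, Fintype.card_fin]
        have h1 : (m : ℝ) ≤ n := by exact_mod_cast hL.m_le
        have h2 : 2 / (n : ℝ) ^ 10 ≤ (n : ℝ) ^ 2 * (2 / (n : ℝ) ^ 10) :=
          le_mul_of_one_le_left (by positivity) (one_le_pow₀ hn1)
        gcongr
    _ = 10 / (n : ℝ) ^ 7 := by field_simp; norm_num

/-- A machine holds at most 2n/m vertices of degree at most 2D/m each, so it has at most 4nD/m² ≤ 8S
edges and is not emptied. -/
lemma GoodPartition.securityCheck_eq (hn : 2 ≤ Fintype.card V)
    (hL : LoopNumerics (Fintype.card V) S m τ D ξ)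
    (hdeg : ∀ v ∈ A, (nbrCount G A v : ℝ) ≤ 3 / 2 * D) {Φ : V → Fin m}
    (hΦ : GoodPartition G A D ξ m τ Φ) (i : Fin m) :
    securityCheck G S (A.filter fun v => Φ v = i) = A.filter fun v => Φ v = i := by
  have hp := machineParams hn hL hdeg
  have hm0 : (0 : ℝ) < m := by exact_mod_cast hL.one_le_m
  obtain ⟨h1, h2⟩ := hΦ i
  set B := A.filter fun v => Φ v = i
  rw [securityCheck, if_neg]
  rw [not_lt]
  have h3 : FollowsMeanField G (D / m) (initialDensity A m) τ 0 B
      (ξ * (120 * alpha (Fintype.card V)) ^ 0) := by rwa [pow_zero, mul_one]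
  have h4 : ∀ v ∈ B, (nbrCount G B v : ℝ) ≤ 2 * (D / m) := fun v hv => by
    have := (h3.nearMeanField hp (Nat.zero_le τ)).nbrCount_le hn (hp.smallNoise (Nat.zero_le τ)) hv
    simpa using this
  have h5 : ((∑ v ∈ B, nbrCount G B v : ℕ) : ℝ) ≤ 8 * S := by
    push_cast
    refine (Finset.sum_le_sum h4).trans ?_
    rw [Finset.sum_const, nsmul_eq_mul]
    have hD := hp.D_pos
    calc (B.card : ℝ) * (2 * (D / m)) ≤ 2 * (Fintype.card V / m) * (2 * (D / m)) := by gcongr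
      _ = 4 * Fintype.card V * D / (m : ℝ) ^ 2 := by field_simp; ring
      _ ≤ 8 * S := by rw [div_le_iff₀ (by positivity)]; exact hL.edges
  exact (ncard_edgeSet_inducedOn_le G B).trans (by exact_mod_cast h5)

end Partition

/-! ### One iteration of the main loop -/

section LoopBody

variable {V : Type*} [Fintype V] {G : SimpleGraph V} {A : Finset V} {D ξ : ℝ} {S m τ : ℕ}

/-- The machines, started on a given partition. -/
def machines (ρ : OpenChoices V) (G : SimpleGraph V) (S m τ : ℕ) (D : ℝ) (A : Finset V)
    (Φ : V → Fin m) : PMF (Fin m → Finset V × Finset (Sym2 V)) :=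
  indep fun i => localPhases ρ G τ (D / m) (securityCheck G S (A.filter fun v => Φ v = i))

lemma loopBody_eq (ρ : OpenChoices V) (G : SimpleGraph V) (S m τ : ℕ) [NeZero m] (D : ℝ)
    (A : Finset V) : loopBody ρ G S m τ D A =
      (indep fun _ : V => PMF.uniformOfFintype (Fin m)).bind fun Φ =>
      (machines ρ G S m τ D A Φ).map fun out =>
        (Finset.univ.biUnion fun i => (out i).1, Finset.univ.biUnion fun i => (out i).2) := rfl

/-- If all machines follow the mean field, then all remaining degrees are small. -/
lemma nbrCount_le_of_followsMeanField (hp : MachineParams G (D / m) (initialDensity A m) ξ τ)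
    (hτ : 1 ≤ τ) (hm : 1 ≤ m) {B : Fin m → Finset V}
    (hB : ∀ i, FollowsMeanField G (D / m) (initialDensity A m) τ τ (B i)
      (ξ * (120 * alpha (Fintype.card V)) ^ τ)) {v : V} (hv : v ∈ Finset.univ.biUnion B) :
    (nbrCount G (Finset.univ.biUnion B) v : ℝ) ≤ 3 / 2 * (D / 2 ^ τ) := by
  have hm0 : (0 : ℝ) < m := by exact_mod_cast hm
  obtain ⟨i₀, -, hv⟩ := Finset.mem_biUnion.1 hv
  -- Nonzero density is a property of the common mean field. Thus survival of `v` on its own machine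
  -- controls its neighbourhood on every other machine too.
  have hdv := (hB i₀).1 v hv
  have h1 : ∀ i ∈ (Finset.univ : Finset (Fin m)),
      (nbrCount G (B i) v : ℝ) ≤ 3 / 2 * (D / m / 2 ^ τ) := by
    intro i _
    have h2 := (hB i).2 τ le_rfl le_rfl v hdv false
    simp only [pullback_self, target, testWeight, mul_one, Bool.false_eq_true, if_false] at h2
    rw [← nbrCount_eq_sum_one] at h2
    have h3 : meanDeg G (density G (D / m) (initialDensity A m) τ) v ≤ 7 / 5 * (D / m / 2 ^ τ) := by
      obtain ⟨k, rfl⟩ : ∃ k, τ = k + 1 := ⟨τ - 1, by omega⟩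
      exact hp.meanDeg_density_succ_le hdv
    rw [meanDeg] at h3
    have h4 := (hp.smallNoise le_rfl).eta_le hp.two_le
    have h5 : 0 < D / m / 2 ^ τ := div_pos hp.D_pos (by positivity)
    have h6 := (abs_le.1 h2).2
    nlinarith
  calc (nbrCount G (Finset.univ.biUnion B) v : ℝ) ≤ ∑ i, (nbrCount G (B i) v : ℝ) := by
        exact_mod_cast nbrCount_biUnion_le G Finset.univ B v
    _ ≤ ∑ _i : Fin m, 3 / 2 * (D / m / 2 ^ τ) := Finset.sum_le_sum h1
    _ = 3 / 2 * (D / 2 ^ τ) := by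
        rw [Finset.sum_const, Finset.card_univ, Fintype.card_fin, nsmul_eq_mul]
        field_simp

lemma GoodPartition.follows {Φ : V → Fin m} (hΦ : GoodPartition G A D ξ m τ Φ) (i : Fin m) :
    FollowsMeanField G (D / m) (initialDensity A m) τ 0 (A.filter fun v => Φ v = i)
      (ξ * (120 * alpha (Fintype.card V)) ^ 0) := by
  rw [pow_zero, mul_one]
  exact (hΦ i).1

lemma GoodPartition.pr_machines_le (ρ : OpenChoices V) (hn : 2 ≤ Fintype.card V)
    (hL : LoopNumerics (Fintype.card V) S m τ D ξ)
    (hdeg : ∀ v ∈ A, (nbrCount G A v : ℝ) ≤ 3 / 2 * D) {Φ : V → Fin m}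
    (hΦ : GoodPartition G A D ξ m τ Φ) :
    pr (machines ρ G S m τ D A Φ) (fun out => ¬ ∀ i, FollowsMeanField G (D / m)
      (initialDensity A m) τ τ (out i).1 (ξ * (120 * alpha (Fintype.card V)) ^ τ)) ≤
      17 / (Fintype.card V : ℝ) ^ 5 := by
  have hp := machineParams hn hL hdeg
  have hn1 := card_pos_of_two_le hn
  set n := Fintype.card V with hndef
  have h1 : ∀ i ∈ (Finset.univ : Finset (Fin m)), pr (machines ρ G S m τ D A Φ) (fun out =>
      ¬ FollowsMeanField G (D / m) (initialDensity A m) τ τ (out i).1 (ξ * (120 * alpha n) ^ τ)) ≤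
      τ * (17 / (n : ℝ) ^ 7) := by
    intro i _
    have h2 := pr_localPhases_le ρ hp (zero_add τ) (hΦ.follows i)
    rw [pow_zero, div_one, pr_not] at h2
    rw [pr_not, machines, ex_indep_apply (fun i => localPhases ρ G τ (D / m) (securityCheck G S
      (A.filter fun v => Φ v = i))) i (fun x => if FollowsMeanField G (D / m)
      (initialDensity A m) τ τ x.1 (ξ * (120 * alpha n) ^ τ) then 0 else 1),
      hΦ.securityCheck_eq hn hL hdeg i]
    exact h2
  calc _ ≤ pr (machines ρ G S m τ D A Φ) (fun out => ∃ i ∈ (Finset.univ : Finset (Fin m)),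
      ¬ FollowsMeanField G (D / m) (initialDensity A m) τ τ (out i).1 (ξ * (120 * alpha n) ^ τ)) :=
        pr_mono fun out _ h => by
          rw [not_forall] at h
          obtain ⟨i, hi⟩ := h
          exact ⟨i, Finset.mem_univ i, hi⟩
    _ ≤ m * (τ * (17 / (n : ℝ) ^ 7)) := by
        refine (pr_exists_le_card_mul _ _ _ h1).trans_eq ?_
        rw [Finset.card_univ, Fintype.card_fin]
    _ ≤ n * (n * (17 / (n : ℝ) ^ 7)) := by
        have h3 : (m : ℝ) ≤ n := by exact_mod_cast hL.m_le
        have h4 : (τ : ℝ) ≤ n := by exact_mod_cast hL.tau_le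
        gcongr
    _ = 17 / (n : ℝ) ^ 5 := by field_simp

/-- With high probability an iteration of the main loop reduces the degrees as planned. -/
lemma pr_loopBody_le [NeZero m] (ρ : OpenChoices V) (hn : 2 ≤ Fintype.card V)
    (hL : LoopNumerics (Fintype.card V) S m τ D ξ)
    (hdeg : ∀ v ∈ A, (nbrCount G A v : ℝ) ≤ 3 / 2 * D) :
    pr (loopBody ρ G S m τ D A)
      (fun x => ¬ ∀ v ∈ x.1, (nbrCount G x.1 v : ℝ) ≤ 3 / 2 * (D / 2 ^ τ)) ≤
      27 / (Fintype.card V : ℝ) ^ 5 := by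
  have hp := machineParams hn hL hdeg
  have hn1 := card_pos_of_two_le hn
  rw [loopBody_eq]
  refine (pr_bind_le (B := fun Φ => ¬ GoodPartition G A D ξ m τ Φ)
    (b := 17 / (Fintype.card V : ℝ) ^ 5) (by positivity) fun Φ _ hΦ => ?_).trans ?_
  · rw [pr_map]
    refine (pr_mono ?_).trans ((not_not.1 hΦ).pr_machines_le ρ hn hL hdeg)
    intro out _ hbad hgood
    exact hbad fun v hv => nbrCount_le_of_followsMeanField hp hL.one_le_tau hL.one_le_m hgood hv
  · have h1 := pr_not_goodPartition_le hn hL hdeg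
    have h2 : 10 / (Fintype.card V : ℝ) ^ 7 ≤ 10 / (Fintype.card V : ℝ) ^ 5 :=
      div_le_div_of_nonneg_left (by norm_num) (by positivity) (pow_le_pow_right₀ hn1 (by norm_num))
    have e : 27 / (Fintype.card V : ℝ) ^ 5 =
      10 / (Fintype.card V : ℝ) ^ 5 + 17 / (Fintype.card V : ℝ) ^ 5 := by ring
    linarith

lemma card_edgesIn_le_card {N : Finset (Sym2 V)} (hN : IsMatching G N) (A : Finset V) :
    (edgesIn N A).card ≤ Fintype.card V := by
  refine ((isMatching_edgesIn hN A).card_le_of_cover Finset.univ fun e _ => ?_).trans_eq Finset.card_univ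
  induction e with
  | _ x y => exact ⟨x, Finset.mem_univ x, Sym2.mem_mk_left x y⟩

/-- Only removed endpoints of edges of `N` inside `A` are counted, so the unpaid reference vertices
cost `muR` times the number of these endpoints instead of `muR` times |A|. -/
lemma GoodPartition.card_edgesIn_le (ρ : OpenChoices V) (hn : 2 ≤ Fintype.card V)
    (hL : LoopNumerics (Fintype.card V) S m τ D ξ)
    (hdeg : ∀ v ∈ A, (nbrCount G A v : ℝ) ≤ 3 / 2 * D) {Φ : V → Fin m}
    (hΦ : GoodPartition G A D ξ m τ Φ) {N : Finset (Sym2 V)} (hN : IsMatching G N) :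
    ((edgesIn N A).card : ℝ) ≤ ex (machines ρ G S m τ D A Φ) (fun out =>
        ((edgesIn N (Finset.univ.biUnion fun i => (out i).1)).card : ℝ) +
          400 * ((Finset.univ.biUnion fun i => (out i).2).card : ℝ)) +
      2 * τ * muR (Fintype.card V) * (edgesIn N A).card + 22 / (Fintype.card V : ℝ) ^ 4 := by
  have hp := machineParams hn hL hdeg
  have hn1 := card_pos_of_two_le hn
  have hmu := muR_pos hn
  obtain ⟨X, hX, hXmem⟩ := exists_vertices (edgesIn N A)
  set n := Fintype.card V with hndef
  set B : Fin m → Finset V := fun i => A.filter fun v => Φ v = i with hB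
  have hloc : ∀ i, ((B i ∩ X).card : ℝ) ≤ ex (machines ρ G S m τ D A Φ) (fun out =>
      (((out i).1 ∩ X).card : ℝ) + 400 * ((out i).2.card : ℝ)) +
      τ * (muR n * (B i ∩ X).card) + τ * (22 / (n : ℝ) ^ 6) := by
    intro i
    have h1 := card_inter_le_ex_localPhases ρ hp X (zero_add τ) (hΦ.follows i)
    rw [pow_zero, div_one] at h1
    rw [machines, ex_indep_apply (fun i => localPhases ρ G τ (D / m) (securityCheck G S
      (A.filter fun v => Φ v = i))) i (fun x => ((x.1 ∩ X).card : ℝ) + 400 * (x.2.card : ℝ)),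
      hΦ.securityCheck_eq hn hL hdeg i]
    exact h1
  -- The machines hold disjoint vertex sets and each edge has two endpoints; this is the origin of
  -- the factor 2 in 2τ`muR`.
  have hcardX : ∑ i, ((B i ∩ X).card : ℝ) ≤ 2 * (edgesIn N A).card := by
    have h1 : ∑ i, (B i ∩ X).card ≤ X.card := by
      rw [← Finset.card_biUnion fun i _ j _ hij => Finset.disjoint_left.2 fun v hv hv' => hij
        ((Finset.mem_filter.1 (Finset.mem_inter.1 hv).1).2.symm.trans
          (Finset.mem_filter.1 (Finset.mem_inter.1 hv').1).2)]
      refine Finset.card_le_card fun v hv => ?_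
      obtain ⟨i, -, hv⟩ := Finset.mem_biUnion.1 hv
      exact (Finset.mem_inter.1 hv).2
    exact_mod_cast h1.trans hX
  have hpt : ex (machines ρ G S m τ D A Φ) (fun out => ((edgesIn N A).card : ℝ) -
      ∑ i, (((B i ∩ X).card : ℝ) - ((((out i).1 ∩ X).card : ℝ) + 400 * ((out i).2.card : ℝ)))) ≤
      ex (machines ρ G S m τ D A Φ) (fun out =>
        ((edgesIn N (Finset.univ.biUnion fun i => (out i).1)).card : ℝ) +
          400 * ((Finset.univ.biUnion fun i => (out i).2).card : ℝ)) := by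
    refine ex_mono fun out hout => ?_
    have hsound : ∀ i, Sound G (B i) (out i).1 (out i).2 := fun i =>
      sound_of_mem_support_machines hout i
    have hcard := (sound_collect Φ hsound).2
    have hrem := RoundCompression.card_edgesIn_le hN (A := A) (A' := Finset.univ.biUnion fun i => (out i).1)
      (Finset.univ.biUnion fun i => (B i ∩ X) \ ((out i).1 ∩ X)) (fun v hv hv' he => by
        refine Finset.mem_biUnion.2 ⟨Φ v, Finset.mem_univ _, Finset.mem_sdiff.2
          ⟨Finset.mem_inter.2 ⟨Finset.mem_filter.2 ⟨hv, rfl⟩, (hXmem v).2 he⟩, fun h => hv' ?_⟩⟩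
        exact Finset.mem_biUnion.2 ⟨Φ v, Finset.mem_univ _, (Finset.mem_inter.1 h).1⟩)
    have h2 : ((Finset.univ.biUnion fun i => (B i ∩ X) \ ((out i).1 ∩ X)).card : ℝ) ≤
        ∑ i, (((B i ∩ X).card : ℝ) - (((out i).1 ∩ X).card : ℝ)) := by
      refine (Nat.cast_le.2 Finset.card_biUnion_le).trans_eq ?_
      push_cast
      refine Finset.sum_congr rfl fun i _ => ?_
      rw [Finset.cast_card_sdiff (Finset.inter_subset_inter_right (hsound i).1)]
    have h3 : ((edgesIn N A).card : ℝ) ≤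
        (edgesIn N (Finset.univ.biUnion fun i => (out i).1)).card +
        ((Finset.univ.biUnion fun i => (B i ∩ X) \ ((out i).1 ∩ X)).card : ℝ) := by
      exact_mod_cast hrem
    rw [hcard]
    push_cast
    rw [Finset.mul_sum]
    rw [Finset.sum_sub_distrib] at h2 ⊢
    rw [Finset.sum_add_distrib]
    linarith
  rw [ex_sub, ex_const, ex_sum] at hpt
  have hsum : ∑ i, ex (machines ρ G S m τ D A Φ) (fun out => ((B i ∩ X).card : ℝ) -
      ((((out i).1 ∩ X).card : ℝ) + 400 * ((out i).2.card : ℝ))) ≤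
      2 * τ * muR n * (edgesIn N A).card + 22 / (n : ℝ) ^ 4 := by
    calc _ ≤ ∑ i, (τ * muR n * ((B i ∩ X).card : ℝ) + τ * (22 / (n : ℝ) ^ 6)) := by
          refine Finset.sum_le_sum fun i _ => ?_
          rw [ex_sub, ex_const]
          linarith [hloc i]
      _ = τ * muR n * ∑ i, ((B i ∩ X).card : ℝ) + m * (τ * (22 / (n : ℝ) ^ 6)) := by
          rw [Finset.sum_add_distrib, ← Finset.mul_sum, Finset.sum_const, Finset.card_univ,
            Fintype.card_fin, nsmul_eq_mul]
      _ ≤ τ * muR n * (2 * (edgesIn N A).card) + n * (n * (22 / (n : ℝ) ^ 6)) := by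
          have h3 : (m : ℝ) ≤ n := by exact_mod_cast hL.m_le
          have h4 : (τ : ℝ) ≤ n := by exact_mod_cast hL.tau_le
          gcongr
      _ = 2 * τ * muR n * (edgesIn N A).card + 22 / (n : ℝ) ^ 4 := by
          have e : (n : ℝ) * (n * (22 / (n : ℝ) ^ 6)) = 22 / (n : ℝ) ^ 4 := by field_simp
          rw [e]
          ring
  linarith

/-- An iteration of the main loop destroys few edges of a matching compared to the expected size of
the matching that it finds. -/
lemma card_edgesIn_le_ex_loopBody [NeZero m] (ρ : OpenChoices V) (hn : 2 ≤ Fintype.card V)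
    (hL : LoopNumerics (Fintype.card V) S m τ D ξ)
    (hdeg : ∀ v ∈ A, (nbrCount G A v : ℝ) ≤ 3 / 2 * D) {N : Finset (Sym2 V)}
    (hN : IsMatching G N) :
    ((edgesIn N A).card : ℝ) ≤ ex (loopBody ρ G S m τ D A) (fun x =>
        ((edgesIn N x.1).card : ℝ) + 400 * (x.2.card : ℝ)) +
      2 * τ * muR (Fintype.card V) * (edgesIn N A).card + 32 / (Fintype.card V : ℝ) ^ 4 := by
  have hn1 := card_pos_of_two_le hn
  have hmu := muR_pos hn
  have hbad := pr_not_goodPartition_le hn hL hdeg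
  set n := Fintype.card V with hndef
  have hnu : ((edgesIn N A).card : ℝ) ≤ n := by exact_mod_cast card_edgesIn_le_card hN A
  set K := 2 * τ * muR n * (edgesIn N A).card + 22 / (n : ℝ) ^ 4 with hK
  have hK0 : 0 ≤ K := by positivity
  have h1 : ((edgesIn N A).card : ℝ) ≤
      ex (indep fun _ : V => PMF.uniformOfFintype (Fin m)) (fun Φ =>
        ex (machines ρ G S m τ D A Φ) (fun out =>
        ((edgesIn N (Finset.univ.biUnion fun i => (out i).1)).card : ℝ) +
          400 * ((Finset.univ.biUnion fun i => (out i).2).card : ℝ)) + K +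
        n * if GoodPartition G A D ξ m τ Φ then 0 else 1) := by
    refine const_le_ex fun Φ _ => ?_
    split_ifs with hΦ
    · have := hΦ.card_edgesIn_le ρ hn hL hdeg hN
      linarith
    · have : 0 ≤ ex (machines ρ G S m τ D A Φ) (fun out =>
        ((edgesIn N (Finset.univ.biUnion fun i => (out i).1)).card : ℝ) +
          400 * ((Finset.univ.biUnion fun i => (out i).2).card : ℝ)) :=
        ex_nonneg fun _ _ => by positivity
      linarith
  rw [ex_add, ex_add, ex_const, ex_const_mul, ← pr_not] at h1
  have h2 : ex (loopBody ρ G S m τ D A) (fun x =>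
      ((edgesIn N x.1).card : ℝ) + 400 * (x.2.card : ℝ)) =
      ex (indep fun _ : V => PMF.uniformOfFintype (Fin m)) (fun Φ =>
        ex (machines ρ G S m τ D A Φ) (fun out =>
        ((edgesIn N (Finset.univ.biUnion fun i => (out i).1)).card : ℝ) +
          400 * ((Finset.univ.biUnion fun i => (out i).2).card : ℝ))) := by
    rw [loopBody_eq, ex_bind]
    simp only [ex_map]
  have h3 : n * pr (indep fun _ : V => PMF.uniformOfFintype (Fin m))
      (fun Φ => ¬ GoodPartition G A D ξ m τ Φ) ≤ 10 / (n : ℝ) ^ 4 := by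
    calc _ ≤ n * (10 / (n : ℝ) ^ 7) := by gcongr
      _ = 10 / (n : ℝ) ^ 6 := by field_simp
      _ ≤ 10 / (n : ℝ) ^ 4 :=
        div_le_div_of_nonneg_left (by norm_num) (by positivity)
          (pow_le_pow_right₀ hn1 (by norm_num))
  have e : (32 : ℝ) / (n : ℝ) ^ 4 = 22 / (n : ℝ) ^ 4 + 10 / (n : ℝ) ^ 4 := by ring
  rw [h2, e]
  linarith

end LoopBody

/-! ### The main loop -/

section EdgesIn

variable {V : Type*}

lemma mem_edgesIn {N : Finset (Sym2 V)} {A : Finset V} {e : Sym2 V} :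
    e ∈ edgesIn N A ↔ e ∈ N ∧ ∀ v ∈ e, v ∈ A := Finset.mem_filter

lemma edgesIn_eq_self {N : Finset (Sym2 V)} {A : Finset V} (h : ∀ v, v ∈ A) : edgesIn N A = N :=
  Finset.filter_true_of_mem fun _ _ v _ => h v

end EdgesIn

section MainLoop

variable {V : Type*} [Fintype V] {G : SimpleGraph V} {S : ℕ}

/-- The noise condition forces even the last scale on a machine to be at least 100 ln n, since ξ and
`muR` are below 1. So log₂ of the next threshold is nonnegative and can serve as a budget for
phases. -/
lemma LoopNumerics.one_le_next {n m τ : ℕ} {D ξ : ℝ} (hn : 2 ≤ n) (hD : 0 ≤ D)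
    (h : LoopNumerics n S m τ D ξ) : 1 ≤ D / 2 ^ τ := by
  have ha := alpha_pos hn
  have hm : (1 : ℝ) ≤ m := by exact_mod_cast h.one_le_m
  have hξ := h.pos
  have hξ1 : ξ ≤ 1 := by
    have h1 : (1 : ℝ) ≤ (120 * alpha n) ^ τ := one_le_pow₀ (by linarith)
    have h2 := h.small
    have h3 : ξ ≤ ξ * (120 * alpha n) ^ τ := le_mul_of_one_le_right hξ.le h1
    nlinarith
  have h0 : 0 ≤ D / m / 2 ^ τ := by positivity
  have h1 : ξ ^ 2 * (muR n * (D / m / 2 ^ τ)) ≤ 1 * (1 * (D / m / 2 ^ τ)) := by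
    have := muR_pos hn
    have := muR_le hn
    gcongr
    · exact pow_le_one₀ hξ.le hξ1
    · linarith
  have h2 : D / m / 2 ^ τ ≤ D / 2 ^ τ := by
    gcongr
    exact div_le_self hD hm
  have := h.scale
  have := log_pos_of_two_le hn
  linarith

/-- The matching found from the test of the main loop on is large compared to any matching between
the remaining vertices. -/
lemma card_edgesIn_le_ex_parallelLoop (ρ : OpenChoices V) (hn : 2 ≤ Fintype.card V) (hS : 1 ≤ S)
    (hSn : S ≤ Fintype.card V) {N : Finset (Sym2 V)} (hN : IsMatching G N) {D : ℝ} (hD1 : 1 ≤ D)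
    (hDn : D ≤ Fintype.card V) {A : Finset V}
    (hdeg : ∀ v ∈ A, (nbrCount G A v : ℝ) ≤ 3 / 2 * D) :
    ((edgesIn N A).card : ℝ) ≤
      400 * ex (parallelLoop ρ G S hn hS hSn D A) (fun M => (M.card : ℝ)) +
        2 * muR (Fintype.card V) * Real.logb 2 D * (edgesIn N A).card +
        Real.logb 2 D * (59 / (Fintype.card V : ℝ) ^ 4) := by
  induction hk : ⌊D⌋₊ using Nat.strong_induction_on generalizing D A with
  | _ k ih =>
  have hmu := muR_pos hn
  have hn0 : (0 : ℝ) < Fintype.card V := by exact_mod_cast (by omega : 0 < Fintype.card V)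
  by_cases hD : threshold (Fintype.card V) S ≤ D
  · obtain ⟨ξ, hL⟩ := exists_loopNumerics hn hS hSn hD hDn
    have hlt := floor_next_lt hn hS hSn hD
    have : NeZero (numMachines (Fintype.card V) S D) := ⟨(numMachines_pos hn hS hSn hD).ne'⟩
    have hD' := hL.one_le_next hn (by linarith)
    have hbody := card_edgesIn_le_ex_loopBody ρ hn hL hdeg hN
    have hbad := pr_loopBody_le ρ hn hL hdeg
    rw [parallelLoop_of_le ρ G hn hS hSn A hD]
    set τ := numPhases (Fintype.card V) S D
    set body := loopBody ρ G S (numMachines (Fintype.card V) S D) τ D A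
    have hτ1 : (1 : ℝ) ≤ τ := by exact_mod_cast hL.one_le_tau
    have h2τ : (1 : ℝ) ≤ 2 ^ τ := one_le_pow₀ (by norm_num)
    have hD'n : D / 2 ^ τ ≤ Fintype.card V := (div_le_self (by linarith) h2τ).trans hDn
    -- An iteration with τ phases uses up exactly τ units of log₂ D. This bounds the total cost of
    -- the reference sets.
    have hlogD : Real.logb 2 D = Real.logb 2 (D / 2 ^ τ) + τ := by
      rw [Real.logb_div (by linarith) (by positivity), Real.logb_pow, Real.logb_self_eq_one (by norm_num)]
      ring
    have hlog' : 0 ≤ Real.logb 2 (D / 2 ^ τ) := Real.logb_nonneg (by norm_num) hD'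
    set ℓ := Real.logb 2 (D / 2 ^ τ) with hℓ
    obtain ⟨good, hgood⟩ : ∃ good : Finset V × Finset (Sym2 V) → Prop, ∀ x, good x ↔
      ∀ v ∈ x.1, (nbrCount G x.1 v : ℝ) ≤ 3 / 2 * (D / 2 ^ τ) := ⟨_, fun _ => Iff.rfl⟩
    set rest : Finset V → ℝ := fun B =>
      ex (parallelLoop ρ G S hn hS hSn (D / 2 ^ τ) B) fun M => (M.card : ℝ) with hrest
    have hrest0 : ∀ B, 0 ≤ rest B := fun B => ex_nonneg fun _ _ => by positivity
    have hE0 : (0 : ℝ) ≤ (edgesIn N A).card := by positivity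
    have hstep : ex body (fun x =>
        ((edgesIn N x.1).card : ℝ) + 400 * (x.2.card : ℝ)) ≤
        ex body (fun x => 400 * (rest x.1 + x.2.card) +
          (2 * muR (Fintype.card V) * ℓ * (edgesIn N A).card + ℓ * (59 / (Fintype.card V : ℝ) ^ 4)) +
          Fintype.card V * if good x then 0 else 1) := by
      refine ex_mono fun x hx => ?_
      have hsub := (sound_of_mem_support_loopBody hx).1
      have hr := hrest0 x.1
      split_ifs with hg
      · have h1 := ih _ (hk ▸ hlt) hD' hD'n ((hgood x).1 hg) rfl
        have h2 : ((edgesIn N x.1).card : ℝ) ≤ (edgesIn N A).card := by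
          exact_mod_cast Finset.card_le_card (edgesIn_mono N hsub)
        have h3 : 2 * muR (Fintype.card V) * ℓ * (edgesIn N x.1).card ≤ 2 * muR (Fintype.card V) * ℓ * (edgesIn N A).card := by
          gcongr
        linarith
      · have h1 : ((edgesIn N x.1).card : ℝ) ≤ Fintype.card V := by
          exact_mod_cast card_edgesIn_le_card hN x.1
        have h2 : 0 ≤ 2 * muR (Fintype.card V) * ℓ * (edgesIn N A).card + ℓ * (59 / (Fintype.card V : ℝ) ^ 4) := by positivity
        linarith
    rw [ex_add, ex_add, ex_add, ex_const, ex_const_mul, ex_const_mul, ex_const_mul, ← pr_not] at hstep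
    rw [ex_add, ex_const_mul] at hbody
    have hnew : ex body (fun x => rest x.1 + x.2.card) =
        ex (body.bind fun x =>
          (parallelLoop ρ G S hn hS hSn (D / 2 ^ τ) x.1).map fun M => x.2 ∪ M)
          fun M => (M.card : ℝ) := by
      rw [ex_bind]
      refine ex_congr fun x hx => ?_
      rw [ex_map, hrest, ← ex_const (parallelLoop ρ G S hn hS hSn (D / 2 ^ τ) x.1) (x.2.card : ℝ),
        ← ex_add]
      refine ex_congr fun M hM => ?_
      have h3 : Sound G x.1 ∅ M := ⟨Finset.empty_subset _, by
        rw [Finset.sdiff_empty]; exact isMatching_of_mem_support_parallelLoop hM⟩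
      rw [((sound_of_mem_support_loopBody hx).trans h3).2]
      push_cast
      ring
    have hbad' : Fintype.card V * pr body (fun x => ¬ good x) ≤ 27 / (Fintype.card V : ℝ) ^ 4 := by
      have h1 : pr body (fun x => ¬ good x) ≤ 27 / (Fintype.card V : ℝ) ^ 5 := by
        refine le_trans (pr_mono ?_) hbad
        intro x _ h1 h2
        exact h1 ((hgood x).2 h2)
      calc _ ≤ Fintype.card V * (27 / (Fintype.card V : ℝ) ^ 5) := by gcongr
        _ = 27 / (Fintype.card V : ℝ) ^ 4 := by field_simp
    rw [hnew] at hstep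
    rw [hlogD]
    -- As τ ≥ 1, the additive errors of one iteration, 27/n^4 for failing degrees and 32/n^4 from
    -- the body, fit into its budget.
    have h59 : 59 / (Fintype.card V : ℝ) ^ 4 ≤ τ * (59 / (Fintype.card V : ℝ) ^ 4) :=
      le_mul_of_one_le_left (by positivity) hτ1
    have e : 59 / (Fintype.card V : ℝ) ^ 4 = 27 / (Fintype.card V : ℝ) ^ 4 + 32 / (Fintype.card V : ℝ) ^ 4 := by ring
    linarith
  · rw [parallelLoop_of_lt ρ G hn hS hSn A hD]
    have hlog : 0 ≤ Real.logb 2 D := Real.logb_nonneg (by norm_num) hD1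
    -- The degree invariant 3D/2 makes the final removal of vertices of degree at least 2D vacuous.
    have hA : (A.filter fun v => (nbrCount G A v : ℝ) < 2 * D) = A :=
      Finset.filter_true_of_mem fun v hv => by linarith [hdeg v hv]
    rw [hA]
    have h1 := card_edgesIn_le_ex_globalAlg ρ hN (G := G) (A := A) (D := 2 * D)
      fun v hv => by linarith [hdeg v hv]
    have h2 : 0 ≤ 2 * muR (Fintype.card V) * Real.logb 2 D * (edgesIn N A).card +
      Real.logb 2 D * (59 / (Fintype.card V : ℝ) ^ 4) := by positivity
    linarith

/-- One execution finds, in expectation, a constant fraction of a maximum matching. -/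
lemma card_le_ex_parallelAlg (ρ : OpenChoices V) (hn : 2 ≤ Fintype.card V) (hS : 1 ≤ S)
    (hSn : S ≤ Fintype.card V) {N : Finset (Sym2 V)} (hN : IsMatching G N) :
    (N.card : ℝ) ≤ 500 * ex (parallelAlg ρ G S hn hS hSn) fun M => (M.card : ℝ) := by
  have hn0 : (0 : ℝ) < Fintype.card V := by exact_mod_cast (by omega : 0 < Fintype.card V)
  have hdeg : ∀ v ∈ (Finset.univ : Finset V),
      (nbrCount G Finset.univ v : ℝ) ≤ Fintype.card V := fun v _ => by
    exact_mod_cast nbrCount_le_card G Finset.univ v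
  have hex : 0 ≤ ex (parallelAlg ρ G S hn hS hSn) fun M => (M.card : ℝ) :=
    ex_nonneg fun _ _ => by positivity
  -- If the loop runs at all, n is huge and the error terms are negligible; otherwise the run is
  -- just `globalAlg` on the whole graph.
  by_cases hD : threshold (Fintype.card V) S ≤ Fintype.card V
  · rcases N.eq_empty_or_nonempty with rfl | hne
    · simpa using hex
    have hN1 : (1 : ℝ) ≤ N.card := by exact_mod_cast hne.card_pos
    have h1 := card_edgesIn_le_ex_parallelLoop ρ hn hS hSn hN
      (D := Fintype.card V) (by exact_mod_cast (by omega : 1 ≤ Fintype.card V)) le_rfl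
      (A := Finset.univ) fun v hv => by linarith [hdeg v hv]
    rw [edgesIn_eq_self fun _ => Finset.mem_univ _] at h1
    change _ ≤ 400 * ex (parallelAlg ρ G S hn hS hSn) _ + _ + _ at h1
    set n := Fintype.card V
    have hpow := pow_le_of_threshold_le hn hS hD
    have hSn' : (S : ℝ) ≤ n := by exact_mod_cast hSn
    have hn' : (n : ℝ) * S / n ≤ n := by
      rw [div_le_iff₀ hn0]
      gcongr
    have hlog := log_ge_of_pow_le hn (hpow.trans hn')
    have hlogn : Real.log n ≤ n := Real.log_le_self hn0.le
    have hn100 : (100 : ℝ) ≤ n := by norm_num at hlog; linarith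
    have hl0 : 0 < Real.log n := by norm_num at hlog; linarith
    have hl2 := Real.log_two_gt_d9
    -- The ln n in `muR` cancels against log₂ n, leaving 2 · 10^(-6)/ln 2: the reference sets of all
    -- phases cost at most one percent of `N`.
    have hc : 2 * muR n * Real.logb 2 n ≤ 1 / 100 := by
      have : 2 * muR n * Real.logb 2 n = 2 / 10 ^ 6 / Real.log 2 := by
        rw [muR, Real.logb]
        field_simp
      rw [this, div_le_iff₀ (by linarith)]
      linarith
    have he : Real.logb 2 n * (59 / (n : ℝ) ^ 4) ≤ 1 / 100 := by
      have h2 : Real.logb 2 n ≤ 2 * n := by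
        rw [Real.logb, div_le_iff₀ (by linarith)]
        nlinarith
      calc _ ≤ 2 * n * (59 / (n : ℝ) ^ 4) := by gcongr
        _ = 118 / (n : ℝ) ^ 3 := by field_simp; norm_num
        _ ≤ 118 / 100 ^ 3 := by gcongr
        _ ≤ 1 / 100 := by norm_num
    have h3 : 2 * muR n * Real.logb 2 n * N.card ≤ 1 / 100 * N.card := by gcongr
    linarith
  · have hA : (Finset.univ.filter fun v => (nbrCount G Finset.univ v : ℝ) <
        2 * (Fintype.card V : ℝ)) = Finset.univ :=
      Finset.filter_true_of_mem fun v hv => by linarith [hdeg v hv]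
    have h1 := card_edgesIn_le_ex_globalAlg ρ hN (G := G) (A := Finset.univ)
      (D := 2 * (Fintype.card V : ℝ)) fun v hv => by linarith [hdeg v hv]
    rw [edgesIn_eq_self fun _ => Finset.mem_univ _] at h1
    rw [parallelAlg, parallelLoop_of_lt ρ G hn hS hSn _ hD, hA] at hex ⊢
    linarith

lemma isMatching_of_mem_support_parallelAlg {ρ : OpenChoices V} {hn : 2 ≤ Fintype.card V}
    {hS : 1 ≤ S} {hSn : S ≤ Fintype.card V} {M : Finset (Sym2 V)}
    (hM : M ∈ (parallelAlg ρ G S hn hS hSn).support) : IsMatching G M :=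
  (isMatching_of_mem_support_parallelLoop hM).mono (inducedOn_le G _)

end MainLoop

/-! ### Removing a matching -/

section RemoveMatching

variable {V : Type*}

lemma removeMatching_le (G : SimpleGraph V) (M : Finset (Sym2 V)) : removeMatching G M ≤ G :=
  fun _ _ h => h.1

lemma mem_edgeSet_removeMatching {G : SimpleGraph V} {M : Finset (Sym2 V)} {e : Sym2 V} :
    e ∈ (removeMatching G M).edgeSet ↔ e ∈ G.edgeSet ∧ ∀ v ∈ e, ∀ f ∈ M, v ∉ f := by
  induction e with
  | _ x y => simp [removeMatching]

lemma removeMatching_union (G : SimpleGraph V) (M M' : Finset (Sym2 V)) :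
    removeMatching G (M ∪ M') = removeMatching (removeMatching G M) M' := by
  ext u v
  simp only [removeMatching, Finset.mem_union]
  grind

lemma removeMatching_empty (G : SimpleGraph V) : removeMatching G ∅ = G := by
  ext u v
  simp [removeMatching]

lemma IsMatching.union_removeMatching {G : SimpleGraph V} {M M' : Finset (Sym2 V)}
    (hM : IsMatching G M) (hM' : IsMatching (removeMatching G M) M') :
    IsMatching G (M ∪ M') ∧ Disjoint M M' := by
  have key : ∀ e ∈ M, ∀ f ∈ M', ∀ v, v ∈ e → v ∈ f → False := fun e he f hf v hve hvf =>
    (mem_edgeSet_removeMatching.1 (hM'.1 f hf)).2 v hvf e he hve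
  refine ⟨⟨fun e he => ?_, fun e he f hf v hve hvf => ?_⟩, Finset.disjoint_left.2 fun e he he' => ?_⟩
  · rcases Finset.mem_union.1 he with h | h
    exacts [hM.1 e h, SimpleGraph.edgeSet_mono (removeMatching_le G M) (hM'.1 e h)]
  · rcases Finset.mem_union.1 he with h | h <;> rcases Finset.mem_union.1 hf with h' | h'
    · exact hM.2 e h f h' v hve hvf
    · exact (key e h f h' v hve hvf).elim
    · exact (key f h' e h v hvf hve).elim
    · exact hM'.2 e h f h' v hve hvf
  · induction e with
    | _ x y => exact key _ he _ he' x (Sym2.mem_mk_left x y) (Sym2.mem_mk_left x y)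

variable [Fintype V]

/-- The size of a maximum matching. -/
def matchingNumber (G : SimpleGraph V) : ℕ :=
  (Finset.univ.filter fun N : Finset (Sym2 V) => IsMatching G N).sup Finset.card

lemma IsMatching.card_le_matchingNumber {G : SimpleGraph V} {N : Finset (Sym2 V)}
    (hN : IsMatching G N) : N.card ≤ matchingNumber G :=
  Finset.le_sup (f := Finset.card) (Finset.mem_filter.2 ⟨Finset.mem_univ N, hN⟩)

lemma exists_isMatching_card_eq (G : SimpleGraph V) :
    ∃ N, IsMatching G N ∧ N.card = matchingNumber G := by
  obtain ⟨N, hN, h⟩ := Finset.exists_mem_eq_sup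
    (Finset.univ.filter fun N : Finset (Sym2 V) => IsMatching G N)
    ⟨∅, Finset.mem_filter.2 ⟨Finset.mem_univ _, isMatching_empty G⟩⟩ Finset.card
  exact ⟨N, (Finset.mem_filter.1 hN).2, h.symm⟩

lemma IsMatching.card_add_matchingNumber_le {G : SimpleGraph V} {M : Finset (Sym2 V)}
    (hM : IsMatching G M) : M.card + matchingNumber (removeMatching G M) ≤ matchingNumber G := by
  obtain ⟨N, hN, h⟩ := exists_isMatching_card_eq (removeMatching G M)
  obtain ⟨hu, hd⟩ := hM.union_removeMatching hN
  rw [← h, ← Finset.card_union_of_disjoint hd]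
  exact hu.card_le_matchingNumber

/-- Removing a matching with `k` edges decreases the matching number by at most `2 k`. -/
lemma matchingNumber_le (G : SimpleGraph V) (M : Finset (Sym2 V)) :
    matchingNumber G ≤ 2 * M.card + matchingNumber (removeMatching G M) := by
  obtain ⟨N, hN, h⟩ := exists_isMatching_card_eq G
  obtain ⟨U, hU, hU'⟩ := exists_vertices M
  have h1 := card_edgesIn_le hN (A := Finset.univ) (A' := Finset.univ \ U) U
    fun v _ hv _ => by simpa using hv
  rw [edgesIn_eq_self fun _ => Finset.mem_univ _] at h1
  have h2 : IsMatching (removeMatching G M) (edgesIn N (Finset.univ \ U)) := by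
    refine ⟨fun e he => mem_edgeSet_removeMatching.2 ⟨?_, fun v hv f hf hvf => ?_⟩,
      (isMatching_edgesIn hN _).2⟩
    · exact hN.1 e (mem_edgesIn.1 he).1
    · exact (Finset.mem_sdiff.1 ((mem_edgesIn.1 he).2 v hv)).2 ((hU' v).2 ⟨f, hf, hvf⟩)
  have h3 := h2.card_le_matchingNumber
  omega

end RemoveMatching

/-! ### Repeated executions -/

section Repetition

variable {V : Type*} [Fintype V] {S : ℕ}

lemma isMatching_of_mem_support_repeatedParallelAlg {ρ : OpenChoices V}
    {hn : 2 ≤ Fintype.card V} {hS : 1 ≤ S} {hSn : S ≤ Fintype.card V} {k : ℕ} {G : SimpleGraph V}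
    {M : Finset (Sym2 V)} (hM : M ∈ (repeatedParallelAlg ρ S hn hS hSn k G).support) :
    IsMatching G M := by
  induction k generalizing G M with
  | zero =>
    rw [repeatedParallelAlg, PMF.mem_support_pure_iff] at hM
    exact hM ▸ isMatching_empty G
  | succ k ih =>
    rw [repeatedParallelAlg, PMF.mem_support_bind_iff] at hM
    obtain ⟨M₁, hM₁, hM⟩ := hM
    rw [PMF.mem_support_map_iff] at hM
    obtain ⟨M₂, hM₂, rfl⟩ := hM
    exact ((isMatching_of_mem_support_parallelAlg hM₁).union_removeMatching (ih hM₂)).1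

/-- A run lowers the matching number of the rest by at least the size of the matching found, on
average at least 1/500 of the current value; fresh randomness lets the factors multiply. -/
lemma ex_matchingNumber_repeatedParallelAlg_le (ρ : OpenChoices V) (hn : 2 ≤ Fintype.card V)
    (hS : 1 ≤ S) (hSn : S ≤ Fintype.card V) (k : ℕ) (G : SimpleGraph V) :
    ex (repeatedParallelAlg ρ S hn hS hSn k G)
      (fun M => (matchingNumber (removeMatching G M) : ℝ)) ≤
      (499 / 500) ^ k * matchingNumber G := by
  induction k generalizing G with
  | zero => rw [repeatedParallelAlg, ex_pure, removeMatching_empty]; simp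
  | succ k ih =>
    obtain ⟨N, hN, hcard⟩ := exists_isMatching_card_eq G
    have h1 := card_le_ex_parallelAlg ρ hn hS hSn hN
    rw [hcard] at h1
    rw [repeatedParallelAlg, ex_bind]
    calc _ ≤ ex (parallelAlg ρ G S hn hS hSn) (fun M =>
          (499 / 500) ^ k * ((matchingNumber G : ℝ) - M.card)) := by
          refine ex_mono fun M hM => ?_
          rw [ex_map]
          simp only [removeMatching_union]
          refine (ih (removeMatching G M)).trans ?_
          have h2 : (M.card : ℝ) + matchingNumber (removeMatching G M) ≤ matchingNumber G := by
            exact_mod_cast (isMatching_of_mem_support_parallelAlg hM).card_add_matchingNumber_le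
          gcongr
          linarith
      _ = (499 / 500) ^ k * (matchingNumber G -
          ex (parallelAlg ρ G S hn hS hSn) fun M => (M.card : ℝ)) := by
          rw [ex_const_mul, ex_sub, ex_const]
      _ ≤ (499 / 500) ^ k * (499 / 500 * matchingNumber G) := by gcongr; linarith
      _ = _ := by ring

/-- With t = exp(-max(1, ln(1/ε))), which is at most ε and at most 1/2, the power is at most
exp(-1/500) to the 5000·max(1, ln(1/ε)), that is t^10 ≤ t/512. The factor 512 leaves ample room. -/
lemma pow_ceil_le {ε : ℝ} (hε : 0 < ε) :
    (499 / 500 : ℝ) ^ ⌈5000 * max 1 (Real.log (1 / ε))⌉₊ ≤ 1 / 2 * (ε / (2 + ε)) := by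
  set L := max 1 (Real.log (1 / ε)) with hL
  set t := Real.exp (-L) with ht
  have ht0 : 0 < t := Real.exp_pos _
  have htε : t ≤ ε := by
    rw [ht, ← Real.exp_log hε]
    refine Real.exp_le_exp.2 ?_
    have h := le_max_right 1 (Real.log (1 / ε))
    rw [one_div, Real.log_inv] at h
    rw [hL, one_div, Real.log_inv]
    linarith
  have ht2 : t ≤ 1 / 2 := by
    have h1 : t ≤ Real.exp (-1) := Real.exp_le_exp.2 (neg_le_neg (le_max_left _ _))
    have h2 := Real.exp_one_gt_d9
    rw [Real.exp_neg] at h1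
    refine h1.trans ?_
    rw [one_div]
    exact inv_anti₀ (by norm_num) (by linarith)
  have h1 : (499 / 500 : ℝ) ^ ⌈5000 * L⌉₊ ≤ t ^ 10 := by
    have h2 : (499 / 500 : ℝ) ≤ Real.exp (-(1 / 500)) := by
      have := Real.add_one_le_exp (-(1 / 500) : ℝ)
      linarith
    refine (pow_le_pow_left₀ (by norm_num) h2 _).trans ?_
    rw [ht, ← Real.exp_nat_mul, ← Real.exp_nat_mul]
    refine Real.exp_le_exp.2 ?_
    have := Nat.le_ceil (5000 * L)
    push_cast
    linarith
  have h2 : t ^ 10 ≤ t / 512 := by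
    have h3 : t ^ 9 ≤ (1 / 2) ^ 9 := by gcongr
    calc t ^ 10 = t * t ^ 9 := by ring
      _ ≤ t * (1 / 2) ^ 9 := by gcongr
      _ = t / 512 := by norm_num; ring
  have h3 : t / 512 ≤ 1 / 2 * (ε / (2 + ε)) := by
    rw [← mul_div_assoc, le_div_iff₀ (by linarith)]
    have : t * ε ≤ 1 / 2 * ε := by gcongr
    linarith
  linarith

/-- The fraction c = ε/(2+ε) satisfies (1 - c)(2 + ε)/2 = 1. If less than cν(G) remains, then (1 -
c)ν(G) ≤ 2|M|, which is the claimed ratio; Markov's inequality bounds the opposite event. -/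
lemma half_le_pr_repeatedParallelAlg (ρ : OpenChoices V) (hn : 2 ≤ Fintype.card V)
    (hS : 1 ≤ S) (hSn : S ≤ Fintype.card V) {ε : ℝ} (hε : 0 < ε) {k : ℕ}
    (hk : (499 / 500 : ℝ) ^ k ≤ 1 / 2 * (ε / (2 + ε))) (G : SimpleGraph V) :
    1 / 2 ≤ pr (repeatedParallelAlg ρ S hn hS hSn k G)
      (fun M => IsApproxMaximumMatching (2 + ε) G M) := by
  set q := repeatedParallelAlg ρ S hn hS hSn k G with hq
  set c := ε / (2 + ε) with hc
  have hc0 : 0 < c := by positivity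
  have happrox : ∀ M, IsMatching G M → (matchingNumber G : ℝ) ≤ (2 + ε) * M.card →
      IsApproxMaximumMatching (2 + ε) G M := fun M hM h =>
    ⟨hM, fun N hN => le_trans (by exact_mod_cast hN.card_le_matchingNumber) h⟩
  have hbad : pr q (fun M => ¬ IsApproxMaximumMatching (2 + ε) G M) ≤ 1 / 2 := by
    rcases (Nat.cast_nonneg (matchingNumber G) : (0 : ℝ) ≤ _).eq_or_lt with h0 | h0
    · rw [pr_eq_zero]
      · norm_num
      · intro M hM hcon
        exact hcon (happrox M (isMatching_of_mem_support_repeatedParallelAlg hM)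
          (h0.symm.le.trans (by positivity)))
    · have h1 : pr q (fun M => ¬ IsApproxMaximumMatching (2 + ε) G M) ≤
          pr q (fun M => c * (matchingNumber G : ℝ) ≤ matchingNumber (removeMatching G M)) := by
        refine pr_mono ?_
        intro M hM hcon
        by_contra! hlt
        -- An approximate matching is certified through ν(G) alone, which avoids any reference to a
        -- particular optimum.
        refine hcon (happrox M (isMatching_of_mem_support_repeatedParallelAlg hM) ?_)
        have h2 : (matchingNumber G : ℝ) ≤ 2 * M.card + matchingNumber (removeMatching G M) := by
          exact_mod_cast matchingNumber_le G M
        have h3 : (1 - c) * (matchingNumber G : ℝ) ≤ 2 * M.card := by linarith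
        have h4 : (2 + ε) / 2 * ((1 - c) * (matchingNumber G : ℝ)) ≤ (2 + ε) / 2 * (2 * M.card) := by gcongr
        have h5 : (2 + ε) / 2 * ((1 - c) * (matchingNumber G : ℝ)) = (matchingNumber G : ℝ) := by
          rw [hc]; field_simp; ring
        linarith
      refine h1.trans ((pr_le_ex_div (by positivity) fun _ _ => by positivity).trans ?_)
      rw [div_le_iff₀ (by positivity)]
      refine (ex_matchingNumber_repeatedParallelAlg_le ρ hn hS hSn k G).trans ?_
      rw [← mul_assoc]
      gcongr
  have hsum := ex_const q 1
  rw [ex_congr (g := fun M => (if IsApproxMaximumMatching (2 + ε) G M then (1 : ℝ) else 0) +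
    if IsApproxMaximumMatching (2 + ε) G M then 0 else 1)
    (fun M _ => by split_ifs <;> norm_num), ex_add, ← pr_not] at hsum
  change pr q _ + _ = 1 at hsum
  linarith

end Repetition

end

end RoundCompression

theorem mainTheorem8 :
    ∃ C p : ℝ, 0 < C ∧ 0 < p ∧
      ∀ ε : ℝ, 0 < ε →
      ∀ (V : Type*) [Fintype V] (ρ : RoundCompression.OpenChoices V) (G : SimpleGraph V) (S : ℕ)
        (hn : 2 ≤ Fintype.card V) (hS : 1 ≤ S) (hSn : S ≤ Fintype.card V),
        (∀ M ∈ (RoundCompression.repeatedParallelAlg ρ S hn hS hSn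
            ⌈C * max 1 (Real.log (1 / ε))⌉₊ G).support, RoundCompression.IsMatching G M) ∧
        ENNReal.ofReal p ≤
          (RoundCompression.repeatedParallelAlg ρ S hn hS hSn
            ⌈C * max 1 (Real.log (1 / ε))⌉₊ G).toOuterMeasure
            {M | RoundCompression.IsApproxMaximumMatching (2 + ε) G M} := by
  -- The factor 499/500 per run makes 5000 = 10 · 500 runs per unit of max(1, ln(1/ε)) ample, and
  -- Markov's inequality gives success probability 1/2.
  refine ⟨5000, 1 / 2, by norm_num, by norm_num, fun ε hε V _ ρ G S hn hS hSn =>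
    ⟨fun M hM => RoundCompression.isMatching_of_mem_support_repeatedParallelAlg hM, ?_⟩⟩
  rw [← RoundCompression.ofReal_pr]
  exact ENNReal.ofReal_le_ofReal (RoundCompression.half_le_pr_repeatedParallelAlg ρ hn hS hSn hε
    (RoundCompression.pow_ceil_le hε) G)
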